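/- Let $q,m\ge 1$ be integers with $q \mid m$. A symmetric matrix $A\in\mathbb{R}^{m\times m}$ is called $q$-block diagonal if $A=\mathrm{diag}(B_1,\dots,B_{m/q})$ with symmetric $q\times q$ matrices $B_j$. Let $\|\cdot\|_{\mathrm{op}}$ denote the largest singular value. There are an absolute constant $C$ and a deterministic real-RAM algorithm (unit-cost exact $+,-,\times,/,\sqrt{\cdot}$ and comparison on real numbers, unit-cost addition, subtraction and comparison on integers and unit-cost array access) with the following property. For all integers $n,m,q\ge 1$ with $q\mid m$ and $n\le qm$, given $q$-block diagonal matrices $A_1,\dots,A_n\in\mathbb{R}^{m\times m}$ with $\|A_i\|_{\mathrm{op}}\le 1$ for $i=1,\dots,n$, the algorithm computes a vector $x\in\{-1,1\}^n$ with $$\Big\|\sum_{i=1}^n x_iA_i\Big\|_{\mathrm{op}}\le C\sqrt{n\log\frac{2qm}{n}}$$ in time at most $C\,(n^5+n^4m^3)$. -/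

import Mathlib

/-! A real RAM, presented as a structured programming language.

A program is a finite piece of text, fixed once and for all inputs.  The memory holds arrays of
natural numbers (used for counters, indices and pointers) and arrays of real numbers; every array is
infinite and three-dimensional, and a scalar is an entry at position `(0, 0, 0)`.  The operations on
reals are exact `+ - * /`, square root and comparison, those on naturals are `+`, truncated `-` and
comparison.  Every operation, memory access, assignment and test takes one unit of time. -/

namespace RealRAM

/-- Index expressions.  `get a i j k` reads the entry `(i, j, k)` of the index array named `a`. -/
inductive IExpr where
  | lit (c : ℕ)
  | get (a : ℕ) (i j k : IExpr)
  | add (e f : IExpr)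
  | sub (e f : IExpr)

/-- Real expressions.  `get a i j k` reads the entry `(i, j, k)` of the real array named `a`;
`cast e` converts an index to a real number.  The only literals are rational numbers. -/
inductive RExpr where
  | lit (c : ℚ)
  | cast (e : IExpr)
  | get (a : ℕ) (i j k : IExpr)
  | add (e f : RExpr)
  | sub (e f : RExpr)
  | mul (e f : RExpr)
  | div (e f : RExpr)
  | sqrt (e : RExpr)

/-- Tests. -/
inductive Test where
  | ilt (e f : IExpr)
  | ieq (e f : IExpr)
  | rlt (e f : RExpr)
  | req (e f : RExpr)
  | not (b : Test)
  | and (b c : Test)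

/-- Programs. `iset a i j k e` and `rset a i j k e` assign the value of `e` to the entry
`(i, j, k)` of the index array, respectively real array, named `a`. -/
inductive Prog where
  | skip
  | iset (a : ℕ) (i j k : IExpr) (e : IExpr)
  | rset (a : ℕ) (i j k : IExpr) (e : RExpr)
  | seq (p r : Prog)
  | ite (b : Test) (p r : Prog)
  | while (b : Test) (p : Prog)

/-- The content of the memory: `ints a i j k` and `reals a i j k` are the entries `(i, j, k)` of the
arrays named `a`. -/
structure State where
  ints : ℕ → ℕ → ℕ → ℕ → ℕ
  reals : ℕ → ℕ → ℕ → ℕ → ℝ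

/-- Overwrite one entry of an array bank. -/
def write {α : Type} (M : ℕ → ℕ → ℕ → ℕ → α) (a i j k : ℕ) (v : α) : ℕ → ℕ → ℕ → ℕ → α :=
  fun a' i' j' k' => if a' = a ∧ i' = i ∧ j' = j ∧ k' = k then v else M a' i' j' k'

/-- Value of an index expression (`-` is truncated at `0`). -/
def IExpr.eval (σ : State) : IExpr → ℕ
  | lit c => c
  | get a i j k => σ.ints a (i.eval σ) (j.eval σ) (k.eval σ)
  | add e f => e.eval σ + f.eval σ
  | sub e f => e.eval σ - f.eval σ

/-- Number of elementary operations in an index expression. -/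
def IExpr.cost : IExpr → ℕ
  | lit _ => 1
  | get _ i j k => i.cost + j.cost + k.cost + 1
  | add e f => e.cost + f.cost + 1
  | sub e f => e.cost + f.cost + 1

/-- Value of a real expression.  Division by `0` and the square root of a negative number return `0`;
as a program can test its operands, this convention gives no additional power. -/
noncomputable def RExpr.eval (σ : State) : RExpr → ℝ
  | lit c => (c : ℝ)
  | cast e => (e.eval σ : ℝ)
  | get a i j k => σ.reals a (i.eval σ) (j.eval σ) (k.eval σ)
  | add e f => e.eval σ + f.eval σ
  | sub e f => e.eval σ - f.eval σ
  | mul e f => e.eval σ * f.eval σ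
  | div e f => e.eval σ / f.eval σ
  | sqrt e => Real.sqrt (e.eval σ)

/-- Number of elementary operations in a real expression. -/
def RExpr.cost : RExpr → ℕ
  | lit _ => 1
  | cast e => e.cost + 1
  | get _ i j k => i.cost + j.cost + k.cost + 1
  | add e f => e.cost + f.cost + 1
  | sub e f => e.cost + f.cost + 1
  | mul e f => e.cost + f.cost + 1
  | div e f => e.cost + f.cost + 1
  | sqrt e => e.cost + 1

/-- Truth of a test. -/
def Test.Holds (σ : State) : Test → Prop
  | ilt e f => e.eval σ < f.eval σ
  | ieq e f => e.eval σ = f.eval σ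
  | rlt e f => e.eval σ < f.eval σ
  | req e f => e.eval σ = f.eval σ
  | not b => ¬ b.Holds σ
  | and b c => b.Holds σ ∧ c.Holds σ

/-- Number of elementary operations in a test. -/
def Test.cost : Test → ℕ
  | ilt e f => e.cost + f.cost + 1
  | ieq e f => e.cost + f.cost + 1
  | rlt e f => e.cost + f.cost + 1
  | req e f => e.cost + f.cost + 1
  | not b => b.cost + 1
  | and b c => b.cost + c.cost + 1

/-- `Run p σ t τ`: started in memory `σ`, the program `p` halts after exactly `t` units of time, with
memory `τ`. -/
inductive Run : Prog → State → ℕ → State → Prop where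
  | skip (σ : State) : Run .skip σ 1 σ
  | iset (σ : State) (a : ℕ) (i j k : IExpr) (e : IExpr) :
      Run (.iset a i j k e) σ (i.cost + j.cost + k.cost + e.cost + 1)
        { σ with ints := write σ.ints a (i.eval σ) (j.eval σ) (k.eval σ) (e.eval σ) }
  | rset (σ : State) (a : ℕ) (i j k : IExpr) (e : RExpr) :
      Run (.rset a i j k e) σ (i.cost + j.cost + k.cost + e.cost + 1)
        { σ with reals := write σ.reals a (i.eval σ) (j.eval σ) (k.eval σ) (e.eval σ) }
  | seq {p r : Prog} {σ τ υ : State} {s t : ℕ} :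
      Run p σ s τ → Run r τ t υ → Run (.seq p r) σ (s + t) υ
  | ite_true {b : Test} {p r : Prog} {σ τ : State} {t : ℕ} :
      b.Holds σ → Run p σ t τ → Run (.ite b p r) σ (b.cost + 1 + t) τ
  | ite_false {b : Test} {p r : Prog} {σ τ : State} {t : ℕ} :
      ¬ b.Holds σ → Run r σ t τ → Run (.ite b p r) σ (b.cost + 1 + t) τ
  | while_true {b : Test} {p : Prog} {σ τ υ : State} {s t : ℕ} :
      b.Holds σ → Run p σ s τ → Run (.while b p) τ t υ →
      Run (.while b p) σ (b.cost + 1 + s + t) υ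
  | while_false {b : Test} {p : Prog} {σ : State} :
      ¬ b.Holds σ → Run (.while b p) σ (b.cost + 1) σ

/-- Programs are deterministic: the input determines both the running time and the result. -/
theorem Run.deterministic {p : Prog} {σ τ τ' : State} {t t' : ℕ}
    (h : Run p σ t τ) (h' : Run p σ t' τ') : t = t' ∧ τ = τ' := by
  induction h generalizing t' τ' with
  | skip => cases h'; exact ⟨rfl, rfl⟩
  | iset => cases h'; exact ⟨rfl, rfl⟩
  | rset => cases h'; exact ⟨rfl, rfl⟩
  | seq _ _ ih₁ ih₂ =>
    cases h' with
    | seq h₁ h₂ =>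
      obtain ⟨rfl, rfl⟩ := ih₁ h₁
      obtain ⟨rfl, rfl⟩ := ih₂ h₂
      exact ⟨rfl, rfl⟩
  | ite_true hb _ ih =>
    cases h' with
    | ite_true _ h₁ => obtain ⟨rfl, rfl⟩ := ih h₁; exact ⟨rfl, rfl⟩
    | ite_false hb' _ => exact absurd hb hb'
  | ite_false hb _ ih =>
    cases h' with
    | ite_true hb' _ => exact absurd hb' hb
    | ite_false _ h₁ => obtain ⟨rfl, rfl⟩ := ih h₁; exact ⟨rfl, rfl⟩
  | while_true hb _ _ ih₁ ih₂ =>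
    cases h' with
    | while_true _ h₁ h₂ =>
      obtain ⟨rfl, rfl⟩ := ih₁ h₁
      obtain ⟨rfl, rfl⟩ := ih₂ h₂
      exact ⟨rfl, rfl⟩
    | while_false hb' => exact absurd hb hb'
  | while_false hb =>
    cases h' with
    | while_true hb' _ _ => exact absurd hb' hb
    | while_false _ => exact ⟨rfl, rfl⟩

end RealRAM

/-- The memory that encodes the input `(n, m, q, A₁, …, Aₙ)`: the scalars named `0`, `1`, `2` hold
`n`, `m`, `q`, the entry `(i, j, k)` of the real array `0` is the entry `(j, k)` of the `i`-th matrix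
(counting from `0`), and everything else is `0`. -/
def balancingInput {n m : ℕ} (q : ℕ) (A : Fin n → Matrix (Fin m) (Fin m) ℝ) : RealRAM.State where
  ints := fun a i j k =>
    if i = 0 ∧ j = 0 ∧ k = 0 then
      if a = 0 then n else if a = 1 then m else if a = 2 then q else 0
    else 0
  reals := fun a i j k =>
    if h : a = 0 ∧ i < n ∧ j < m ∧ k < m then
      A ⟨i, h.2.1⟩ ⟨j, h.2.2.1⟩ ⟨k, h.2.2.2⟩
    else 0

/-- The vector that a halted program outputs: the entries `(i, 0, 0)`, `i < n`, of the real
array `1`. -/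
def outputVector (n : ℕ) (σ : RealRAM.State) : Fin n → ℝ := fun i => σ.reals 1 i 0 0

/-- A real `m × m` matrix is `q`-block diagonal if it is `diag(B₁, …, B_{m/q})` with symmetric
`q × q` blocks: `q` divides `m`, the matrix is symmetric, and each nonzero entry has its row and its
column in the same block of `q` consecutive indices. -/
def IsQBlockDiagonal {m : ℕ} (q : ℕ) (A : Matrix (Fin m) (Fin m) ℝ) : Prop :=
  q ∣ m ∧ A.IsSymm ∧ ∀ i j : Fin m, (i : ℕ) / q ≠ (j : ℕ) / q → A i j = 0

/-- The operator norm of a matrix with respect to the Euclidean norm (largest singular value). -/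
noncomputable def matrixOpNorm {m : ℕ} (A : Matrix (Fin m) (Fin m) ℝ) : ℝ :=
  ‖Matrix.toEuclideanCLM (n := Fin m) (𝕜 := ℝ) A‖

/-! The vector `x` walks from `0` to a corner of the cube while a barrier controls the largest
eigenvalue. Put `D i = A i ⊕ -A i`, of size `w = 2 m`; the operator norm of `∑ x i • A i` is then
the largest eigenvalue of `∑ x i • D i`. Coordinates that reach `±1` are frozen, the others are
live, and the walk stops when at most one is live; that one is rounded at the cost of a constant. If
`q m > 2 ^ n n`, no walk is needed: the logarithm is at least `n log 2`, and the all-ones vector is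
good enough by the triangle inequality.

The walk is cut into phases. A phase that starts at `xs` with `N` live coordinates uses an exponent
`p`, a power of two of order `log (q m / N)`, the initial level `u₀ = √(432 p N)`, the level `u = u₀
+ (432 p / u₀) (|x|² - |xs|²)` and the slack `G = u - ∑ (x i - xs i) • D i`. The invariant is that
`G` is positive definite and `tr G⁻ᵖ` is at most its initial value `w / u₀ ^ p`. Since `|x|² - |xs|²
≤ N`, the level never exceeds `2 u₀ = O(√(N log (q m / N)))`, which bounds the discrepancy added by
the phase. A new phase starts when fewer than `N / 2` coordinates are live, so these bounds form a
geometric series (`Progress.past_of_lt_half`).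

A step adds a small vector to `x`. With `R = G⁻¹` and `Y` the resulting change of `∑ x i • D i`, the
potential does not grow if `tr (R ^ (p + 1) Y) ≤ 0`, which the sign of the step provides, and if `tr
(R ^ (p + 1) Y R Y)` is small against the rise of the level (`PosDef.trace_inv_pow_barrier_le`,
which rests on a Lieb–Thirring inequality). Such a direction exists by `exists_small_direction`: by
the bound on the potential at most `w / 2 ^ p` eigenvalues of `R` exceed `2 / u₀`; their
eigenvectors can be chosen inside single blocks, so that a block diagonal `Y` annihilates all of
them under at most `q w / 2 ^ p` linear conditions, fewer than half the number of live coordinates.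
On the remaining subspace `R` acts like `2 / u₀`, and averaging produces a good direction. This is
where the block size enters.

The program never computes eigenvectors. It minimises the regularised quadratic form with one
coordinate fixed to `1`, which takes one matrix inversion and does at least as well
(`redDir_gram_le`). The direction is kept orthogonal to `x`, so `|x|²` grows by the squared length
of the step. Every step either raises `|x|²` by `1 / (1024 n min(n, m))` or freezes a coordinate;
hence there are `O(n² min(n, m))` steps, each of cost `O(n m³ + n² m² + n³)`, and `n ≤ q m ≤ m²`
gives the running time. -/

namespace RealRAM

/-! ### Weakest preconditions with running time -/

/-- Started in `σ`, the program `p` halts within time `t` in a state satisfying `Q`. -/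
def WP (p : Prog) (σ : State) (t : ℕ) (Q : State → Prop) : Prop :=
  ∃ T τ, Run p σ T τ ∧ T ≤ t ∧ Q τ

theorem WP.mono {p : Prog} {σ : State} {t t' : ℕ} {Q Q' : State → Prop}
    (h : WP p σ t Q) (ht : t ≤ t') (hQ : ∀ τ, Q τ → Q' τ) : WP p σ t' Q' := by
  obtain ⟨T, τ, hr, hT, hq⟩ := h
  exact ⟨T, τ, hr, hT.trans ht, hQ τ hq⟩

theorem WP.seq {p r : Prog} {σ : State} {s t : ℕ} {Q : State → Prop}
    (h : WP p σ s (fun τ => WP r τ t Q)) : WP (.seq p r) σ (s + t) Q := by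
  obtain ⟨T, τ, hr, hT, T', υ, hr', hT', hq⟩ := h
  exact ⟨T + T', υ, hr.seq hr', by omega, hq⟩

theorem WP.seq_le {p r : Prog} {σ : State} {T : ℕ} {Q : State → Prop} (s t : ℕ) (hst : s + t ≤ T)
    (h : WP p σ s (fun τ => WP r τ t Q)) : WP (.seq p r) σ T Q :=
  (WP.seq h).mono hst (fun _ h => h)

theorem WP.skip {σ : State} {t : ℕ} {Q : State → Prop} (ht : 1 ≤ t) (h : Q σ) :
    WP .skip σ t Q :=
  ⟨1, σ, .skip σ, ht, h⟩

theorem WP.ite {b : Test} {p r : Prog} {σ : State} {t : ℕ} {Q : State → Prop}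
    (h₁ : b.Holds σ → WP p σ t Q) (h₂ : ¬ b.Holds σ → WP r σ t Q) :
    WP (.ite b p r) σ (b.cost + 1 + t) Q := by
  by_cases hb : b.Holds σ
  · obtain ⟨T, τ, hr, hT, hq⟩ := h₁ hb
    exact ⟨_, τ, .ite_true hb hr, by omega, hq⟩
  · obtain ⟨T, τ, hr, hT, hq⟩ := h₂ hb
    exact ⟨_, τ, .ite_false hb hr, by omega, hq⟩

theorem WP.iset {a : ℕ} {i j k e : IExpr} {σ : State} {t : ℕ} {Q : State → Prop}
    (ht : i.cost + j.cost + k.cost + e.cost + 1 ≤ t)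
    (h : Q { σ with ints := write σ.ints a (i.eval σ) (j.eval σ) (k.eval σ) (e.eval σ) }) :
    WP (.iset a i j k e) σ t Q :=
  ⟨_, _, .iset σ a i j k e, ht, h⟩

/-- A loop whose body decreases a real-valued measure by at least one. -/
theorem WP.whileLoop {b : Test} {p : Prog} {t : ℕ} {I : State → Prop} {ν : State → ℝ}
    (hν : ∀ τ, I τ → 0 ≤ ν τ)
    (hs : ∀ τ, I τ → b.Holds τ → WP p τ t (fun υ => I υ ∧ ν υ + 1 ≤ ν τ))
    {σ : State} {K : ℕ} (h0 : I σ) (hK : ν σ ≤ K) :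
    WP (.while b p) σ (K * (t + b.cost + 1) + b.cost + 1) (fun τ => I τ ∧ ¬ b.Holds τ) := by
  induction K generalizing σ with
  | zero =>
    have hb : ¬ b.Holds σ := by
      intro hb
      obtain ⟨_, υ, _, _, hI, hυ⟩ := hs σ h0 hb
      have := hν υ hI
      push_cast at hK
      linarith
    exact ⟨_, σ, .while_false hb, by omega, h0, hb⟩
  | succ K ih =>
    by_cases hb : b.Holds σ
    · obtain ⟨T, υ, hr, hT, hI, hυ⟩ := hs σ h0 hb
      obtain ⟨T', τ, hr', hT', hq⟩ := ih hI (by push_cast at hK; linarith)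
      refine ⟨_, τ, .while_true hb hr hr', ?_, hq⟩
      have : (K + 1) * (t + b.cost + 1) = K * (t + b.cost + 1) + (t + b.cost + 1) := by ring
      omega
    · exact ⟨_, σ, .while_false hb, by omega, h0, hb⟩

/-! ### Scalars, counting loops, frames -/

/-- The index scalar named `a`. -/
abbrev IExpr.var (a : ℕ) : IExpr := .get a (.lit 0) (.lit 0) (.lit 0)

/-- The real scalar named `a`. -/
abbrev RExpr.var (a : ℕ) : RExpr := .get a (.lit 0) (.lit 0) (.lit 0)

/-- Assign to an index scalar. -/
abbrev Prog.setI (a : ℕ) (e : IExpr) : Prog := .iset a (.lit 0) (.lit 0) (.lit 0) e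

/-- Assign to a real scalar. -/
abbrev Prog.setR (a : ℕ) (e : RExpr) : Prog := .rset a (.lit 0) (.lit 0) (.lit 0) e

/-- The state in which the index scalar `a` has been set to `v`. -/
def State.setInt (σ : State) (a v : ℕ) : State := { σ with ints := write σ.ints a 0 0 0 v }

/-- The state in which the real entry `(i, j, k)` of the array `a` has been set to `v`. -/
def State.setReal (σ : State) (a i j k : ℕ) (v : ℝ) : State :=
  { σ with reals := write σ.reals a i j k v }

@[simp] theorem State.setInt_reals (σ : State) (a v : ℕ) : (σ.setInt a v).reals = σ.reals := rfl

@[simp] theorem State.setReal_ints (σ : State) (a i j k : ℕ) (v : ℝ) :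
    (σ.setReal a i j k v).ints = σ.ints := rfl

@[simp] theorem State.setInt_same (σ : State) (a v : ℕ) : (σ.setInt a v).ints a 0 0 0 = v := by
  simp [State.setInt, write]

theorem State.setInt_ne (σ : State) {a b : ℕ} (v : ℕ) (h : b ≠ a) :
    (σ.setInt a v).ints b = σ.ints b := by
  funext i j k; simp [State.setInt, write, h]

theorem State.setReal_ne (σ : State) {a b : ℕ} (i j k : ℕ) (v : ℝ) (h : b ≠ a) :
    (σ.setReal a i j k v).reals b = σ.reals b := by
  funext i j k; simp [State.setReal, write, h]

theorem State.setReal_apply (σ : State) (a i j k i' j' k' : ℕ) (v : ℝ) :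
    (σ.setReal a i j k v).reals a i' j' k' =
      if i' = i ∧ j' = j ∧ k' = k then v else σ.reals a i' j' k' := by
  simp [State.setReal, write]

theorem WP.rset {a : ℕ} {i j k : IExpr} {e : RExpr} {σ : State} {t : ℕ} {Q : State → Prop}
    (ht : i.cost + j.cost + k.cost + e.cost + 1 ≤ t)
    (h : Q (σ.setReal a (i.eval σ) (j.eval σ) (k.eval σ) (e.eval σ))) :
    WP (.rset a i j k e) σ t Q :=
  ⟨_, _, .rset σ a i j k e, ht, h⟩

theorem WP.setI {a : ℕ} {e : IExpr} {σ : State} {t : ℕ} {Q : State → Prop}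
    (ht : e.cost + 4 ≤ t) (h : Q (σ.setInt a (e.eval σ))) : WP (.setI a e) σ t Q :=
  WP.iset (by simp only [IExpr.cost]; omega) h

theorem WP.setR {a : ℕ} {e : RExpr} {σ : State} {t : ℕ} {Q : State → Prop}
    (ht : e.cost + 4 ≤ t) (h : Q (σ.setReal a 0 0 0 (e.eval σ))) : WP (.setR a e) σ t Q :=
  WP.rset (by simp only [IExpr.cost]; omega) h

/-- `for v = 0, …, e - 1 do body`. -/
def Prog.for (v : ℕ) (e : IExpr) (body : Prog) : Prog :=
  .seq (.setI v (.lit 0))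
    (.while (.ilt (.var v) e) (.seq body (.setI v (.add (.var v) (.lit 1)))))

theorem WP.for {v : ℕ} {e : IExpr} {body : Prog} {σ : State} {N t : ℕ} {I : ℕ → State → Prop}
    (h0 : I 0 (σ.setInt v 0))
    (he : ∀ k ≤ N, ∀ τ, I k τ → e.eval τ = N)
    (hs : ∀ k < N, ∀ τ, I k τ → τ.ints v 0 0 0 = k →
      WP body τ t (fun υ => υ.ints v 0 0 0 = k ∧ I (k + 1) (υ.setInt v (k + 1)))) :
    WP (.for v e body) σ (N * (t + e.cost + 20) + e.cost + 20) (fun τ => I N τ) := by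
  have key : ∀ d k τ, k + d = N → I k τ → τ.ints v 0 0 0 = k →
      WP (.while (.ilt (.var v) e) (.seq body (.setI v (.add (.var v) (.lit 1))))) τ
        (d * (t + e.cost + 20) + e.cost + 10) (fun τ => I N τ) := by
    intro d
    induction d with
    | zero =>
      intro k τ hk hI hv
      obtain rfl : k = N := by omega
      refine ⟨_, τ, .while_false ?_, ?_, hI⟩
      · simp [Test.Holds, IExpr.eval, hv, he k le_rfl τ hI]
      · simp only [Test.cost, IExpr.cost]; omega
    | succ d ih =>
      intro k τ hk hI hv
      obtain ⟨T, υ, hr, hT, hυ, hI'⟩ := hs k (by omega) τ hI hv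
      obtain ⟨T', ρ, hr', hT', hq⟩ := ih (k + 1) _ (by omega) hI' (by simp)
      have hset : Run (.setI v (.add (.var v) (.lit 1))) υ 10 (υ.setInt v (k + 1)) := by
        have := Run.iset υ v (.lit 0) (.lit 0) (.lit 0) (.add (.var v) (.lit 1))
        simpa [IExpr.eval, IExpr.cost, hυ, State.setInt] using this
      refine ⟨_, ρ, .while_true ?_ (hr.seq hset) hr', ?_, hq⟩
      · simp [Test.Holds, IExpr.eval, hv, he k (by omega) τ hI]; omega
      · simp only [Test.cost, IExpr.cost]
        have : (d + 1) * (t + e.cost + 20) = d * (t + e.cost + 20) + (t + e.cost + 20) := by ring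
        omega
  refine (WP.seq (s := 5) (t := N * (t + e.cost + 20) + e.cost + 10) ?_).mono (by omega)
    (fun _ h => h)
  exact WP.setI (by simp [IExpr.cost]) (key N 0 _ (by omega) h0 (by simp [IExpr.eval]))

/-- The states `σ` and `τ` agree outside the index arrays in `is` and the real arrays in `rs`. -/
def Frame (is rs : List ℕ) (σ τ : State) : Prop :=
  (∀ b, b ∉ is → τ.ints b = σ.ints b) ∧ ∀ b, b ∉ rs → τ.reals b = σ.reals b

theorem Frame.refl (is rs : List ℕ) (σ : State) : Frame is rs σ σ :=
  ⟨fun _ _ => rfl, fun _ _ => rfl⟩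

theorem Frame.trans {is rs is' rs' : List ℕ} {σ τ υ : State} (h : Frame is rs σ τ)
    (h' : Frame is' rs' τ υ) : Frame (is ++ is') (rs ++ rs') σ υ := by
  refine ⟨fun b hb => ?_, fun b hb => ?_⟩ <;> rw [List.mem_append, not_or] at hb
  · rw [h'.1 b hb.2, h.1 b hb.1]
  · rw [h'.2 b hb.2, h.2 b hb.1]

theorem Frame.weaken {is rs is' rs' : List ℕ} {σ τ : State} (h : Frame is rs σ τ)
    (hi : is ⊆ is') (hr : rs ⊆ rs') : Frame is' rs' σ τ :=
  ⟨fun b hb => h.1 b fun h' => hb (hi h'), fun b hb => h.2 b fun h' => hb (hr h')⟩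

theorem Frame.comp {is rs : List ℕ} {σ τ υ : State} (h : Frame is rs σ τ)
    (h' : Frame is rs τ υ) : Frame is rs σ υ :=
  (h.trans h').weaken (by simp) (by simp)

theorem Frame.setInt {is rs : List ℕ} {σ τ : State} (h : Frame is rs σ τ) {a : ℕ} (v : ℕ)
    (ha : a ∈ is) : Frame is rs σ (τ.setInt a v) :=
  ⟨fun b hb => by rw [State.setInt_ne _ _ (by rintro rfl; exact hb ha), h.1 b hb],
    fun b hb => by rw [State.setInt_reals, h.2 b hb]⟩

theorem Frame.setReal {is rs : List ℕ} {σ τ : State} (h : Frame is rs σ τ) {a : ℕ} (i j k : ℕ)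
    (v : ℝ) (ha : a ∈ rs) : Frame is rs σ (τ.setReal a i j k v) :=
  ⟨fun b hb => by rw [State.setReal_ints, h.1 b hb],
    fun b hb => by rw [State.setReal_ne _ _ _ _ _ (by rintro rfl; exact hb ha), h.2 b hb]⟩

/-- The index arrays that a program may write. -/
def Prog.intsW : Prog → List ℕ
  | skip => []
  | iset a _ _ _ _ => [a]
  | rset _ _ _ _ _ => []
  | seq p r => p.intsW ++ r.intsW
  | ite _ p r => p.intsW ++ r.intsW
  | .while _ p => p.intsW

/-- The real arrays that a program may write. -/
def Prog.realsW : Prog → List ℕ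
  | skip => []
  | iset _ _ _ _ _ => []
  | rset a _ _ _ _ => [a]
  | seq p r => p.realsW ++ r.realsW
  | ite _ p r => p.realsW ++ r.realsW
  | .while _ p => p.realsW

/-- Write sets are read off from the program text. Everything outside them survives a subroutine for
free, and the inclusions of write sets needed later are settled by `decide`. -/
theorem Run.frame {p : Prog} {σ τ : State} {t : ℕ} (h : Run p σ t τ) :
    Frame p.intsW p.realsW σ τ := by
  induction h with
  | skip σ => exact Frame.refl _ _ σ
  | iset σ a i j k e =>
    refine ⟨fun b hb => ?_, fun b _ => rfl⟩
    have : b ≠ a := by simpa [Prog.intsW] using hb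
    funext x y z; simp [write, this]
  | rset σ a i j k e =>
    refine ⟨fun b _ => rfl, fun b hb => ?_⟩
    have : b ≠ a := by simpa [Prog.realsW] using hb
    funext x y z; simp [write, this]
  | seq _ _ ih₁ ih₂ => exact ih₁.trans ih₂
  | ite_true _ _ ih =>
    exact ih.weaken (List.subset_append_left _ _) (List.subset_append_left _ _)
  | ite_false _ _ ih =>
    exact ih.weaken (List.subset_append_right _ _) (List.subset_append_right _ _)
  | while_true _ _ _ ih₁ ih₂ => exact ih₁.comp ih₂
  | while_false _ => exact Frame.refl _ _ _

theorem WP.frame {p : Prog} {σ : State} {t : ℕ} {Q : State → Prop} (h : WP p σ t Q) :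
    WP p σ t (fun τ => Q τ ∧ Frame p.intsW p.realsW σ τ) := by
  obtain ⟨T, τ, hr, hT, hq⟩ := h
  exact ⟨T, τ, hr, hT, hq, hr.frame⟩

/-- `a[i, j, k] := ∑ l < e, r` for all `i < e₁`, `j < e₂`, `k < e₃`; the expression `r` finds
`i`, `j`, `k`, `l` in the index scalars `10`, `11`, `12`, `13`. -/
def Prog.tab (a : ℕ) (e₁ e₂ e₃ e : IExpr) (r : RExpr) : Prog :=
  .for 10 e₁ (.for 11 e₂ (.for 12 e₃ (.seq (.setR 40 (.lit 0))
    (.seq (.for 13 e (.setR 40 (.add (.var 40) r)))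
      (.rset a (.var 10) (.var 11) (.var 12) (.var 40))))))

theorem WP.tabNat {a : ℕ} {e₁ e₂ e₃ e : IExpr} {r : RExpr} {σ : State} {n₁ n₂ n₃ n : ℕ}
    {f : ℕ → ℕ → ℕ → ℕ → ℝ} (ha : a ≠ 40)
    (h₁ : ∀ τ, Frame [10, 11, 12, 13] [a, 40] σ τ → e₁.eval τ = n₁)
    (h₂ : ∀ τ, Frame [10, 11, 12, 13] [a, 40] σ τ → e₂.eval τ = n₂)
    (h₃ : ∀ τ, Frame [10, 11, 12, 13] [a, 40] σ τ → e₃.eval τ = n₃)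
    (h : ∀ τ, Frame [10, 11, 12, 13] [a, 40] σ τ → e.eval τ = n)
    (hr : ∀ τ i j k l, Frame [10, 11, 12, 13] [a, 40] σ τ → i < n₁ → j < n₂ → k < n₃ → l < n →
      τ.ints 10 0 0 0 = i → τ.ints 11 0 0 0 = j → τ.ints 12 0 0 0 = k → τ.ints 13 0 0 0 = l →
      r.eval τ = f i j k l) :
    WP (.tab a e₁ e₂ e₃ e r) σ
      (n₁ * (n₂ * (n₃ * (n * (r.cost + e.cost + 40) + e.cost + e₃.cost + 80) +
        e₃.cost + e₂.cost + 40) + e₂.cost + e₁.cost + 40) + e₁.cost + 20)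
      (fun τ => Frame [10, 11, 12, 13] [a, 40] σ τ ∧ ∀ i < n₁, ∀ j < n₂, ∀ k < n₃,
        τ.reals a i j k = ∑ l ∈ Finset.range n, f i j k l) := by
  -- `D P` says that the entries selected by `P` are already correct. The three loops use it with
  -- `P` an initial segment of the lexicographic order on `(i, j, k)`.
  let D : (ℕ → ℕ → ℕ → Prop) → State → Prop := fun P τ =>
    Frame [10, 11, 12, 13] [a, 40] σ τ ∧ ∀ i < n₁, ∀ j < n₂, ∀ k < n₃, P i j k →
      τ.reals a i j k = ∑ l ∈ Finset.range n, f i j k l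
  have hD : ∀ {P P' : ℕ → ℕ → ℕ → Prop} {τ : State}, D P τ →
      (∀ i j k, j < n₂ → k < n₃ → P' i j k → P i j k) → D P' τ := fun h h' =>
    ⟨h.1, fun i hi j hj k hk hp => h.2 i hi j hj k hk (h' i j k hj hk hp)⟩
  have hDs : ∀ {P : ℕ → ℕ → ℕ → Prop} {τ : State} {v x : ℕ}, D P τ → v ∈ [10, 11, 12, 13] →
      D P (τ.setInt v x) := fun h hv => ⟨h.1.setInt _ hv, h.2⟩
  have hne : ∀ (τ : State) (v x b : ℕ), b ≠ v → (τ.setInt v x).ints b 0 0 0 = τ.ints b 0 0 0 :=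
    fun τ v x b hb => by rw [State.setInt_ne _ _ hb]
  refine ((WP.for (N := n₁) (t := n₂ * (n₃ * (n * (r.cost + e.cost + 40) + e.cost + e₃.cost + 80) +
        e₃.cost + e₂.cost + 40) + e₂.cost + 20) (I := fun x τ => D (fun i _ _ => i < x) τ)
    (hDs ⟨Frame.refl _ _ _, by simp⟩ (by simp)) (fun _ _ τ hτ => h₁ τ hτ.1) ?_).mono
    ?_ (fun τ hτ => ⟨hτ.1, fun i hi j hj k hk => hτ.2 i hi j hj k hk hi⟩))
  swap
  · gcongr ?_ + _ + _; apply Nat.mul_le_mul_left; omega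
  intro x hx τ hτ hτx
  refine ((WP.for (N := n₂) (t := n₃ * (n * (r.cost + e.cost + 40) + e.cost + e₃.cost + 80) +
        e₃.cost + 20) (I := fun y τ => τ.ints 10 0 0 0 = x ∧
        D (fun i j _ => i < x ∨ i = x ∧ j < y) τ)
    ?_ (fun _ _ τ hτ => h₂ τ hτ.2.1) ?_).mono
    ?_ (fun τ hτ => ⟨hτ.1, hDs (hD hτ.2 fun i j k hj hk hi => ?_) (by simp)⟩))
  · refine ⟨by rw [hne _ _ _ _ (by simp), hτx], hDs (hD hτ fun i j k hj hk hi => ?_) (by simp)⟩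
    omega
  rotate_left
  · gcongr ?_ + _ + _; apply Nat.mul_le_mul_left; omega
  · omega
  intro y hy τ hτ hτy
  refine ((WP.for (N := n₃) (t := n * (r.cost + e.cost + 40) + e.cost + 60)
      (I := fun z τ => τ.ints 10 0 0 0 = x ∧ τ.ints 11 0 0 0 = y ∧
        D (fun i j k => i < x ∨ i = x ∧ (j < y ∨ j = y ∧ k < z)) τ)
    ?_ (fun _ _ τ hτ => h₃ τ hτ.2.2.1) ?_).mono
    ?_ (fun τ hτ => ⟨hτ.2.1, by rw [hne _ _ _ _ (by simp), hτ.1],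
      hDs (hD hτ.2.2 fun i j k hj hk hi => ?_) (by simp)⟩))
  · refine ⟨by rw [hne _ _ _ _ (by simp), hτ.1], by rw [hne _ _ _ _ (by simp), hτy],
      hDs (hD hτ.2 fun i j k hj hk hi => ?_) (by simp)⟩
    omega
  rotate_left
  · gcongr ?_ + _ + _; apply Nat.mul_le_mul_left; omega
  · omega
  intro z hz τ hτ hτz
  refine (WP.seq (s := 5) (t := n * (r.cost + e.cost + 40) + e.cost + 50) ?_).mono (by omega)
    (fun _ h => h)
  refine WP.setR (by simp [RExpr.cost]) ?_
  refine (WP.seq (s := n * (r.cost + e.cost + 40) + e.cost + 20) (t := 20) ?_).mono (by omega)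
    (fun _ h => h)
  have hτ0 : ∀ {τ' : State} {v : ℝ} {P}, D P τ' → D P (τ'.setReal 40 0 0 0 v) := fun hτ' =>
    ⟨hτ'.1.setReal _ _ _ _ (by simp), fun i hi j hj k hk hp => by
      rw [State.setReal_ne _ _ _ _ _ ha]; exact hτ'.2 i hi j hj k hk hp⟩
  refine ((WP.for (N := n) (t := r.cost + 10)
      (I := fun u τ => τ.ints 10 0 0 0 = x ∧ τ.ints 11 0 0 0 = y ∧ τ.ints 12 0 0 0 = z ∧
        τ.reals 40 0 0 0 = ∑ l ∈ Finset.range u, f x y z l ∧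
        D (fun i j k => i < x ∨ i = x ∧ (j < y ∨ j = y ∧ k < z)) τ)
    ?_ (fun _ _ τ hτ => h τ hτ.2.2.2.2.1) ?_).mono
    ?_ (fun τ hτ => ?_))
  · refine ⟨by rw [hne _ _ _ _ (by simp)]; exact hτ.1,
      by rw [hne _ _ _ _ (by simp)]; exact hτ.2.1,
      by rw [hne _ _ _ _ (by simp)]; exact hτz,
      by simp [State.setReal, write, RExpr.eval], hDs (hτ0 hτ.2.2) (by simp)⟩
  · intro u hu τ hτ hτu
    refine WP.setR (by simp only [RExpr.cost, IExpr.cost]; omega) ?_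
    refine ⟨hτu, by rw [hne _ _ _ _ (by simp)]; exact hτ.1,
      by rw [hne _ _ _ _ (by simp)]; exact hτ.2.1,
      by rw [hne _ _ _ _ (by simp)]; exact hτ.2.2.1, ?_, hDs (hτ0 hτ.2.2.2.2) (by simp)⟩
    simp only [State.setInt_reals, State.setReal_apply, and_self, if_true, RExpr.eval, IExpr.eval]
    rw [hτ.2.2.2.1, Finset.sum_range_succ,
      hr τ x y z u hτ.2.2.2.2.1 hx hy hz hu hτ.1 hτ.2.1 hτ.2.2.1 hτu]
  · gcongr ?_ + _ + _; apply Nat.mul_le_mul_left; omega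
  · obtain ⟨h10, h11, h12, hs, hd⟩ := hτ
    refine WP.rset (by simp [IExpr.cost, RExpr.cost]) ?_
    have hev : State.setReal τ a ((IExpr.var 10).eval τ) ((IExpr.var 11).eval τ)
        ((IExpr.var 12).eval τ) ((RExpr.var 40).eval τ) =
        τ.setReal a x y z (∑ l ∈ Finset.range n, f x y z l) := by
      simp [IExpr.eval, RExpr.eval, h10, h11, h12, hs]
    rw [hev]
    refine ⟨h12, by rw [hne _ _ _ _ (by simp)]; exact h10,
      by rw [hne _ _ _ _ (by simp)]; exact h11,
      hDs ⟨hd.1.setReal _ _ _ _ (by simp), fun i hi j hj k hk hp => ?_⟩ (by simp)⟩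
    rw [State.setReal_apply]
    split_ifs with hc
    · obtain ⟨rfl, rfl, rfl⟩ := hc; rfl
    · exact hd.2 i hi j hj k hk (by omega)

/-- All sizes are positive, so the overhead of each loop is absorbed into the innermost iterations.
-/
theorem tab_cost_le {n₁ n₂ n₃ n c c₁ c₂ c₃ c₄ : ℕ} (hc : c₁ ≤ 4 ∧ c₂ ≤ 4 ∧ c₃ ≤ 4 ∧ c₄ ≤ 4)
    (hpos : 0 < n₁ ∧ 0 < n₂ ∧ 0 < n₃ ∧ 0 < n) :
    n₁ * (n₂ * (n₃ * (n * (c + c₄ + 40) + c₄ + c₃ + 80) + c₃ + c₂ + 40) + c₂ + c₁ + 40) + c₁ + 20 ≤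
      n₁ * n₂ * n₃ * n * (c + 300) := by
  obtain ⟨h₁, h₂, h₃, h₄⟩ := hc
  obtain ⟨p₁, p₂, p₃, p⟩ := hpos
  have step : ∀ {x A B z : ℕ} (y : ℕ), A ≤ B → z ≤ y → 0 < x → x * A + z ≤ x * (B + y) := by
    intro x A B z y h hz hx
    have h1 : x * A ≤ x * B := Nat.mul_le_mul_left _ h
    have h2 : y ≤ x * y := Nat.le_mul_of_pos_left _ hx
    rw [mul_add]; omega
  have pull : ∀ {x A B : ℕ} (y : ℕ), A ≤ x * B → 0 < x → A + y ≤ x * (B + y) := by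
    intro x A B y h hx
    have h2 : y ≤ x * y := Nat.le_mul_of_pos_left _ hx
    rw [mul_add]; omega
  have s1 : n * (c + c₄ + 40) + (c₄ + c₃ + 80) ≤ n * (c + 44 + 88) :=
    step 88 (by omega) (by omega) p
  have s2 : n₃ * (n * (c + c₄ + 40) + (c₄ + c₃ + 80)) + (c₃ + c₂ + 40) ≤
      n₃ * (n * (c + 44 + 88) + 48) := step 48 s1 (by omega) p₃
  have s3 : n₂ * (n₃ * (n * (c + c₄ + 40) + (c₄ + c₃ + 80)) + (c₃ + c₂ + 40)) + (c₂ + c₁ + 40) ≤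
      n₂ * (n₃ * (n * (c + 44 + 88) + 48) + 48) := step 48 s2 (by omega) p₂
  have s4 : n₁ * (n₂ * (n₃ * (n * (c + c₄ + 40) + (c₄ + c₃ + 80)) + (c₃ + c₂ + 40)) +
      (c₂ + c₁ + 40)) + (c₁ + 20) ≤ n₁ * (n₂ * (n₃ * (n * (c + 44 + 88) + 48) + 48) + 24) :=
    step 24 s3 (by omega) p₁
  have t1 : n * (c + 44 + 88) + 48 ≤ n * (c + 180) := pull 48 le_rfl p
  have t2 : n₃ * (n * (c + 44 + 88) + 48) + 48 ≤ n₃ * (n * (c + 228)) :=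
    (pull 48 (Nat.mul_le_mul_left _ t1) p₃).trans (Nat.mul_le_mul_left _ (pull 48 le_rfl p))
  have t3 : n₂ * (n₃ * (n * (c + 44 + 88) + 48) + 48) + 24 ≤ n₂ * (n₃ * (n * (c + 252))) :=
    (pull 24 (Nat.mul_le_mul_left _ t2) p₂).trans (Nat.mul_le_mul_left _
      ((pull 24 le_rfl p₃).trans (Nat.mul_le_mul_left _ (pull 24 le_rfl p))))
  have t4 := Nat.mul_le_mul_left n₁ t3
  calc _ = n₁ * (n₂ * (n₃ * (n * (c + c₄ + 40) + (c₄ + c₃ + 80)) + (c₃ + c₂ + 40)) +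
        (c₂ + c₁ + 40)) + (c₁ + 20) := by simp only [← add_assoc]
    _ ≤ _ := s4.trans t4
    _ = n₁ * n₂ * n₃ * n * (c + 252) := by simp only [mul_assoc]
    _ ≤ _ := Nat.mul_le_mul_left _ (by omega)

theorem WP.tab {a : ℕ} {e₁ e₂ e₃ e : IExpr} {r : RExpr} {σ : State} {n₁ n₂ n₃ n T : ℕ}
    (f : Fin n₁ → Fin n₂ → Fin n₃ → Fin n → ℝ) (ha : a ≠ 40)
    (hc : e₁.cost ≤ 4 ∧ e₂.cost ≤ 4 ∧ e₃.cost ≤ 4 ∧ e.cost ≤ 4)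
    (hpos : 0 < n₁ ∧ 0 < n₂ ∧ 0 < n₃ ∧ 0 < n)
    (hT : n₁ * n₂ * n₃ * n * (r.cost + 300) ≤ T)
    (he : ∀ τ, Frame [10, 11, 12, 13] [a, 40] σ τ →
      e₁.eval τ = n₁ ∧ e₂.eval τ = n₂ ∧ e₃.eval τ = n₃ ∧ e.eval τ = n)
    (hr : ∀ τ (i : Fin n₁) (j : Fin n₂) (k : Fin n₃) (l : Fin n),
      Frame [10, 11, 12, 13] [a, 40] σ τ →
      τ.ints 10 0 0 0 = i → τ.ints 11 0 0 0 = j → τ.ints 12 0 0 0 = k → τ.ints 13 0 0 0 = l →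
      r.eval τ = f i j k l) :
    WP (.tab a e₁ e₂ e₃ e r) σ T
      (fun τ => Frame [10, 11, 12, 13] [a, 40] σ τ ∧
        ∀ (i : Fin n₁) (j : Fin n₂) (k : Fin n₃), τ.reals a i j k = ∑ l, f i j k l) := by
  refine (WP.tabNat (n₁ := n₁) (n₂ := n₂) (n₃ := n₃) (n := n)
    (f := fun i j k l => if h : i < n₁ ∧ j < n₂ ∧ k < n₃ ∧ l < n then
      f ⟨i, h.1⟩ ⟨j, h.2.1⟩ ⟨k, h.2.2.1⟩ ⟨l, h.2.2.2⟩ else 0) ha (fun τ h => (he τ h).1)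
    (fun τ h => (he τ h).2.1) (fun τ h => (he τ h).2.2.1) (fun τ h => (he τ h).2.2.2)
    (fun τ i j k l hτ hi hj hk hl h₁ h₂ h₃ h₄ => ?_)).mono ?_ (fun τ hτ => ⟨hτ.1, fun i j k => ?_⟩)
  · rw [dif_pos ⟨hi, hj, hk, hl⟩]
    exact hr τ ⟨i, hi⟩ ⟨j, hj⟩ ⟨k, hk⟩ ⟨l, hl⟩ hτ h₁ h₂ h₃ h₄
  · exact (tab_cost_le hc hpos).trans hT
  · rw [hτ.2 i i.2 j j.2 k k.2, Finset.sum_range]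
    simp

/-- Store in the index scalar `a` an index `i < e` that maximises `s[i, 0, 0]`. -/
def Prog.argmax (a s : ℕ) (e : IExpr) : Prog :=
  .seq (.setI a (.lit 0)) (.for 10 e
    (.ite (.rlt (.get s (.var a) (.lit 0) (.lit 0)) (.get s (.var 10) (.lit 0) (.lit 0)))
      (.setI a (.var 10)) .skip))

theorem WP.argmax {a s : ℕ} {e : IExpr} {σ : State} {n T : ℕ} (ha : a ≠ 10) (hn : 0 < n)
    (hc : e.cost ≤ 4) (hT : n * 100 ≤ T)
    (he : ∀ τ, Frame [10, a] [] σ τ → e.eval τ = n) :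
    WP (.argmax a s e) σ T (fun τ => Frame [10, a] [] σ τ ∧
      ∃ i : Fin n, τ.ints a 0 0 0 = i ∧ ∀ j : Fin n, σ.reals s j 0 0 ≤ σ.reals s i 0 0) := by
  refine WP.mono (t := 5 + (n * (30 + e.cost + 20) + e.cost + 20)) (WP.seq ?_)
    (by nlinarith) (fun _ h => h)
  refine WP.setI (by simp [IExpr.cost]) ?_
  refine (WP.for (N := n) (I := fun k τ => Frame [10, a] [] σ τ ∧ τ.ints a 0 0 0 < n ∧
    ∀ j < k, σ.reals s j 0 0 ≤ σ.reals s (τ.ints a 0 0 0) 0 0) ?_ (fun k _ τ hτ => he τ hτ.1)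
    ?_).mono le_rfl (fun τ hτ => ⟨hτ.1, ⟨_, hτ.2.1⟩, rfl, fun j => hτ.2.2 j j.2⟩)
  · refine ⟨((Frame.refl _ _ _).setInt _ (by simp)).setInt _ (by simp), ?_, by simp⟩
    rw [State.setInt_ne _ _ ha]
    simpa [IExpr.eval] using hn
  · rintro k hk τ ⟨hf, hlt, hmax⟩ hτk
    refine (WP.ite (t := 8) (fun hb => ?_) (fun hb => ?_)).mono
      (by simp [Test.cost, RExpr.cost, IExpr.cost]) (fun _ h => h)
    · refine WP.setI (by simp [IExpr.cost]) ?_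
      simp only [Test.Holds, RExpr.eval, IExpr.eval, hτk, hf.2 s (by simp)] at hb
      have h1 : ((τ.setInt a ((IExpr.var 10).eval τ)).setInt 10 (k + 1)).ints a 0 0 0 = k := by
        rw [State.setInt_ne _ _ ha, State.setInt_same]
        simp [IExpr.eval, hτk]
      refine ⟨by rw [State.setInt_ne _ _ ha.symm, hτk],
        (hf.setInt _ (by simp)).setInt _ (by simp), by rw [h1]; exact hk, ?_⟩
      rw [h1]
      intro j hj
      rcases Nat.lt_succ_iff_lt_or_eq.1 hj with h | rfl
      · exact (hmax j h).trans hb.le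
      · exact le_rfl
    · refine WP.skip (by simp) ?_
      simp only [Test.Holds, RExpr.eval, IExpr.eval, hτk, hf.2 s (by simp), not_lt] at hb
      refine ⟨hτk, hf.setInt _ (by simp), ?_⟩
      rw [State.setInt_ne _ _ ha]
      refine ⟨hlt, fun j hj => ?_⟩
      rcases Nat.lt_succ_iff_lt_or_eq.1 hj with h | rfl
      · exact hmax j h
      · exact hb

end RealRAM

/-! ### Inversion of a positive definite matrix by successive row replacement -/

namespace Matrix

/-- The matrix whose first `t` rows are those of `S` and whose other rows are those of `1`. -/
def firstRows {n : ℕ} (S : Matrix (Fin n) (Fin n) ℝ) (t : ℕ) : Matrix (Fin n) (Fin n) ℝ :=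
  .of fun i j => if (i : ℕ) < t then S i j else (1 : Matrix (Fin n) (Fin n) ℝ) i j

/-- Update of an inverse when row `t` of the identity is replaced by row `t` of `S`. -/
noncomputable def replaceRow {n : ℕ} (S J : Matrix (Fin n) (Fin n) ℝ) (t : Fin n) :
    Matrix (Fin n) (Fin n) ℝ :=
  .of fun i j => J i j -
    J i t * ((S * J) t j - (1 : Matrix (Fin n) (Fin n) ℝ) t j) / (S * J) t t

theorem firstRows_zero {n : ℕ} (S : Matrix (Fin n) (Fin n) ℝ) : S.firstRows 0 = 1 := by
  ext i j; simp [firstRows]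

theorem firstRows_self {n : ℕ} (S : Matrix (Fin n) (Fin n) ℝ) : S.firstRows n = S := by
  ext i j; simp [firstRows]

theorem firstRows_mul_of_lt {n : ℕ} (S J : Matrix (Fin n) (Fin n) ℝ) {t : ℕ} {i : Fin n}
    (h : (i : ℕ) < t) (j : Fin n) : (S.firstRows t * J) i j = (S * J) i j := by
  simp [mul_apply, firstRows, h]

theorem firstRows_mul_of_not_lt {n : ℕ} (S J : Matrix (Fin n) (Fin n) ℝ) {t : ℕ} {i : Fin n}
    (h : ¬ (i : ℕ) < t) (j : Fin n) : (S.firstRows t * J) i j = J i j := by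
  simp [mul_apply, firstRows, h, one_apply]

/-- Let `v` be column `t` of `J`. The hypothesis gives `(S v) i = 0` for `i < t`, `v i = 0` for `i >
t`, and `v t = 1`. So `vᵀ S v` is the pivot itself, and positive definiteness makes it nonzero. No
pivot search is ever needed. -/
theorem PosDef.replaceRow_pivot_ne_zero {n : ℕ} {S J : Matrix (Fin n) (Fin n) ℝ} (hS : S.PosDef)
    (t : Fin n) (hJ : S.firstRows t * J = 1) : (S * J) t t ≠ 0 := by
  intro h0
  have hz : ∀ i, J i t * (S * J) i t = 0 := by
    intro i
    have hi := congrFun (congrFun hJ i) t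
    rcases lt_trichotomy i t with h | rfl | h
    · rw [firstRows_mul_of_lt _ _ (by simpa using h), one_apply_ne h.ne] at hi
      rw [hi, mul_zero]
    · rw [h0, mul_zero]
    · rw [firstRows_mul_of_not_lt _ _ (by simpa using h.le), one_apply_ne h.ne'] at hi
      rw [hi, zero_mul]
  have hne : (fun i => J i t) ≠ 0 := by
    intro h
    have ht := congrFun (congrFun hJ t) t
    rw [firstRows_mul_of_not_lt _ _ (by simp), one_apply_eq] at ht
    have := congrFun h t
    simp only [Pi.zero_apply] at this
    linarith
  have hpos := hS.dotProduct_mulVec_pos hne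
  have : star (fun i => J i t) ⬝ᵥ (S *ᵥ fun i => J i t) = 0 := by
    simp only [dotProduct, star_trivial]
    refine Finset.sum_eq_zero fun i _ => ?_
    have := hz i
    rwa [mul_apply] at this
  linarith

/-- The rank-one update of Sherman and Morrison: only row `t` of the product changes, because column
`t` of the old product is a unit vector. -/
theorem PosDef.firstRows_succ_mul_replaceRow {n : ℕ} {S J : Matrix (Fin n) (Fin n) ℝ}
    (hS : S.PosDef) (t : Fin n) (hJ : S.firstRows t * J = 1) :
    S.firstRows (t + 1) * S.replaceRow J t = 1 := by
  have hw := hS.replaceRow_pivot_ne_zero t hJ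
  have hmul : ∀ (A : Matrix (Fin n) (Fin n) ℝ) i j, (A * S.replaceRow J t) i j =
      (A * J) i j - (A * J) i t * ((S * J) t j - (1 : Matrix (Fin n) (Fin n) ℝ) t j) /
        (S * J) t t := by
    intro A i j
    rw [mul_apply, mul_apply, mul_apply (M := A) (i := i) (k := t), Finset.sum_mul, Finset.sum_div,
      ← Finset.sum_sub_distrib]
    exact Finset.sum_congr rfl fun l _ => by simp only [replaceRow, of_apply]; ring
  ext i j
  by_cases hit : i = t
  · subst hit
    rw [firstRows_mul_of_lt _ _ (by simp), hmul]
    field_simp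
    ring
  · have hne : (i : ℕ) ≠ t := fun h => hit (Fin.ext h)
    have e : ∀ j, (S.firstRows (t + 1) * J) i j = (1 : Matrix (Fin n) (Fin n) ℝ) i j := by
      intro j
      rw [← hJ]
      by_cases h : (i : ℕ) < t
      · rw [firstRows_mul_of_lt _ _ h, firstRows_mul_of_lt _ _ (by omega)]
      · rw [firstRows_mul_of_not_lt _ _ h, firstRows_mul_of_not_lt _ _ (by omega)]
    rw [hmul, e, e, one_apply_ne hit]
    simp

end Matrix

/-! ### Programs for matrix inversion, matrix powers and tables of entries -/

namespace RealRAM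

/-- The real number `1` if the values of `e` and `f` agree and `0` otherwise (as `0 / 0 = 0`). -/
def RExpr.eqInd (e f : IExpr) : RExpr :=
  .sub (.lit 1) (.div (.sub (.cast e) (.cast f)) (.sub (.cast e) (.cast f)))

theorem RExpr.eqInd_eval (e f : IExpr) (σ : State) :
    (RExpr.eqInd e f).eval σ = if e.eval σ = f.eval σ then 1 else 0 := by
  simp only [RExpr.eqInd, RExpr.eval]
  split_ifs with h
  · simp [h]
  · have : ((e.eval σ : ℕ) : ℝ) - (f.eval σ : ℕ) ≠ 0 := sub_ne_zero.2 (by exact_mod_cast h)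
    rw [div_self this]; simp

/-- The entry `(i, j, k)` of the array `a`, for scalars `i`, `j`, `k`. -/
abbrev RExpr.at₃ (a i j k : ℕ) : RExpr := .get a (.var i) (.var j) (.var k)

/-- The entry `(0, j, k)` of the array `a`, for scalars `j`, `k`. -/
abbrev RExpr.at₂ (a j k : ℕ) : RExpr := .get a (.lit 0) (.var j) (.var k)

/-- The entry `(i, 0, 0)` of the array `a`, for a scalar `i`. -/
abbrev RExpr.at₁ (a i : ℕ) : RExpr := .get a (.var i) (.lit 0) (.lit 0)

/-- The matrix stored in the entries `(0, i, j)` of the real array `a`. -/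
abbrev HasMat {r s : ℕ} (σ : State) (a : ℕ) (X : Matrix (Fin r) (Fin s) ℝ) : Prop :=
  ∀ (i : Fin r) (j : Fin s), σ.reals a 0 i j = X i j

/-- The vector stored in the entries `(i, 0, 0)` of the real array `a`. -/
abbrev HasVec {r : ℕ} (σ : State) (a : ℕ) (x : Fin r → ℝ) : Prop :=
  ∀ i : Fin r, σ.reals a i 0 0 = x i

/-- The family of matrices stored in the entries `(i, j, k)` of the real array `a`. -/
abbrev HasFam {r s t : ℕ} (σ : State) (a : ℕ) (B : Fin r → Matrix (Fin s) (Fin t) ℝ) : Prop :=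
  ∀ (i : Fin r) (j : Fin s) (k : Fin t), σ.reals a i j k = B i j k

/-- The inverse of the positive definite matrix in array `s`, of size `e`, is stored in `d`. -/
def Prog.inv (d s : ℕ) (e : IExpr) : Prog :=
  .seq (.tab d (.lit 1) e e (.lit 1) (.eqInd (.var 11) (.var 12)))
    (.for 14 e
      (.seq (.tab 41 (.lit 1) (.lit 1) e e (.mul (.at₂ s 14 13) (.at₂ d 13 12)))
      (.seq (.tab 42 (.lit 1) e e (.lit 1) (.sub (.at₂ d 11 12) (.div (.mul (.at₂ d 11 14)
          (.sub (.get 41 (.lit 0) (.lit 0) (.var 12)) (.eqInd (.var 14) (.var 12))))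
          (.get 41 (.lit 0) (.lit 0) (.var 14)))))
        (.tab d (.lit 1) e e (.lit 1) (.at₂ 42 11 12)))))

theorem WP.inv {d s : ℕ} {e : IExpr} {σ : State} {n T : ℕ} {S : Matrix (Fin n) (Fin n) ℝ}
    (hd : d ∉ [40, 41, 42]) (hs : s ∉ [d, 40, 41, 42]) (hn : 0 < n)
    (hc : e.cost ≤ 4) (hT : n * n * n * 2000 ≤ T)
    (he : ∀ τ, Frame [10, 11, 12, 13, 14] [d, 40, 41, 42] σ τ → e.eval τ = n)
    (hS : S.PosDef) (hσ : HasMat σ s S) :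
    WP (.inv d s e) σ T (fun τ => Frame [10, 11, 12, 13, 14] [d, 40, 41, 42] σ τ ∧
      HasMat τ d S⁻¹) := by
  simp only [List.mem_cons, List.not_mem_nil, or_false, not_or] at hd hs
  obtain ⟨hd0, hd1, hd2⟩ := hd
  obtain ⟨hsd, hs0, hs1, hs2⟩ := hs
  have hsub : ∀ {τ υ : State} {a : ℕ}, Frame [10, 11, 12, 13, 14] [d, 40, 41, 42] σ τ →
      a ∈ [d, 41, 42] → Frame [10, 11, 12, 13] [a, 40] τ υ →
      Frame [10, 11, 12, 13, 14] [d, 40, 41, 42] σ υ := by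
    intro τ υ a h ha h'
    refine h.comp (h'.weaken (by simp) ?_)
    intro b hb
    simp only [List.mem_cons, List.not_mem_nil, or_false] at hb ha ⊢
    rcases hb with rfl | rfl <;> tauto
  refine WP.seq_le (n * n * 400) (n * (n * n * 1300 + e.cost + 20) + e.cost + 20) ?_ ?_
  · have h1 : 1 * 1 ≤ n * n := Nat.mul_le_mul hn hn
    have h2 : n * 1 ≤ n * (n * n) := Nat.mul_le_mul_left _ (by linarith)
    have h3 : n * n * 1 ≤ n * n * n := Nat.mul_le_mul_left _ hn
    have h4 : n * (n * n * 1300 + e.cost + 20) ≤ n * (n * n * 1300 + 24) :=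
      Nat.mul_le_mul_left _ (by linarith)
    nlinarith
  refine (WP.tab (n₁ := 1) (n₂ := n) (n₃ := n) (n := 1)
    (fun _ j k _ => (1 : Matrix (Fin n) (Fin n) ℝ) j k) hd0 ⟨by simp [IExpr.cost], hc, hc,
    by simp [IExpr.cost]⟩ ⟨one_pos, hn, hn, one_pos⟩ (by rw [one_mul, mul_one]; exact Nat.mul_le_mul_left _ (by simp [RExpr.cost, RExpr.eqInd, IExpr.cost]))
    (fun τ hτ => ⟨rfl, he τ (hsub (Frame.refl _ _ _) (by simp) hτ),
      he τ (hsub (Frame.refl _ _ _) (by simp) hτ), rfl⟩)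
    (fun τ i j k l hτ h₁ h₂ h₃ h₄ => ?_)).mono le_rfl ?_
  · simp [RExpr.eqInd_eval, IExpr.eval, h₂, h₃, Matrix.one_apply, Fin.ext_iff]
  rintro τ ⟨hτ, hτd⟩
  have hτ' := hsub (Frame.refl _ _ _) (by simp) hτ
  refine (WP.for (N := n) (t := n * n * 1300) (I := fun t υ =>
    Frame [10, 11, 12, 13, 14] [d, 40, 41, 42] σ υ ∧ ∃ J : Matrix (Fin n) (Fin n) ℝ,
      HasMat υ d J ∧ S.firstRows t * J = 1) ?_ (fun k _ υ hυ => he υ hυ.1) ?_).mono le_rfl ?_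
  · refine ⟨hτ'.setInt _ (by simp), 1, fun i j => ?_, ?_⟩
    · have := hτd 0 i j
      simpa using this
    · rw [Matrix.firstRows_zero, one_mul]
  · rintro t ht υ ⟨hυ, J, hυJ, hJ⟩ hυt
    have hυS : HasMat υ s S := fun i j => by
      rw [hυ.2 s (by simp [hsd, hs0, hs1, hs2])]; exact hσ i j
    refine WP.seq_le (n * n * 400) (n * n * 900) (by linarith) ?_
    refine (WP.tab (n₁ := 1) (n₂ := 1) (n₃ := n) (n := n)
      (fun _ _ k l => S ⟨t, ht⟩ l * J l k) (by simp) ⟨by simp [IExpr.cost], by simp [IExpr.cost],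
      hc, hc⟩ ⟨one_pos, one_pos, hn, hn⟩ ?_
      (fun τ hτ => ⟨rfl, rfl, he τ (hsub hυ (by simp) hτ), he τ (hsub hυ (by simp) hτ)⟩)
      (fun τ i j k l hτ h₁ h₂ h₃ h₄ => ?_)).mono le_rfl ?_
    · simp only [RExpr.cost, IExpr.cost, one_mul]
      exact Nat.mul_le_mul_left _ (by norm_num)
    · have := hυS ⟨t, ht⟩ l
      simp [RExpr.eval, IExpr.eval, hτ.1, hτ.2, hs0, hs1, hd0, hd1, hυt, h₃, h₄, hυJ l k]
      left; exact this
    rintro τ₁ ⟨hf₁, hw⟩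
    replace hw : ∀ k : Fin n, τ₁.reals 41 0 0 k = (S * J) ⟨t, ht⟩ k := fun k => by
      have := hw 0 0 k
      simpa [Matrix.mul_apply] using this
    have hf₁' := hsub hυ (by simp) hf₁
    -- Each updated entry reads other entries of the old inverse, so the update is written to array
    -- `42` and copied back afterwards.
    refine WP.seq_le (n * n * 500) (n * n * 400) (by linarith) ((WP.tab (n₁ := 1) (n₂ := n) (n₃ := n) (n := 1)
      (fun _ j k _ => S.replaceRow J ⟨t, ht⟩ j k) (by simp) ⟨by simp [IExpr.cost], hc,
      hc, by simp [IExpr.cost]⟩ ⟨one_pos, hn, hn, one_pos⟩ ?_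
      (fun τ hτ => ⟨rfl, he τ (hsub hf₁' (by simp) hτ), he τ (hsub hf₁' (by simp) hτ), rfl⟩)
      (fun τ i j k l hτ h₁ h₂ h₃ h₄ => ?_)).mono le_rfl ?_)
    · simp only [RExpr.cost, RExpr.eqInd, IExpr.cost, one_mul]
      rw [mul_one]
      exact Nat.mul_le_mul_left _ (by norm_num)
    · have e1 := hυJ j ⟨t, ht⟩
      have e2 := hw ⟨t, ht⟩
      simp only at e1 e2
      simp [RExpr.eval, RExpr.eqInd_eval, IExpr.eval, hτ.1, hτ.2, hf₁.1, hf₁.2, hd0, hd1, hd2,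
        hυt, h₂, h₃, hυJ j k, e1, e2, hw k, Matrix.replaceRow, Matrix.one_apply, Fin.ext_iff]
    rintro τ₂ ⟨hf₂, hK⟩
    have hf₂' := hsub hf₁' (by simp) hf₂
    refine (WP.tab (n₁ := 1) (n₂ := n) (n₃ := n) (n := 1)
      (fun _ j k _ => S.replaceRow J ⟨t, ht⟩ j k) hd0 ⟨by simp [IExpr.cost], hc,
      hc, by simp [IExpr.cost]⟩ ⟨one_pos, hn, hn, one_pos⟩ ?_
      (fun τ hτ => ⟨rfl, he τ (hsub hf₂' (by simp) hτ), he τ (hsub hf₂' (by simp) hτ), rfl⟩)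
      (fun τ i j k l hτ h₁ h₂ h₃ h₄ => ?_)).mono le_rfl ?_
    · simp only [RExpr.cost, IExpr.cost, one_mul]
      rw [mul_one]
      exact Nat.mul_le_mul_left _ (by norm_num)
    · have := hK 0 j k
      simp only [Finset.univ_unique, Finset.sum_const, Finset.card_singleton, one_smul,
        Fin.coe_ofNat_eq_mod, Nat.zero_mod] at this
      simp [RExpr.eval, IExpr.eval, hτ.2, Ne.symm hd2, h₂, h₃, this]
    rintro τ₃ ⟨hf₃, hJ'⟩
    refine ⟨by rw [hf₃.1 14 (by simp), hf₂.1 14 (by simp), hf₁.1 14 (by simp), hυt],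
      (hsub hf₂' (by simp) hf₃).setInt _ (by simp), S.replaceRow J ⟨t, ht⟩, fun i j => ?_,
      hS.firstRows_succ_mul_replaceRow ⟨t, ht⟩ hJ⟩
    have := hJ' 0 i j
    simpa using this
  · rintro υ ⟨hυ, J, hυJ, hJ⟩
    rw [Matrix.firstRows_self] at hJ
    refine ⟨hυ, ?_⟩
    rw [Matrix.inv_eq_right_inv hJ]
    exact hυJ

/-- `a[i, 0, 0] := r` for all `i` below the index scalar `d`. -/
abbrev Prog.mapVec (a d : ℕ) (r : RExpr) : Prog := .tab a (.var d) (.lit 1) (.lit 1) (.lit 1) r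

/-- `a[i, 0, 0] := ∑ l, r` for all `i` below `d`, with `l` running below `e`. -/
abbrev Prog.sumVec (a d e : ℕ) (r : RExpr) : Prog := .tab a (.var d) (.lit 1) (.lit 1) (.var e) r

/-- `a[0, j, k] := r` for all `j`, `k` below `d`. -/
abbrev Prog.mapMat (a d : ℕ) (r : RExpr) : Prog := .tab a (.lit 1) (.var d) (.var d) (.lit 1) r

/-- `a[0, j, k] := ∑ l, r` for all `j`, `k` below `d`, with `l` running below `e`. -/
abbrev Prog.sumMat (a d e : ℕ) (r : RExpr) : Prog := .tab a (.lit 1) (.var d) (.var d) (.var e) r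

/-- `a[i, j, k] := r` for all `i` below `d` and `j`, `k` below `d'`. -/
abbrev Prog.mapFam (a d d' : ℕ) (r : RExpr) : Prog := .tab a (.var d) (.var d') (.var d') (.lit 1) r

/-- `a[i, j, k] := ∑ l, r` for `i`, `j`, `k` below `d₁`, `d₂`, `d₃`, with `l` running below `e`. -/
abbrev Prog.sumFam (a d₁ d₂ d₃ e : ℕ) (r : RExpr) : Prog :=
  .tab a (.var d₁) (.var d₂) (.var d₃) (.var e) r

/-- `a := ∑ l, r` with `l` running below `e`. -/
abbrev Prog.sumScal (a e : ℕ) (r : RExpr) : Prog := .tab a (.lit 1) (.lit 1) (.lit 1) (.var e) r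

section

variable {a d d₁ d₂ d₃ e : ℕ} {r : RExpr} {σ : State} {n n₁ n₂ n₃ n' T : ℕ}

theorem Frame.var_eval {τ : State} {rs : List ℕ} (h : Frame [10, 11, 12, 13] rs σ τ)
    (hd : d ∉ [10, 11, 12, 13]) (hn : σ.ints d 0 0 0 = n) : (IExpr.var d).eval τ = n := by
  simp only [IExpr.eval]
  rw [h.1 d hd, hn]

theorem WP.sumFam (f : Fin n₁ → Fin n₂ → Fin n₃ → Fin n' → ℝ)
    (X : Fin n₁ → Matrix (Fin n₂) (Fin n₃) ℝ) (hX : ∀ i j k, X i j k = ∑ l, f i j k l)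
    (hn : σ.ints d₁ 0 0 0 = n₁ ∧ σ.ints d₂ 0 0 0 = n₂ ∧ σ.ints d₃ 0 0 0 = n₃ ∧ σ.ints e 0 0 0 = n')
    (hpos : 0 < n₁ ∧ 0 < n₂ ∧ 0 < n₃ ∧ 0 < n') (hT : n₁ * n₂ * n₃ * n' * 500 ≤ T)
    (hr : ∀ τ (i : Fin n₁) (j : Fin n₂) (k : Fin n₃) (l : Fin n'),
      Frame [10, 11, 12, 13] [a, 40] σ τ → τ.ints 10 0 0 0 = i → τ.ints 11 0 0 0 = j →
      τ.ints 12 0 0 0 = k → τ.ints 13 0 0 0 = l → r.eval τ = f i j k l)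
    (ha : a ≠ 40 := by simp) (hd₁ : d₁ ∉ [10, 11, 12, 13] := by simp)
    (hd₂ : d₂ ∉ [10, 11, 12, 13] := by simp) (hd₃ : d₃ ∉ [10, 11, 12, 13] := by simp)
    (he : e ∉ [10, 11, 12, 13] := by simp)
    (hc : r.cost ≤ 200 := by simp [RExpr.cost, RExpr.eqInd, IExpr.cost]) :
    WP (.sumFam a d₁ d₂ d₃ e r) σ T
      (fun τ => Frame [10, 11, 12, 13] [a, 40] σ τ ∧ HasFam τ a X) := by
  refine (WP.tab f ha (by simp [IExpr.cost]) hpos ((Nat.mul_le_mul_left _ (by omega)).trans hT)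
    (fun τ hτ => ⟨hτ.var_eval hd₁ hn.1, hτ.var_eval hd₂ hn.2.1, hτ.var_eval hd₃ hn.2.2.1,
      hτ.var_eval he hn.2.2.2⟩) hr).mono le_rfl (fun τ hτ => ⟨hτ.1, fun i j k => ?_⟩)
  rw [hX, hτ.2]

theorem WP.mapFam (X : Fin n₁ → Matrix (Fin n₂) (Fin n₂) ℝ)
    (hn : σ.ints d₁ 0 0 0 = n₁ ∧ σ.ints d₂ 0 0 0 = n₂) (hpos : 0 < n₁ ∧ 0 < n₂)
    (hT : n₁ * n₂ * n₂ * 500 ≤ T)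
    (hr : ∀ τ (i : Fin n₁) (j k : Fin n₂), Frame [10, 11, 12, 13] [a, 40] σ τ →
      τ.ints 10 0 0 0 = i → τ.ints 11 0 0 0 = j → τ.ints 12 0 0 0 = k → r.eval τ = X i j k)
    (ha : a ≠ 40 := by simp) (hd₁ : d₁ ∉ [10, 11, 12, 13] := by simp)
    (hd₂ : d₂ ∉ [10, 11, 12, 13] := by simp)
    (hc : r.cost ≤ 200 := by simp [RExpr.cost, RExpr.eqInd, IExpr.cost]) :
    WP (.mapFam a d₁ d₂ r) σ T
      (fun τ => Frame [10, 11, 12, 13] [a, 40] σ τ ∧ HasFam τ a X) := by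
  refine (WP.tab (n := 1) (fun i j k _ => X i j k) ha (by simp [IExpr.cost])
    ⟨hpos.1, hpos.2, hpos.2, one_pos⟩
    (by rw [mul_one]; exact (Nat.mul_le_mul_left _ (by omega)).trans hT)
    (fun τ hτ => ⟨hτ.var_eval hd₁ hn.1, hτ.var_eval hd₂ hn.2, hτ.var_eval hd₂ hn.2, rfl⟩)
    (fun τ i j k _ hτ h₁ h₂ h₃ _ => hr τ i j k hτ h₁ h₂ h₃)).mono le_rfl
    (fun τ hτ => ⟨hτ.1, fun i j k => ?_⟩)
  rw [hτ.2]; simp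

theorem WP.sumMat (f : Fin n → Fin n → Fin n' → ℝ) (X : Matrix (Fin n) (Fin n) ℝ)
    (hX : ∀ j k, X j k = ∑ l, f j k l) (hn : σ.ints d 0 0 0 = n ∧ σ.ints e 0 0 0 = n')
    (hpos : 0 < n ∧ 0 < n') (hT : n * n * n' * 500 ≤ T)
    (hr : ∀ τ (j k : Fin n) (l : Fin n'), Frame [10, 11, 12, 13] [a, 40] σ τ →
      τ.ints 11 0 0 0 = j → τ.ints 12 0 0 0 = k → τ.ints 13 0 0 0 = l → r.eval τ = f j k l)
    (ha : a ≠ 40 := by simp) (hd : d ∉ [10, 11, 12, 13] := by simp)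
    (he : e ∉ [10, 11, 12, 13] := by simp)
    (hc : r.cost ≤ 200 := by simp [RExpr.cost, RExpr.eqInd, IExpr.cost]) :
    WP (.sumMat a d e r) σ T
      (fun τ => Frame [10, 11, 12, 13] [a, 40] σ τ ∧ HasMat τ a X) := by
  refine (WP.tab (n₁ := 1) (fun _ j k l => f j k l) ha (by simp [IExpr.cost])
    ⟨one_pos, hpos.1, hpos.1, hpos.2⟩
    (by rw [one_mul]; exact (Nat.mul_le_mul_left _ (by omega)).trans hT)
    (fun τ hτ => ⟨rfl, hτ.var_eval hd hn.1, hτ.var_eval hd hn.1, hτ.var_eval he hn.2⟩)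
    (fun τ _ j k l hτ _ h₂ h₃ h₄ => hr τ j k l hτ h₂ h₃ h₄)).mono le_rfl
    (fun τ hτ => ⟨hτ.1, fun j k => ?_⟩)
  rw [hX]; exact hτ.2 0 j k

theorem WP.mapMat (X : Matrix (Fin n) (Fin n) ℝ) (hn : σ.ints d 0 0 0 = n) (hpos : 0 < n)
    (hT : n * n * 500 ≤ T)
    (hr : ∀ τ (j k : Fin n), Frame [10, 11, 12, 13] [a, 40] σ τ →
      τ.ints 11 0 0 0 = j → τ.ints 12 0 0 0 = k → r.eval τ = X j k)
    (ha : a ≠ 40 := by simp) (hd : d ∉ [10, 11, 12, 13] := by simp)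
    (hc : r.cost ≤ 200 := by simp [RExpr.cost, RExpr.eqInd, IExpr.cost]) :
    WP (.mapMat a d r) σ T
      (fun τ => Frame [10, 11, 12, 13] [a, 40] σ τ ∧ HasMat τ a X) := by
  refine (WP.tab (n₁ := 1) (n := 1) (fun _ j k _ => X j k) ha (by simp [IExpr.cost])
    ⟨one_pos, hpos, hpos, one_pos⟩
    (by rw [one_mul, mul_one]; exact (Nat.mul_le_mul_left _ (by omega)).trans hT)
    (fun τ hτ => ⟨rfl, hτ.var_eval hd hn, hτ.var_eval hd hn, rfl⟩)
    (fun τ _ j k _ hτ _ h₂ h₃ _ => hr τ j k hτ h₂ h₃)).mono le_rfl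
    (fun τ hτ => ⟨hτ.1, fun j k => ?_⟩)
  have := hτ.2 0 j k
  simpa using this

theorem WP.sumVec (f : Fin n → Fin n' → ℝ) (x : Fin n → ℝ)
    (hx : ∀ i, x i = ∑ l, f i l) (hn : σ.ints d 0 0 0 = n ∧ σ.ints e 0 0 0 = n')
    (hpos : 0 < n ∧ 0 < n') (hT : n * n' * 500 ≤ T)
    (hr : ∀ τ (i : Fin n) (l : Fin n'), Frame [10, 11, 12, 13] [a, 40] σ τ →
      τ.ints 10 0 0 0 = i → τ.ints 13 0 0 0 = l → r.eval τ = f i l)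
    (ha : a ≠ 40 := by simp) (hd : d ∉ [10, 11, 12, 13] := by simp)
    (he : e ∉ [10, 11, 12, 13] := by simp)
    (hc : r.cost ≤ 200 := by simp [RExpr.cost, RExpr.eqInd, IExpr.cost]) :
    WP (.sumVec a d e r) σ T
      (fun τ => Frame [10, 11, 12, 13] [a, 40] σ τ ∧ HasVec τ a x) := by
  refine (WP.tab (n₂ := 1) (n₃ := 1) (fun i _ _ l => f i l) ha (by simp [IExpr.cost])
    ⟨hpos.1, one_pos, one_pos, hpos.2⟩
    (by rw [mul_one, mul_one]; exact (Nat.mul_le_mul_left _ (by omega)).trans hT)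
    (fun τ hτ => ⟨hτ.var_eval hd hn.1, rfl, rfl, hτ.var_eval he hn.2⟩)
    (fun τ i _ _ l hτ h₁ _ _ h₄ => hr τ i l hτ h₁ h₄)).mono le_rfl
    (fun τ hτ => ⟨hτ.1, fun i => ?_⟩)
  rw [hx]; exact hτ.2 i 0 0

theorem WP.mapVec (x : Fin n → ℝ) (hn : σ.ints d 0 0 0 = n) (hpos : 0 < n) (hT : n * 500 ≤ T)
    (hr : ∀ τ (i : Fin n), Frame [10, 11, 12, 13] [a, 40] σ τ →
      τ.ints 10 0 0 0 = i → r.eval τ = x i)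
    (ha : a ≠ 40 := by simp) (hd : d ∉ [10, 11, 12, 13] := by simp)
    (hc : r.cost ≤ 200 := by simp [RExpr.cost, RExpr.eqInd, IExpr.cost]) :
    WP (.mapVec a d r) σ T
      (fun τ => Frame [10, 11, 12, 13] [a, 40] σ τ ∧ HasVec τ a x) := by
  refine (WP.tab (n₂ := 1) (n₃ := 1) (n := 1) (fun i _ _ _ => x i) ha (by simp [IExpr.cost])
    ⟨hpos, one_pos, one_pos, one_pos⟩
    (by rw [mul_one, mul_one, mul_one]; exact (Nat.mul_le_mul_left _ (by omega)).trans hT)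
    (fun τ hτ => ⟨hτ.var_eval hd hn, rfl, rfl, rfl⟩)
    (fun τ i _ _ _ hτ h₁ _ _ _ => hr τ i hτ h₁)).mono le_rfl
    (fun τ hτ => ⟨hτ.1, fun i => ?_⟩)
  have := hτ.2 i 0 0
  simpa using this

theorem WP.sumScal (f : Fin n → ℝ) (x : ℝ) (hx : x = ∑ l, f l) (hn : σ.ints e 0 0 0 = n)
    (hpos : 0 < n) (hT : n * 500 ≤ T)
    (hr : ∀ τ (l : Fin n), Frame [10, 11, 12, 13] [a, 40] σ τ →
      τ.ints 13 0 0 0 = l → r.eval τ = f l)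
    (ha : a ≠ 40 := by simp) (he : e ∉ [10, 11, 12, 13] := by simp)
    (hc : r.cost ≤ 200 := by simp [RExpr.cost, RExpr.eqInd, IExpr.cost]) :
    WP (.sumScal a e r) σ T
      (fun τ => Frame [10, 11, 12, 13] [a, 40] σ τ ∧ τ.reals a 0 0 0 = x) := by
  refine (WP.tab (n₁ := 1) (n₂ := 1) (n₃ := 1) (fun _ _ _ l => f l) ha (by simp [IExpr.cost])
    ⟨one_pos, one_pos, one_pos, hpos⟩
    (by simp only [one_mul]; exact (Nat.mul_le_mul_left _ (by omega)).trans hT)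
    (fun τ hτ => ⟨rfl, rfl, rfl, hτ.var_eval he hn⟩)
    (fun τ _ _ _ l hτ _ _ _ h₄ => hr τ l hτ h₄)).mono le_rfl
    (fun τ hτ => ⟨hτ.1, ?_⟩)
  rw [hx]; exact hτ.2 0 0 0

end

/-- Store in array `b` the `p + 1`-st power of the matrix in array `s`, of size `d`. -/
def Prog.pow (b s d p : ℕ) : Prog :=
  .seq (.mapMat b d (.at₂ s 11 12)) (.for 14 (.var p)
    (.seq (.sumMat 43 d d (.mul (.at₂ b 11 13) (.at₂ s 13 12)))
      (.mapMat b d (.at₂ 43 11 12))))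

theorem WP.pow {b s d p : ℕ} {σ : State} {n k T : ℕ} {R : Matrix (Fin n) (Fin n) ℝ}
    (hb : b ∉ [40, 43]) (hs : s ∉ [b, 40, 43]) (hd : d ∉ [10, 11, 12, 13, 14])
    (hp : p ∉ [10, 11, 12, 13, 14]) (hn : σ.ints d 0 0 0 = n) (hk : σ.ints p 0 0 0 = k)
    (hpos : 0 < n) (hT : (k + 1) * (n * n * n * 2000) ≤ T) (hR : HasMat σ s R) :
    WP (.pow b s d p) σ T (fun τ => Frame [10, 11, 12, 13, 14] [b, 40, 43] σ τ ∧
      HasMat τ b (R ^ (k + 1))) := by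
  simp only [List.mem_cons, List.not_mem_nil, or_false, not_or] at hb hs hd hp
  obtain ⟨hb0, hb3⟩ := hb
  obtain ⟨hsb, hs0, hs3⟩ := hs
  have hd' : d ∉ [10, 11, 12, 13] := by simp; tauto
  have h2 : n * n * 1 ≤ n * n * n := Nat.mul_le_mul_left _ hpos
  have h1 : 1 * 1 * 1 ≤ n * n * n := Nat.mul_le_mul (Nat.mul_le_mul hpos hpos) hpos
  refine WP.seq_le (n * n * 500) (k * (n * n * n * 1000 + 4 + 20) + 4 + 20) ?_ ?_
  · have : k * (n * n * n * 1000 + 4 + 20) ≤ k * (n * n * n * 2000) :=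
      Nat.mul_le_mul_left _ (by linarith)
    nlinarith
  refine (WP.mapMat R hn hpos le_rfl (fun τ j k hτ h₁ h₂ => ?_) hb0 hd').mono le_rfl ?_
  · simp [RExpr.eval, IExpr.eval, hτ.2, hsb, hs0, h₁, h₂, hR]
  rintro τ ⟨hf, hτ⟩
  have hf' : Frame [10, 11, 12, 13, 14] [b, 40, 43] σ τ := hf.weaken (by simp) (by simp)
  refine (WP.for (N := k) (t := n * n * n * 1000) (I := fun t υ =>
    Frame [10, 11, 12, 13, 14] [b, 40, 43] σ υ ∧ HasMat υ b (R ^ (t + 1))) ?_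
    (fun t _ υ hυ => ?_) ?_).mono le_rfl (fun _ h => h)
  · exact ⟨hf'.setInt _ (by simp), by rw [zero_add, pow_one]; exact hτ⟩
  · simp only [IExpr.eval]
    rw [hυ.1.1 p (by simp; tauto), hk]
  · rintro t ht υ ⟨hυ, hυb⟩ hυt
    have hυR : HasMat υ s R := fun i j => by rw [hυ.2 s (by simp [hsb, hs0, hs3])]; exact hR i j
    have hυn : υ.ints d 0 0 0 = n := by rw [hυ.1 d (by simp; tauto), hn]
    refine WP.seq_le (n * n * n * 500) (n * n * 500) (by linarith) ?_
    refine (WP.sumMat (fun i j l => (R ^ (t + 1)) i l * R l j) (R ^ (t + 1 + 1))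
      (fun i j => by rw [pow_succ _ (t + 1), Matrix.mul_apply]) ⟨hυn, hυn⟩ ⟨hpos, hpos⟩ le_rfl
      (fun τ i j l hτ h₁ h₂ h₃ => ?_) (by simp) hd' hd').mono le_rfl ?_
    · simp [RExpr.eval, IExpr.eval, hτ.2, hb0, hb3, hs0, hs3, h₁, h₂, h₃, hυb, hυR]
    rintro τ₁ ⟨hf₁, h43⟩
    refine (WP.mapMat (R ^ (t + 1 + 1)) (by rw [hf₁.1 d hd', hυn]) hpos le_rfl
      (fun τ i j hτ h₁ h₂ => ?_) hb0 hd').mono le_rfl ?_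
    · simp [RExpr.eval, IExpr.eval, hτ.2, Ne.symm hb3, h₁, h₂, h43]
    rintro τ₂ ⟨hf₂, hτ₂⟩
    refine ⟨by rw [hf₂.1 14 (by simp), hf₁.1 14 (by simp), hυt], Frame.setInt ?_ _ (by simp), hτ₂⟩
    exact hυ.comp ((hf₁.trans hf₂).weaken (by simp) (by simp))

end RealRAM

/-! ### One step of the balancing algorithm -/

namespace Balancing

variable {n w : ℕ}

/-- The indicator of the coordinates of `x` that are not yet `±1`. -/
noncomputable def mask (x : Fin n → ℝ) (i : Fin n) : ℝ := if x i * x i = 1 then 0 else 1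

/-- The level of the barrier at `x`, in a phase that starts at `xs`. -/
noncomputable def level (p : ℕ) (u₀ : ℝ) (x xs : Fin n → ℝ) : ℝ :=
  u₀ + 432 * p / u₀ * ∑ i, (x i * x i - xs i * xs i)

/-- The slack matrix at `x`, in a phase that starts at `xs`. -/
noncomputable def slack (D : Fin n → Matrix (Fin w) (Fin w) ℝ) (p : ℕ) (u₀ : ℝ)
    (x xs : Fin n → ℝ) : Matrix (Fin w) (Fin w) ℝ :=
  level p u₀ x xs • 1 - ∑ i, (x i - xs i) • D i

/-- The indicator of the coordinates of `x` other than `j₀` that are not yet `±1`. -/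
noncomputable def redMask (x : Fin n → ℝ) (j₀ i : Fin n) : ℝ :=
  mask x i * (1 - if i = j₀ then 1 else 0)

/-- The matrices after elimination of the coordinate `j₀` by the condition of orthogonality
to `x`. -/
noncomputable def redMat (D : Fin n → Matrix (Fin w) (Fin w) ℝ) (x : Fin n → ℝ) (j₀ i : Fin n) :
    Matrix (Fin w) (Fin w) ℝ :=
  redMask x j₀ i • (D i - (x i / x j₀) • D j₀)

/-- The matrix of the regularised quadratic form `v ↦ tr (W V R V) + ε |v|²`, `V = ∑ vᵢ Bᵢ`. -/
noncomputable def gram {J κ : Type*} [DecidableEq J] [Fintype κ] (W R : Matrix κ κ ℝ)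
    (B : J → Matrix κ κ ℝ) (ε : ℝ) : Matrix J J ℝ :=
  .of fun i j => (W * B i * R * B j).trace + (1 : Matrix J J ℝ) i j * ε

/-- The normalised column `i₀` of `S`, restricted to the reduced coordinates. -/
noncomputable def redDir (S : Matrix (Fin n) (Fin n) ℝ) (x : Fin n → ℝ) (j₀ i₀ i : Fin n) : ℝ :=
  redMask x j₀ i * (S i i₀ / S i₀ i₀)

/-- The direction orthogonal to `x` with reduced coordinates `v`. -/
noncomputable def fullDir (v x : Fin n → ℝ) (j₀ i : Fin n) : ℝ :=
  v i - (if i = j₀ then 1 else 0) * ∑ j, x j / x j₀ * v j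

/-- The sign that makes `descSign l * l` nonpositive. -/
noncomputable def descSign (l : ℝ) : ℝ := if 0 < l then -1 else 1

/-- The inverse of the largest step in direction `z` that keeps coordinate `i` in `[-1, 1]`. -/
noncomputable def rate (x z : Fin n → ℝ) (i : Fin n) : ℝ :=
  max (z i / (1 - x i)) (-z i / (1 + x i))

end Balancing

namespace RealRAM

open Balancing

/-- `e²` divided by itself, for `e = 1 - x²`: the indicator of `x² ≠ 1`. -/
def RExpr.ind (e : RExpr) : RExpr := .div e e

theorem RExpr.ind_eval (e : RExpr) (σ : State) :
    (RExpr.ind e).eval σ = if e.eval σ = 0 then 0 else 1 := by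
  simp only [RExpr.ind, RExpr.eval]
  split_ifs with h
  · simp [h]
  · exact div_self h

/-- The absolute value. -/
def RExpr.abs (e : RExpr) : RExpr := .sqrt (.mul e e)

theorem RExpr.abs_eval (e : RExpr) (σ : State) : (RExpr.abs e).eval σ = |e.eval σ| := by
  simp only [RExpr.abs, RExpr.eval, Real.sqrt_mul_self_eq_abs]

/-- The maximum. -/
def RExpr.max (e f : RExpr) : RExpr :=
  .div (.add (.add e f) (.abs (.sub e f))) (.lit 2)

theorem RExpr.max_eval (e f : RExpr) (σ : State) :
    (RExpr.max e f).eval σ = Max.max (e.eval σ) (f.eval σ) := by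
  simp only [RExpr.max, RExpr.eval, RExpr.abs_eval]
  rcases le_total (e.eval σ) (f.eval σ) with h | h
  · rw [max_eq_right h, abs_of_nonpos (by linarith)]; push_cast; ring
  · rw [max_eq_left h, abs_of_nonneg (by linarith)]; push_cast; ring

/-- The time unit `U` dominates the cost of every elementary routine. -/
structure Budget (n w p U : ℕ) : Prop where
  pow : (p + 1) * (w * w * w * 2000) ≤ U
  fam : n * (w * w * w * 500) ≤ U
  gram : n * n * (w * w * 500) ≤ U
  inv : n * n * n * 2000 ≤ U

namespace Budget

variable {n w p U : ℕ}

theorem inv' (h : Budget n w p U) : w * w * w * 2000 ≤ U :=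
  le_trans (Nat.le_mul_of_pos_left _ p.succ_pos) h.pow

theorem nnn (h : Budget n w p U) (hn : 0 < n) : n * n * 500 ≤ U := by
  have := h.inv
  have : n * n * 1 ≤ n * n * n := Nat.mul_le_mul_left _ hn
  linarith

theorem nn (h : Budget n w p U) (hn : 0 < n) : n * 500 ≤ U := by
  have := h.nnn hn
  have : n * 1 ≤ n * n := Nat.mul_le_mul_left _ hn
  linarith

theorem ww (h : Budget n w p U) (hw : 0 < w) : w * w * 500 ≤ U := by
  have := h.inv'
  have : w * w * 1 ≤ w * w * w := Nat.mul_le_mul_left _ hw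
  linarith

theorem sw (h : Budget n w p U) (hw : 0 < w) : w * 500 ≤ U := by
  have := h.ww hw
  have : w * 1 ≤ w * w := Nat.mul_le_mul_left _ hw
  linarith

theorem nww (h : Budget n w p U) (hw : 0 < w) : n * w * w * 500 ≤ U := by
  have := h.fam
  have : n * (w * w * 1) ≤ n * (w * w * w) := Nat.mul_le_mul_left _ (Nat.mul_le_mul_left _ hw)
  nlinarith

theorem nnw (h : Budget n w p U) (hw : 0 < w) : n * n * w * 500 ≤ U := by
  have := h.gram
  have : n * n * (w * 1) ≤ n * n * (w * w) := Nat.mul_le_mul_left _ (Nat.mul_le_mul_left _ hw)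
  nlinarith

end Budget

/-- The index scalars during the main loop: `n`, the size `w`, the constant `c`, the exponent
`p`. -/
structure Sizes (σ : State) (n w c p : ℕ) : Prop where
  n : σ.ints 0 0 0 0 = n
  w : σ.ints 3 0 0 0 = w
  c : σ.ints 4 0 0 0 = c
  p : σ.ints 6 0 0 0 = p

theorem Sizes.frame {σ τ : State} {n w c p : ℕ} (h : Sizes σ n w c p) {is rs : List ℕ}
    (hf : Frame is rs σ τ) (his : 0 ∉ is ∧ 3 ∉ is ∧ 4 ∉ is ∧ 6 ∉ is := by simp) :
    Sizes τ n w c p :=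
  ⟨by rw [hf.1 _ his.1, h.n], by rw [hf.1 _ his.2.1, h.w], by rw [hf.1 _ his.2.2.1, h.c],
    by rw [hf.1 _ his.2.2.2, h.p]⟩

/-- Compute the level (`10`), the slack matrix (`12`), its inverse (`13`), the power of the inverse
(`14`) and the trace of that power (`15`). -/
def progBarrier : Prog :=
  .seq (.sumScal 37 0 (.sub (.mul (.at₁ 1 13) (.at₁ 1 13)) (.mul (.at₁ 3 13) (.at₁ 3 13))))
  (.seq (.setR 10 (.add (.var 5)
    (.mul (.div (.mul (.lit 432) (.cast (.var 6))) (.var 5)) (.var 37))))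
  (.seq (.sumMat 11 3 0 (.mul (.sub (.at₁ 1 13) (.at₁ 3 13)) (.at₃ 2 13 11 12)))
  (.seq (.mapMat 12 3 (.sub (.mul (.var 10) (.eqInd (.var 11) (.var 12))) (.at₂ 11 11 12)))
  (.seq (.inv 13 12 (.var 3))
  (.seq (.pow 14 13 3 6)
  (.sumScal 15 3 (.at₂ 14 13 13)))))))

section

variable {n w c p U : ℕ} {σ : State} {D : Fin n → Matrix (Fin w) (Fin w) ℝ} {x xs : Fin n → ℝ}
  {u₀ : ℝ}

theorem WP.barrier (hs : Sizes σ n w c p) (hn : 0 < n) (hw : 0 < w) (hU : Budget n w p U)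
    (hx : HasVec σ 1 x) (hxs : HasVec σ 3 xs) (hD : HasFam σ 2 D) (hu₀ : σ.reals 5 0 0 0 = u₀)
    (hG : (slack D p u₀ x xs).PosDef) :
    WP progBarrier σ (7 * U) (fun τ =>
      HasMat τ 13 (slack D p u₀ x xs)⁻¹ ∧ HasMat τ 14 ((slack D p u₀ x xs)⁻¹ ^ (p + 1)) ∧
      τ.reals 15 0 0 0 = ((slack D p u₀ x xs)⁻¹ ^ (p + 1)).trace) := by
  refine WP.seq_le U (6 * U) (by linarith) ((WP.sumScal (fun i => x i * x i - xs i * xs i) _ rfl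
    hs.n hn (hU.nn hn) (fun τ l hτ h₁ => ?_)).mono le_rfl ?_)
  · simp [RExpr.eval, IExpr.eval, hτ.2, h₁, hx, hxs]
  rintro τ₁ ⟨f₁, g₁⟩
  have s₁ := hs.frame f₁
  refine WP.seq_le U (5 * U) (by linarith) (WP.setR ?_ ?_)
  · have := hU.nn hn
    simp [RExpr.cost, IExpr.cost]
    linarith
  generalize hτ₂ : τ₁.setReal 10 0 0 0 _ = τ₂
  have f₂ : Frame [] [10] τ₁ τ₂ := by
    rw [← hτ₂]; exact (Frame.refl _ _ _).setReal _ _ _ _ (by simp)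
  have g₂ : τ₂.reals 10 0 0 0 = level p u₀ x xs := by
    rw [← hτ₂, State.setReal_apply]
    simp [RExpr.eval, IExpr.eval, f₁.2, hu₀, s₁.p, g₁, level]
  clear hτ₂
  have s₂ := s₁.frame f₂
  refine WP.seq_le U (4 * U) (by linarith) ((WP.sumMat (fun j k l => (x l - xs l) * D l j k)
    (∑ i, (x i - xs i) • D i) (fun j k => by simp [Matrix.sum_apply]) ⟨s₂.w, s₂.n⟩ ⟨hw, hn⟩ ?_
    (fun τ j k l hτ h₁ h₂ h₃ => ?_)).mono le_rfl ?_)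
  · have := hU.nww hw
    linarith
  · simp [RExpr.eval, IExpr.eval, hτ.2, f₁.2, f₂.2, h₁, h₂, h₃, hx, hxs, hD]
  rintro τ₃ ⟨f₃, g₃⟩
  have s₃ := s₂.frame f₃
  refine WP.seq_le U (3 * U) (by linarith) ((WP.mapMat (slack D p u₀ x xs) s₃.w hw (hU.ww hw)
    (fun τ j k hτ h₁ h₂ => ?_)).mono le_rfl ?_)
  · simp [RExpr.eval, RExpr.eqInd_eval, IExpr.eval, hτ.2, f₃.2, g₂, h₁, h₂, g₃, slack,
      Matrix.one_apply, Fin.ext_iff]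
  rintro τ₄ ⟨f₄, g₄⟩
  have s₄ := s₃.frame f₄
  refine WP.seq_le U (2 * U) (by linarith) ((WP.inv (by simp) (by simp) hw (by simp [IExpr.cost])
    hU.inv' (fun τ hτ => ?_) hG g₄).mono le_rfl ?_)
  · exact (s₄.frame hτ).w
  rintro τ₅ ⟨f₅, g₅⟩
  have s₅ := s₄.frame f₅
  refine WP.seq_le U U (by linarith) ((WP.pow (by simp) (by simp) (by simp) (by simp) s₅.w s₅.p hw
    hU.pow g₅).mono le_rfl ?_)
  rintro τ₆ ⟨f₆, g₆⟩
  have s₆ := s₅.frame f₆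
  refine (WP.sumScal (fun l => ((slack D p u₀ x xs)⁻¹ ^ (p + 1)) l l) _ rfl s₆.w hw (hU.sw hw)
    (fun τ l hτ h₁ => ?_)).mono le_rfl ?_
  · simp [RExpr.eval, IExpr.eval, hτ.2, h₁, g₆]
  rintro τ₇ ⟨f₇, g₇⟩
  refine ⟨fun i j => ?_, fun i j => ?_, g₇⟩
  · rw [f₇.2 _ (by simp), f₆.2 _ (by simp), g₅]
  · rw [f₇.2 _ (by simp), g₆]

/-- Select the coordinate `j₀` (index scalar `8`) and compute the reduced matrices (`19`). -/
def progReduce : Prog :=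
  .seq (.mapVec 16 0 (.mul (.at₁ 6 10) (.add (.lit 1) (.abs (.at₁ 1 10)))))
  (.seq (.argmax 8 16 (.var 0))
  (.seq (.mapVec 17 0 (.div (.at₁ 1 10) (.at₁ 1 8)))
  (.seq (.mapVec 18 0 (.mul (.at₁ 6 10) (.sub (.lit 1) (.eqInd (.var 10) (.var 8)))))
  (.mapFam 19 0 3 (.mul (.at₁ 18 10)
    (.sub (.at₃ 2 10 11 12) (.mul (.at₁ 17 10) (.at₃ 2 8 11 12))))))))

theorem WP.reduce (hs : Sizes σ n w c p) (hn : 0 < n) (hw : 0 < w) (hU : Budget n w p U)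
    (hx : HasVec σ 1 x) (hm : HasVec σ 6 (mask x)) (hD : HasFam σ 2 D) :
    WP progReduce σ (5 * U) (fun τ => ∃ j₀ : Fin n, τ.ints 8 0 0 0 = j₀ ∧
      (∀ j, mask x j * (1 + |x j|) ≤ mask x j₀ * (1 + |x j₀|)) ∧
      HasVec τ 17 (fun i => x i / x j₀) ∧ HasVec τ 18 (redMask x j₀) ∧
      HasFam τ 19 (redMat D x j₀)) := by
  refine WP.seq_le U (4 * U) (by linarith) ((WP.mapVec (fun i => mask x i * (1 + |x i|))
    hs.n hn (hU.nn hn) (fun τ l hτ h₁ => ?_)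
    (hc := by simp [RExpr.cost, RExpr.abs, IExpr.cost])).mono le_rfl ?_)
  · simp [RExpr.eval, RExpr.abs_eval, IExpr.eval, hτ.2, h₁, hx, hm]
  rintro τ₁ ⟨f₁, g₁⟩
  have s₁ := hs.frame f₁
  refine WP.seq_le U (3 * U) (by linarith) ((WP.argmax (n := n) (e := .var 0) (by simp) hn (by simp [IExpr.cost])
    (by have := hU.nn hn; linarith) (fun τ hτ => (s₁.frame hτ).n)).mono le_rfl ?_)
  rintro τ₂ ⟨f₂, j₀, hj₀, hmax⟩
  have s₂ := s₁.frame f₂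
  refine WP.seq_le U (2 * U) (by linarith) ((WP.mapVec (fun i => x i / x j₀)
    s₂.n hn (hU.nn hn) (fun τ l hτ h₁ => ?_)).mono le_rfl ?_)
  · simp [RExpr.eval, IExpr.eval, hτ.1, hτ.2, f₁.2, f₂.2, h₁, hx, hj₀]
  rintro τ₃ ⟨f₃, g₃⟩
  have s₃ := s₂.frame f₃
  refine WP.seq_le U U (by linarith) ((WP.mapVec (redMask x j₀)
    s₃.n hn (hU.nn hn) (fun τ l hτ h₁ => ?_)).mono le_rfl ?_)
  · simp [RExpr.eval, RExpr.eqInd_eval, IExpr.eval, hτ.1, hτ.2, f₁.2, f₂.2, f₃.1, f₃.2, h₁, hm, hj₀,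
      redMask, Fin.ext_iff]
  rintro τ₄ ⟨f₄, g₄⟩
  have s₄ := s₃.frame f₄
  refine (WP.mapFam (redMat D x j₀) ⟨s₄.n, s₄.w⟩ ⟨hn, hw⟩ (hU.nww hw)
    (fun τ i j k hτ h₁ h₂ h₃ => ?_)).mono le_rfl ?_
  · simp [RExpr.eval, IExpr.eval, hτ.1, hτ.2, f₁.2, f₂.2, f₃.1, f₃.2, f₄.1, f₄.2, h₁, h₂, h₃, hD,
      hj₀, g₃, g₄, redMat]
  rintro τ₅ ⟨f₅, g₅⟩
  refine ⟨j₀, by rw [f₅.1 _ (by simp), f₄.1 _ (by simp), f₃.1 _ (by simp), hj₀], fun j => ?_,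
    fun i => ?_, fun i => ?_, g₅⟩
  · have := hmax j
    rwa [g₁, g₁] at this
  · rw [f₅.2 _ (by simp), f₄.2 _ (by simp), g₃]
  · rw [f₅.2 _ (by simp), g₄]

/-- Compute the inverse (`25`) of the matrix (`24`) of the quadratic form. -/
def progGram : Prog :=
  .seq (.sumFam 20 0 3 3 3 (.mul (.at₂ 14 11 13) (.at₃ 19 10 13 12)))
  (.seq (.sumFam 21 0 3 3 3 (.mul (.at₃ 20 10 11 13) (.at₂ 13 13 12)))
  (.seq (.sumFam 22 0 0 3 3 (.mul (.at₃ 21 10 12 13) (.at₃ 19 11 13 12)))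
  (.seq (.sumMat 23 0 3 (.at₃ 22 11 12 13))
  (.seq (.mapMat 24 0 (.add (.at₂ 23 11 12)
    (.mul (.eqInd (.var 11) (.var 12)) (.div (.var 15) (.var 5)))))
  (.inv 25 24 (.var 0))))))

/-- The products `W * B i * R` are formed once for every `i`, and only the diagonals of the products
with `B j` are computed. So the Gram matrix costs `n w³ + n² w²` instead of `n² w³`. -/
theorem WP.gramInv {W R : Matrix (Fin w) (Fin w) ℝ} {B : Fin n → Matrix (Fin w) (Fin w) ℝ} {t : ℝ}
    (hs : Sizes σ n w c p) (hn : 0 < n) (hw : 0 < w) (hU : Budget n w p U)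
    (hW : HasMat σ 14 W) (hR : HasMat σ 13 R) (hB : HasFam σ 19 B) (hu₀ : σ.reals 5 0 0 0 = u₀)
    (ht : σ.reals 15 0 0 0 = t) (hQ : (gram W R B (t / u₀)).PosDef) :
    WP progGram σ (6 * U) (fun τ => HasMat τ 25 (gram W R B (t / u₀))⁻¹) := by
  refine WP.seq_le U (5 * U) (by linarith) ((WP.sumFam (fun i j k l => W j l * B i l k)
    (fun i => W * B i) (fun i j k => Matrix.mul_apply) ⟨hs.n, hs.w, hs.w, hs.w⟩ ⟨hn, hw, hw, hw⟩
    (by have := hU.fam; linarith) (fun τ i j k l hτ h₁ h₂ h₃ h₄ => ?_)).mono le_rfl ?_)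
  · simp [RExpr.eval, IExpr.eval, hτ.2, h₁, h₂, h₃, h₄, hW, hB]
  rintro τ₁ ⟨f₁, g₁⟩
  have s₁ := hs.frame f₁
  refine WP.seq_le U (4 * U) (by linarith) ((WP.sumFam (fun i j k l => (W * B i) j l * R l k)
    (fun i => W * B i * R) (fun i j k => Matrix.mul_apply) ⟨s₁.n, s₁.w, s₁.w, s₁.w⟩
    ⟨hn, hw, hw, hw⟩ (by have := hU.fam; linarith)
    (fun τ i j k l hτ h₁ h₂ h₃ h₄ => ?_)).mono le_rfl ?_)
  · simp [RExpr.eval, IExpr.eval, hτ.2, f₁.2, h₁, h₂, h₃, h₄, hR, g₁]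
  rintro τ₂ ⟨f₂, g₂⟩
  have s₂ := s₁.frame f₂
  refine WP.seq_le U (3 * U) (by linarith) ((WP.sumFam (fun i j k l => (W * B i * R) k l * B j l k)
    (fun i => .of fun j k => (W * B i * R * B j) k k)
    (fun i j k => by rw [Matrix.of_apply, Matrix.mul_apply])
    ⟨s₂.n, s₂.n, s₂.w, s₂.w⟩ ⟨hn, hn, hw, hw⟩ (by have := hU.gram; linarith)
    (fun τ i j k l hτ h₁ h₂ h₃ h₄ => ?_)).mono le_rfl ?_)
  · simp [RExpr.eval, IExpr.eval, hτ.2, f₁.2, f₂.2, h₁, h₂, h₃, h₄, hB, g₂]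
  rintro τ₃ ⟨f₃, g₃⟩
  have s₃ := s₂.frame f₃
  refine WP.seq_le U (2 * U) (by linarith) ((WP.sumMat (fun i j l => (W * B i * R * B j) l l)
    (.of fun i j => (W * B i * R * B j).trace) (fun i j => rfl)
    ⟨s₃.n, s₃.w⟩ ⟨hn, hw⟩ (hU.nnw hw)
    (fun τ i j l hτ h₁ h₂ h₃ => ?_)).mono le_rfl ?_)
  · simp [RExpr.eval, IExpr.eval, hτ.2, h₁, h₂, h₃, g₃]
  rintro τ₄ ⟨f₄, g₄⟩
  have s₄ := s₃.frame f₄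
  refine WP.seq_le U U (by linarith) ((WP.mapMat (gram W R B (t / u₀))
    s₄.n hn (hU.nnn hn) (fun τ i j hτ h₁ h₂ => ?_)).mono le_rfl ?_)
  · simp [RExpr.eval, RExpr.eqInd_eval, IExpr.eval, hτ.2, f₁.2, f₂.2, f₃.2, f₄.2, h₁, h₂, g₄, ht,
      hu₀, gram, Matrix.one_apply, Fin.ext_iff]
  rintro τ₅ ⟨f₅, g₅⟩
  have s₅ := s₄.frame f₅
  refine (WP.inv (by simp) (by simp) hn (by simp [IExpr.cost])
    hU.inv (fun τ hτ => ?_) hQ g₅).mono le_rfl (fun τ hτ => hτ.2)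
  exact (s₅.frame hτ).n

/-- Select the column `i₀` (index scalar `9`) and compute the direction (`28`) and the derivative of
the potential in this direction (`31`). -/
def progDir : Prog :=
  .seq (.mapVec 16 0 (.mul (.at₁ 18 10) (.at₂ 25 10 10)))
  (.seq (.argmax 9 16 (.var 0))
  (.seq (.mapVec 26 0 (.mul (.at₁ 18 10) (.div (.at₂ 25 10 9) (.at₂ 25 9 9))))
  (.seq (.sumScal 27 0 (.mul (.at₁ 17 13) (.at₁ 26 13)))
  (.seq (.mapVec 28 0 (.sub (.at₁ 26 10) (.mul (.eqInd (.var 10) (.var 8)) (.var 27))))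
  (.seq (.sumMat 29 3 0 (.mul (.at₁ 28 13) (.at₃ 2 13 11 12)))
  (.seq (.sumVec 30 3 3 (.mul (.at₂ 14 10 13) (.at₂ 29 13 10)))
  (.sumScal 31 3 (.at₁ 30 13))))))))

theorem WP.dir {W : Matrix (Fin w) (Fin w) ℝ} {S : Matrix (Fin n) (Fin n) ℝ} {j₀ : Fin n}
    (hs : Sizes σ n w c p) (hn : 0 < n) (hw : 0 < w) (hU : Budget n w p U)
    (hW : HasMat σ 14 W) (hS : HasMat σ 25 S) (hD : HasFam σ 2 D) (hj₀ : σ.ints 8 0 0 0 = j₀)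
    (hr : HasVec σ 17 (fun i => x i / x j₀)) (hm : HasVec σ 18 (redMask x j₀)) :
    WP progDir σ (8 * U) (fun τ => ∃ i₀ : Fin n,
      (∀ i, redMask x j₀ i * S i i ≤ redMask x j₀ i₀ * S i₀ i₀) ∧
      HasVec τ 28 (fullDir (redDir S x j₀ i₀) x j₀) ∧
      τ.reals 31 0 0 0 = (W * ∑ i, fullDir (redDir S x j₀ i₀) x j₀ i • D i).trace) := by
  refine WP.seq_le U (7 * U) (by linarith) ((WP.mapVec (fun i => redMask x j₀ i * S i i)
    hs.n hn (hU.nn hn) (fun τ l hτ h₁ => ?_)).mono le_rfl ?_)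
  · simp [RExpr.eval, IExpr.eval, hτ.2, h₁, hS, hm]
  rintro τ₁ ⟨f₁, g₁⟩
  have s₁ := hs.frame f₁
  refine WP.seq_le U (6 * U) (by linarith) ((WP.argmax (n := n) (e := .var 0) (by simp) hn (by simp [IExpr.cost])
    (by have := hU.nn hn; linarith) (fun τ hτ => (s₁.frame hτ).n)).mono le_rfl ?_)
  rintro τ₂ ⟨f₂, i₀, hi₀, hmax⟩
  have s₂ := s₁.frame f₂
  set v := redDir S x j₀ i₀ with hv
  refine WP.seq_le U (5 * U) (by linarith) ((WP.mapVec v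
    s₂.n hn (hU.nn hn) (fun τ l hτ h₁ => ?_)).mono le_rfl ?_)
  · simp [RExpr.eval, IExpr.eval, hτ.1, hτ.2, f₁.2, f₂.2, h₁, hS, hm, hi₀, hv, redDir]
  rintro τ₃ ⟨f₃, g₃⟩
  have s₃ := s₂.frame f₃
  refine WP.seq_le U (4 * U) (by linarith) ((WP.sumScal (fun i => x i / x j₀ * v i) _ rfl
    s₃.n hn (hU.nn hn) (fun τ l hτ h₁ => ?_)).mono le_rfl ?_)
  · simp [RExpr.eval, IExpr.eval, hτ.2, f₁.2, f₂.2, f₃.2, h₁, g₃, hr]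
  rintro τ₄ ⟨f₄, g₄⟩
  have s₄ := s₃.frame f₄
  refine WP.seq_le U (3 * U) (by linarith) ((WP.mapVec (fullDir v x j₀)
    s₄.n hn (hU.nn hn) (fun τ l hτ h₁ => ?_)).mono le_rfl ?_)
  · simp [RExpr.eval, RExpr.eqInd_eval, IExpr.eval, hτ.1, hτ.2, f₁.1, f₂.1, f₃.1, f₄.1, f₄.2, h₁,
      hj₀, g₃, g₄, fullDir, Fin.ext_iff]
  rintro τ₅ ⟨f₅, g₅⟩
  have s₅ := s₄.frame f₅
  set y := fullDir v x j₀ with hy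
  refine WP.seq_le U (2 * U) (by linarith) ((WP.sumMat (fun j k l => y l * D l j k)
    (∑ i, y i • D i) (fun j k => by simp [Matrix.sum_apply]) ⟨s₅.w, s₅.n⟩ ⟨hw, hn⟩ ?_
    (fun τ j k l hτ h₁ h₂ h₃ => ?_)).mono le_rfl ?_)
  · have := hU.nww hw
    linarith
  · simp [RExpr.eval, IExpr.eval, hτ.2, f₁.2, f₂.2, f₃.2, f₄.2, f₅.2, h₁, h₂, h₃, hD, g₅]
  rintro τ₆ ⟨f₆, g₆⟩
  have s₆ := s₅.frame f₆
  refine WP.seq_le U U (by linarith) ((WP.sumVec (fun i l => W i l * (∑ i, y i • D i) l i)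
    (fun i => (W * ∑ i, y i • D i) i i) (fun i => Matrix.mul_apply)
    ⟨s₆.w, s₆.w⟩ ⟨hw, hw⟩ (hU.ww hw) (fun τ i l hτ h₁ h₂ => ?_)).mono le_rfl ?_)
  · simp only [RExpr.eval, IExpr.eval, h₁, h₂]
    rw [hτ.2 _ (by simp), hτ.2 _ (by simp), g₆, f₆.2 _ (by simp), f₅.2 _ (by simp),
      f₄.2 _ (by simp), f₃.2 _ (by simp), f₂.2 _ (by simp), f₁.2 _ (by simp), hW]
  rintro τ₇ ⟨f₇, g₇⟩
  have s₇ := s₆.frame f₇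
  refine (WP.sumScal (fun i => (W * ∑ i, y i • D i) i i) _ rfl s₇.w hw (hU.sw hw)
    (fun τ l hτ h₁ => ?_)).mono le_rfl ?_
  · simp only [RExpr.eval, IExpr.eval, h₁]
    rw [hτ.2 _ (by simp), g₇]
  rintro τ₈ ⟨f₈, g₈⟩
  refine ⟨i₀, fun j => ?_, fun i => ?_, g₈⟩
  · have := hmax j
    rwa [g₁, g₁] at this
  · rw [f₈.2 _ (by simp), f₇.2 _ (by simp), f₆.2 _ (by simp), g₅]

/-- Move `x` in the direction `28`, with the sign and the length that the potential demands. -/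
def progMove : Prog :=
  .seq (.mapVec 32 0 (.mul
    (.sub (.lit 1) (.mul (.lit 2) (.ind (.add (.var 31) (.abs (.var 31)))))) (.at₁ 28 10)))
  (.seq (.sumScal 33 0 (.mul (.at₁ 32 13) (.at₁ 32 13)))
  (.seq (.mapVec 34 0 (.max (.div (.at₁ 32 10) (.sub (.lit 1) (.at₁ 1 10)))
    (.div (.sub (.lit 0) (.at₁ 32 10)) (.add (.lit 1) (.at₁ 1 10)))))
  (.seq (.argmax 15 34 (.var 0))
  (.seq (.setR 35 (.max (.sqrt (.mul (.var 33)
    (.mul (.lit 1024) (.mul (.cast (.var 0)) (.cast (.var 4)))))) (.at₁ 34 15)))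
  (.seq (.mapVec 36 0 (.add (.at₁ 1 10) (.div (.at₁ 32 10) (.var 35))))
  (.mapVec 1 0 (.at₁ 36 10)))))))

theorem WP.move {y : Fin n → ℝ} {l : ℝ}
    (hs : Sizes σ n w c p) (hn : 0 < n) (hU : Budget n w p U)
    (hx : HasVec σ 1 x) (hy : HasVec σ 28 y) (hl : σ.reals 31 0 0 0 = l) :
    WP progMove σ (7 * U) (fun τ => ∃ k : Fin n,
      (∀ i, rate x (descSign l • y) i ≤ rate x (descSign l • y) k) ∧
      HasVec τ 1 (fun i => x i + (descSign l • y) i /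
        max (Real.sqrt ((∑ i, (descSign l • y) i * (descSign l • y) i) * (1024 * (n * c))))
          (rate x (descSign l • y) k))) := by
  set z := descSign l • y with hz
  refine WP.seq_le U (6 * U) (by linarith) ((WP.mapVec z
    hs.n hn (hU.nn hn) (fun τ i hτ h₁ => ?_)
    (hc := by simp [RExpr.cost, RExpr.abs, RExpr.ind, IExpr.cost])).mono le_rfl ?_)
  · simp only [RExpr.eval, RExpr.ind_eval, RExpr.abs_eval, IExpr.eval, h₁]
    rw [hτ.2 _ (by simp), hτ.2 _ (by simp), hy, hl, hz, Pi.smul_apply, smul_eq_mul, descSign]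
    congr 1
    -- `l + |l|` vanishes exactly when `l ≤ 0`, so its indicator yields the sign without a branch.
    by_cases h : 0 < l
    · rw [if_pos h, if_neg (by positivity)]; norm_num
    · rw [if_neg h, if_pos (by rw [abs_of_nonpos (not_lt.1 h)]; ring)]; norm_num
  rintro τ₁ ⟨f₁, g₁⟩
  have s₁ := hs.frame f₁
  refine WP.seq_le U (5 * U) (by linarith) ((WP.sumScal (fun i => z i * z i) _ rfl
    s₁.n hn (hU.nn hn) (fun τ i hτ h₁ => ?_)).mono le_rfl ?_)
  · simp [RExpr.eval, IExpr.eval, hτ.2, h₁, g₁]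
  rintro τ₂ ⟨f₂, g₂⟩
  have s₂ := s₁.frame f₂
  refine WP.seq_le U (4 * U) (by linarith) ((WP.mapVec (rate x z)
    s₂.n hn (hU.nn hn) (fun τ i hτ h₁ => ?_)
    (hc := by simp [RExpr.cost, RExpr.max, RExpr.abs, IExpr.cost])).mono le_rfl ?_)
  · simp only [RExpr.eval, RExpr.max_eval, IExpr.eval, h₁]
    rw [hτ.2 _ (by simp), hτ.2 _ (by simp), f₂.2 _ (by simp), f₂.2 _ (by simp), g₁,
      f₁.2 _ (by simp), hx, rate]
    simp
  rintro τ₃ ⟨f₃, g₃⟩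
  have s₃ := s₂.frame f₃
  refine WP.seq_le U (3 * U) (by linarith) ((WP.argmax (n := n) (e := .var 0) (by simp) hn (by simp [IExpr.cost])
    (by have := hU.nn hn; linarith) (fun τ hτ => (s₃.frame hτ).n)).mono le_rfl ?_)
  rintro τ₄ ⟨f₄, k, hk, hmax⟩
  have s₄ := s₃.frame f₄
  refine WP.seq_le U (2 * U) (by linarith) (WP.setR ?_ ?_)
  · have := hU.nn hn
    simp [RExpr.cost, RExpr.max, RExpr.abs, IExpr.cost]
    linarith
  generalize hτ₅ : τ₄.setReal 35 0 0 0 _ = τ₅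
  have f₅ : Frame [] [35] τ₄ τ₅ := by
    rw [← hτ₅]; exact (Frame.refl _ _ _).setReal _ _ _ _ (by simp)
  have g₅ : τ₅.reals 35 0 0 0 = max (Real.sqrt ((∑ i, z i * z i) * (1024 * (n * c))))
      (rate x z k) := by
    rw [← hτ₅, State.setReal_apply]
    simp only [and_self, if_true, RExpr.max_eval, RExpr.eval, IExpr.eval]
    rw [f₄.2 _ (by simp), f₄.2 _ (by simp), f₃.2 33 (by simp), g₂, s₄.n, s₄.c, hk, g₃]
    norm_num
  clear hτ₅
  have s₅ := s₄.frame f₅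
  set r := max (Real.sqrt ((∑ i, z i * z i) * (1024 * (n * c)))) (rate x z k)
  refine WP.seq_le U U (by linarith) ((WP.mapVec (fun i => x i + z i / r)
    s₅.n hn (hU.nn hn) (fun τ i hτ h₁ => ?_)).mono le_rfl ?_)
  · simp only [RExpr.eval, IExpr.eval, h₁]
    rw [hτ.2 _ (by simp), hτ.2 _ (by simp), hτ.2 _ (by simp), g₅, f₅.2 _ (by simp),
      f₅.2 _ (by simp), f₄.2 _ (by simp), f₄.2 _ (by simp), f₃.2 _ (by simp), f₃.2 _ (by simp),
      f₂.2 _ (by simp), f₂.2 _ (by simp), f₁.2 1 (by simp), g₁, hx]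
  rintro τ₆ ⟨f₆, g₆⟩
  have s₆ := s₅.frame f₆
  refine (WP.mapVec (fun i => x i + z i / r) s₆.n hn (hU.nn hn)
    (fun τ i hτ h₁ => ?_)).mono le_rfl ?_
  · simp only [RExpr.eval, IExpr.eval, h₁]
    rw [hτ.2 _ (by simp), g₆]
  rintro τ₇ ⟨f₇, g₇⟩
  refine ⟨k, fun i => ?_, g₇⟩
  have := hmax i
  rwa [g₃, g₃] at this

end

end RealRAM

/-! ### Trace inequalities for real matrices -/

namespace Matrix

set_option linter.unusedSectionVars false

variable {ι : Type*} [Fintype ι] [DecidableEq ι]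

/-- The Frobenius norm of `X - Xᵀ` is nonnegative. -/
theorem trace_mul_self_le (X : Matrix ι ι ℝ) : (X * X).trace ≤ (X * Xᵀ).trace := by
  have h := (posSemidef_self_mul_conjTranspose (X - Xᵀ)).trace_nonneg
  rw [conjTranspose_eq_transpose_of_trivial, transpose_sub, transpose_transpose, mul_sub, sub_mul,
    sub_mul, trace_sub, trace_sub, trace_sub, ← transpose_mul, trace_transpose,
    trace_mul_comm Xᵀ X] at h
  linarith

theorem trace_mul_pow_comm (A B : Matrix ι ι ℝ) (k : ℕ) :
    ((A * B) ^ k).trace = ((B * A) ^ k).trace := by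
  cases k with
  | zero => simp
  | succ k =>
    rw [pow_succ, ← mul_assoc, mul_pow_mul, mul_assoc, trace_mul_comm, mul_assoc, ← pow_succ]

/-- The inequalities of Weyl and of Lieb and Thirring, for exponents that are powers of two. -/
theorem trace_pow_two_pow_le (k : ℕ) :
    (∀ X : Matrix ι ι ℝ, (X ^ 2 ^ (k + 1)).trace ≤ ((X * Xᵀ) ^ 2 ^ k).trace) ∧
    ∀ P Q : Matrix ι ι ℝ, P.IsSymm → Q.IsSymm →
      ((P * Q) ^ 2 ^ k).trace ≤ (P ^ 2 ^ k * Q ^ 2 ^ k).trace := by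
  induction k with
  | zero =>
    refine ⟨fun X => ?_, fun P Q _ _ => by simp⟩
    simpa [pow_two] using trace_mul_self_le X
  | succ k ih =>
    obtain ⟨ihS, ihL⟩ := ih
    refine ⟨fun X => ?_, fun P Q hP hQ => ?_⟩
    · have hA : (Xᵀ * X).IsSymm := by rw [IsSymm, transpose_mul, transpose_transpose]
      have hB : (X * Xᵀ).IsSymm := by rw [IsSymm, transpose_mul, transpose_transpose]
      set A := (Xᵀ * X) ^ 2 ^ k with hAdef
      set B := (X * Xᵀ) ^ 2 ^ k with hBdef
      have hAs : Aᵀ = A := by rw [hAdef, transpose_pow, hA.eq]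
      have hBs : Bᵀ = B := by rw [hBdef, transpose_pow, hB.eq]
      -- The first inequality for `X²`, a cyclic rearrangement, and the second inequality for `XᵀX`
      -- and `XXᵀ`.
      have h1 : (X ^ 2 ^ (k + 1 + 1)).trace ≤ (A * B).trace := by
        calc (X ^ 2 ^ (k + 1 + 1)).trace = ((X * X) ^ 2 ^ (k + 1)).trace := by
              rw [← pow_two, ← pow_mul, ← pow_succ']
          _ ≤ (((X * X) * (X * X)ᵀ) ^ 2 ^ k).trace := ihS _
          _ = ((X * (X * Xᵀ * Xᵀ)) ^ 2 ^ k).trace := by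
              rw [transpose_mul]; simp only [mul_assoc]
          _ = (((Xᵀ * X) * (X * Xᵀ)) ^ 2 ^ k).trace := by
              rw [← mul_assoc, trace_mul_pow_comm]; simp only [mul_assoc]
          _ ≤ _ := ihL _ _ hA hB
      -- `2 tr (A B) ≤ tr A² + tr B²`, and the two terms on the right agree by cyclicity.
      have h2 := (posSemidef_self_mul_conjTranspose (A - B)).trace_nonneg
      rw [conjTranspose_eq_transpose_of_trivial, transpose_sub, hAs, hBs, mul_sub, sub_mul,
        sub_mul, trace_sub, trace_sub, trace_sub, trace_mul_comm B A] at h2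
      have h3 : (A * A).trace = (B * B).trace := by
        rw [hAdef, hBdef, ← pow_add, ← pow_add, trace_mul_pow_comm]
      have h4 : (B * B).trace = ((X * Xᵀ) ^ 2 ^ (k + 1)).trace := by
        rw [hBdef, ← pow_add, pow_succ, mul_two]
      linarith
    -- The matrix `(P Q)(P Q)ᵀ = P Q² P` has the same traces of powers as `P² Q²`, which leaves the
    -- second inequality for the squares with half the exponent.
    · calc ((P * Q) ^ 2 ^ (k + 1)).trace ≤ (((P * Q) * (P * Q)ᵀ) ^ 2 ^ k).trace := ihS _
        _ = ((P * (Q * Q * P)) ^ 2 ^ k).trace := by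
            rw [transpose_mul, hP.eq, hQ.eq]; simp only [mul_assoc]
        _ = ((P * P * (Q * Q)) ^ 2 ^ k).trace := by
            rw [trace_mul_pow_comm, mul_assoc, trace_mul_pow_comm]
        _ ≤ ((P * P) ^ 2 ^ k * (Q * Q) ^ 2 ^ k).trace :=
            ihL _ _ (by rw [IsSymm, transpose_mul, hP.eq]) (by rw [IsSymm, transpose_mul, hQ.eq])
        _ = _ := by
            rw [← pow_two, ← pow_two, ← pow_mul, ← pow_mul, ← pow_succ']

theorem IsHermitian.exists_diagonalization {A : Matrix ι ι ℝ} (hA : A.IsHermitian) :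
    ∃ (U : Matrix ι ι ℝ) (d : ι → ℝ), Uᵀ * U = 1 ∧ U * Uᵀ = 1 ∧ A = U * diagonal d * Uᵀ := by
  refine ⟨hA.eigenvectorUnitary, hA.eigenvalues, ?_, ?_, ?_⟩
  · have := Unitary.coe_star_mul_self hA.eigenvectorUnitary
    rwa [star_eq_conjTranspose, conjTranspose_eq_transpose_of_trivial] at this
  · have := Unitary.coe_mul_star_self hA.eigenvectorUnitary
    rwa [Unitary.coe_star, star_eq_conjTranspose, conjTranspose_eq_transpose_of_trivial] at this
  · have := hA.spectral_theorem
    rw [Unitary.conjStarAlgAut_apply, star_eq_conjTranspose,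
      conjTranspose_eq_transpose_of_trivial] at this
    exact this

theorem posSemidef_real_iff {A : Matrix ι ι ℝ} :
    A.PosSemidef ↔ A.IsSymm ∧ ∀ v, 0 ≤ v ⬝ᵥ A *ᵥ v := by
  rw [posSemidef_iff_dotProduct_mulVec]
  simp [IsHermitian, IsSymm, conjTranspose_eq_transpose_of_trivial]

theorem posDef_real_iff {A : Matrix ι ι ℝ} :
    A.PosDef ↔ A.IsSymm ∧ ∀ v, v ≠ 0 → 0 < v ⬝ᵥ A *ᵥ v := by
  rw [posDef_iff_dotProduct_mulVec]
  simp [IsHermitian, IsSymm, conjTranspose_eq_transpose_of_trivial]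

theorem dotProduct_self_pos {v : ι → ℝ} (hv : v ≠ 0) : 0 < v ⬝ᵥ v :=
  lt_of_le_of_ne (Finset.sum_nonneg fun i _ => mul_self_nonneg (v i))
    (fun h => hv (dotProduct_self_eq_zero.1 h.symm))

theorem dotProduct_self_nonneg' (v : ι → ℝ) : 0 ≤ v ⬝ᵥ v :=
  Finset.sum_nonneg fun i _ => mul_self_nonneg (v i)

theorem IsSymm.dotProduct_mulVec_comm {A : Matrix ι ι ℝ} (hA : A.IsSymm) (v w : ι → ℝ) :
    v ⬝ᵥ A *ᵥ w = (A *ᵥ v) ⬝ᵥ w := by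
  rw [dotProduct_mulVec, ← mulVec_transpose, hA.eq]

theorem conj_diagonal_pow {U : Matrix ι ι ℝ} (hU : Uᵀ * U = 1) (hU' : U * Uᵀ = 1) (d : ι → ℝ)
    (k : ℕ) : (U * diagonal d * Uᵀ) ^ k = U * diagonal (d ^ k) * Uᵀ := by
  induction k with
  | zero => simp [hU']
  | succ k ih =>
    rw [pow_succ, ih]
    calc U * diagonal (d ^ k) * Uᵀ * (U * diagonal d * Uᵀ)
        = U * diagonal (d ^ k) * (Uᵀ * U) * diagonal d * Uᵀ := by simp only [mul_assoc]
      _ = U * (diagonal (d ^ k) * diagonal d) * Uᵀ := by rw [hU, mul_one]; simp only [mul_assoc]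
      _ = _ := by rw [diagonal_mul_diagonal]; rfl

theorem PosSemidef.exists_symm_sqrt {A : Matrix ι ι ℝ} (hA : A.PosSemidef) :
    ∃ V : Matrix ι ι ℝ, V.IsSymm ∧ V * V = A := by
  obtain ⟨U, d, hU, hU', hd⟩ := hA.1.exists_diagonalization
  have hdn : ∀ i, 0 ≤ d i := by
    intro i
    have h := (hA.conjTranspose_mul_mul_same U).diag_nonneg (i := i)
    rw [hd, conjTranspose_eq_transpose_of_trivial] at h
    have : Uᵀ * (U * diagonal d * Uᵀ) * U = diagonal d := by
      calc _ = (Uᵀ * U) * diagonal d * (Uᵀ * U) := by simp only [mul_assoc]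
        _ = _ := by rw [hU, one_mul, mul_one]
    rw [this] at h
    simpa using h
  refine ⟨U * diagonal (fun i => Real.sqrt (d i)) * Uᵀ, ?_, ?_⟩
  · rw [IsSymm, transpose_mul, transpose_mul, transpose_transpose, diagonal_transpose, mul_assoc]
  · rw [← pow_two, conj_diagonal_pow hU hU', hd]
    congr 3
    funext i
    exact Real.sq_sqrt (hdn i)

theorem PosSemidef.trace_mul_nonneg {A B : Matrix ι ι ℝ} (hA : A.PosSemidef) (hB : B.PosSemidef) :
    0 ≤ (A * B).trace := by
  obtain ⟨V, hV, rfl⟩ := hA.exists_symm_sqrt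
  rw [mul_assoc, trace_mul_comm]
  have := (hB.mul_mul_conjTranspose_same V).trace_nonneg
  rwa [conjTranspose_eq_transpose_of_trivial, hV.eq] at this

/-- Bernoulli gives `(1 - z) ^ p ≥ 1 - p z`, and with `t = p z ≤ 1/2` one has `(1 - t)(1 + t + 3 t²)
= 1 + 2 t² - 3 t³ ≥ 1`. -/
theorem inv_one_sub_pow_le {z : ℝ} {p : ℕ} (hp : 0 < p) (hz : |z| ≤ 1 / (2 * p)) :
    ((1 - z)⁻¹) ^ p ≤ 1 + p * z + 3 * p ^ 2 * z ^ 2 := by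
  have hp' : (1 : ℝ) ≤ p := by exact_mod_cast hp
  have hz1 : |p * z| ≤ 1 / 2 := by
    rw [abs_mul, abs_of_pos (by linarith : (0 : ℝ) < p)]
    calc (p : ℝ) * |z| ≤ p * (1 / (2 * p)) := by gcongr
      _ = 1 / 2 := by field_simp
  have hz2 : |z| ≤ 1 / 2 := hz.trans (by
    rw [div_le_div_iff₀ (by positivity) (by norm_num)]; linarith)
  obtain ⟨h1, h2⟩ := abs_le.1 hz1
  obtain ⟨h3, h4⟩ := abs_le.1 hz2
  have hb := one_add_mul_le_pow (a := -z) (by linarith) p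
  have h5 : (1 : ℝ) ≤ (1 - p * z) * (1 + p * z + 3 * p ^ 2 * z ^ 2) := by
    nlinarith [sq_nonneg (p * z), mul_nonneg (sq_nonneg (p * z)) (by linarith : 0 ≤ 1 / 2 - p * z)]
  have h6 : 0 ≤ 1 + p * z + 3 * p ^ 2 * z ^ 2 := by nlinarith [sq_nonneg (p * z)]
  have h7 : 0 < (1 - z) ^ p := pow_pos (by linarith) p
  rw [inv_pow, inv_le_iff_one_le_mul₀ h7]
  have h8 : 1 - p * z ≤ (1 - z) ^ p := by
    calc 1 - p * z = 1 + p * -z := by ring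
      _ ≤ (1 + -z) ^ p := hb
      _ = _ := by ring_nf
  nlinarith

/-- The expansion of `tr (A (1 - Z)⁻ᵖ)` for small `Z`. -/
theorem trace_mul_inv_one_sub_pow_le {A Z : Matrix ι ι ℝ} {p : ℕ} (hp : 0 < p)
    (hA : A.PosSemidef) (hZ : Z.IsSymm)
    (hb : ∀ v, |v ⬝ᵥ Z *ᵥ v| ≤ 1 / (2 * p) * (v ⬝ᵥ v)) :
    (1 - Z).PosDef ∧
    (A * ((1 - Z)⁻¹) ^ p).trace ≤ A.trace + p * (A * Z).trace + 3 * p ^ 2 * (A * Z * Z).trace := by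
  have hp' : (1 : ℝ) ≤ p := by exact_mod_cast hp
  have hβ : 1 / (2 * (p : ℝ)) ≤ 1 / 2 := by
    rw [div_le_div_iff₀ (by positivity) (by norm_num)]; linarith
  refine ⟨posDef_real_iff.2 ⟨by rw [IsSymm, transpose_sub, transpose_one, hZ.eq], fun v hv => ?_⟩, ?_⟩
  · have h0 := dotProduct_self_pos hv
    have h1 := (abs_le.1 (hb v)).2
    rw [sub_mulVec, one_mulVec, dotProduct_sub]
    nlinarith
  have hZh : Z.IsHermitian := by
    rw [IsHermitian, conjTranspose_eq_transpose_of_trivial]; exact hZ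
  obtain ⟨U, d, hU, hU', hd⟩ := hZh.exists_diagonalization
  have hdb : ∀ i, |d i| ≤ 1 / (2 * p) := by
    intro i
    have h := hb (U *ᵥ Pi.single i 1)
    have e1 : (U *ᵥ Pi.single i 1) ⬝ᵥ (U *ᵥ Pi.single i 1) = (1 : ℝ) := by
      rw [dotProduct_mulVec, ← mulVec_transpose, mulVec_mulVec, hU, one_mulVec]; simp
    have e2 : (U *ᵥ Pi.single i 1) ⬝ᵥ Z *ᵥ (U *ᵥ Pi.single i 1) = d i := by
      rw [dotProduct_comm, dotProduct_mulVec, ← mulVec_transpose, mulVec_mulVec, mulVec_mulVec, hd]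
      have : Uᵀ * (U * diagonal d * Uᵀ) * U = diagonal d := by
        calc _ = (Uᵀ * U) * diagonal d * (Uᵀ * U) := by simp only [mul_assoc]
          _ = _ := by rw [hU, one_mul, mul_one]
      rw [this]
      simp
    rwa [e1, e2, mul_one] at h
  have hd1 : ∀ i, 1 - d i ≠ 0 := fun i => by
    have := (abs_le.1 (hdb i)).2
    intro h; linarith
  have hinv : (1 - Z)⁻¹ = U * diagonal (fun i => (1 - d i)⁻¹) * Uᵀ := by
    apply inv_eq_right_inv
    have e : 1 - Z = U * diagonal (fun i => 1 - d i) * Uᵀ := by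
      have : diagonal (fun i => 1 - d i) = 1 - diagonal d := by
        rw [← diagonal_one, diagonal_sub]
      rw [this, mul_sub, sub_mul, mul_one, hU', hd]
    rw [e]
    calc U * diagonal (fun i => 1 - d i) * Uᵀ * (U * diagonal (fun i => (1 - d i)⁻¹) * Uᵀ)
        = U * diagonal (fun i => 1 - d i) * (Uᵀ * U) * diagonal (fun i => (1 - d i)⁻¹) * Uᵀ := by
          simp only [mul_assoc]
      _ = U * (diagonal (fun i => 1 - d i) * diagonal (fun i => (1 - d i)⁻¹)) * Uᵀ := by
          rw [hU, mul_one]; simp only [mul_assoc]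
      _ = 1 := by
          rw [diagonal_mul_diagonal]
          simp only [fun i => mul_inv_cancel₀ (hd1 i), diagonal_one, mul_one, hU']
  -- The scalar inequality at each eigenvalue of `Z` makes a polynomial in `Z` dominate `(1 - Z)⁻ᵖ`.
  -- The trace against `A ≥ 0` preserves this, although `A` and `Z` need not commute.
  set g : ι → ℝ := fun i => 1 + p * d i + 3 * p ^ 2 * d i ^ 2 - ((1 - d i)⁻¹) ^ p with hg
  have hpsd : (U * diagonal g * Uᵀ).PosSemidef := by
    have := (PosSemidef.diagonal (d := g) (fun i => by
      have := inv_one_sub_pow_le hp (hdb i)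
      simp only [Pi.zero_apply, hg]; linarith)).mul_mul_conjTranspose_same U
    rwa [conjTranspose_eq_transpose_of_trivial] at this
  have hexp : U * diagonal g * Uᵀ =
      1 + (p : ℝ) • Z + (3 * (p : ℝ) ^ 2) • (Z * Z) - ((1 - Z)⁻¹) ^ p := by
    rw [hinv, conj_diagonal_pow hU hU', ← pow_two Z, hd, conj_diagonal_pow hU hU']
    have : diagonal g = 1 + (p : ℝ) • diagonal d + (3 * (p : ℝ) ^ 2) • diagonal (d ^ 2) -
        diagonal ((fun i => (1 - d i)⁻¹) ^ p) := by
      ext i j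
      by_cases hij : i = j
      · subst hij; simp [hg]
      · simp [hij]
    rw [this]
    simp only [mul_sub, sub_mul, mul_add, add_mul, mul_one, hU', smul_mul_assoc, mul_smul_comm]
  have h := hA.trace_mul_nonneg hpsd
  rw [hexp, mul_sub, mul_add, mul_add, mul_one, mul_smul_comm, mul_smul_comm, trace_sub, trace_add,
    trace_add, trace_smul, trace_smul, smul_eq_mul, smul_eq_mul, ← mul_assoc] at h
  linarith

/-- One step of the barrier argument: shifting the slack matrix `G` by `-Y` and raising the barrier
by `du` does not increase the potential `tr G⁻ᵖ`. -/
theorem PosDef.trace_inv_pow_barrier_le {G Y : Matrix ι ι ℝ} {k p : ℕ} {du a b τ : ℝ}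
    (hG : G.PosDef) (hY : Y.IsSymm) (hp : p = 2 ^ k) (hdu : 0 ≤ du)
    (hR : ∀ v, v ⬝ᵥ G⁻¹ *ᵥ v ≤ a * (v ⬝ᵥ v)) (hb : ∀ v, |v ⬝ᵥ Y *ᵥ v| ≤ b * (v ⬝ᵥ v))
    (hb0 : 0 ≤ b)
    (h1 : p * (a * b) ≤ 1 / 4) (h2 : p * (a * du) ≤ 1 / 12)
    (hl : (G⁻¹ ^ (p + 1) * Y).trace ≤ 0)
    (hQ : (G⁻¹ ^ (p + 1) * Y * G⁻¹ * Y).trace ≤ τ * (G⁻¹ ^ (p + 1)).trace)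
    (h3 : 12 * p * τ ≤ du) :
    (G + du • 1 - Y).PosDef ∧ ((G + du • 1 - Y)⁻¹ ^ p).trace ≤ (G⁻¹ ^ p).trace := by
  have hp0 : 0 < p := hp ▸ Nat.two_pow_pos k
  have hp' : (1 : ℝ) ≤ p := by exact_mod_cast hp0
  have hRp := hG.inv
  set R := G⁻¹ with hRdef
  obtain ⟨V, hV, hVV⟩ := hRp.posSemidef.exists_symm_sqrt
  have hVu : IsUnit V.det := by
    have h : IsUnit (V * V).det := hVV ▸ (isUnit_iff_isUnit_det _).1 hRp.isUnit
    rw [det_mul] at h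
    exact isUnit_of_mul_isUnit_left h
  set Y' := Y - du • (1 : Matrix ι ι ℝ) with hY'
  have hY's : Y'.IsSymm := by rw [hY', IsSymm, transpose_sub, transpose_smul, transpose_one, hY.eq]
  -- With `V = R^(1/2)` the new slack is `V⁻¹ (1 - Z) V⁻¹`, so its inverse is `V (1 - Z)⁻¹ V`.
  set Z := V * Y' * V with hZ
  have hZs : Z.IsSymm := by
    rw [hZ, IsSymm, transpose_mul, transpose_mul, hV.eq, hY's.eq, mul_assoc]
  have hZb : ∀ v, |v ⬝ᵥ Z *ᵥ v| ≤ 1 / (2 * p) * (v ⬝ᵥ v) := by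
    intro v
    have e1 : v ⬝ᵥ Z *ᵥ v = (V *ᵥ v) ⬝ᵥ Y *ᵥ (V *ᵥ v) - du * ((V *ᵥ v) ⬝ᵥ (V *ᵥ v)) := by
      rw [hZ, ← mulVec_mulVec, ← mulVec_mulVec, hV.dotProduct_mulVec_comm, hY', sub_mulVec,
        dotProduct_sub, smul_mulVec, one_mulVec, dotProduct_smul, smul_eq_mul]
    have e2 : (V *ᵥ v) ⬝ᵥ (V *ᵥ v) = v ⬝ᵥ R *ᵥ v := by
      rw [← hV.dotProduct_mulVec_comm, mulVec_mulVec, hVV]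
    have e3 := hR v
    have e4 := hb (V *ᵥ v)
    have e5 := dotProduct_self_nonneg' (V *ᵥ v)
    have e6 := dotProduct_self_nonneg' v
    rw [e1]
    have e7 : (b + du) * ((V *ᵥ v) ⬝ᵥ (V *ᵥ v)) ≤ (b + du) * (a * (v ⬝ᵥ v)) :=
      mul_le_mul_of_nonneg_left (e2 ▸ e3) (by linarith)
    -- `p a b + p a du ≤ 1/4 + 1/12 < 1/2`, so the expansion of `(1 - Z)⁻ᵖ` applies.
    have e8 : (b + du) * a ≤ 1 / (2 * p) := by
      rw [le_div_iff₀ (by positivity)]; nlinarith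
    have e9 := mul_le_mul_of_nonneg_right e8 e6
    have e10 : |(V *ᵥ v) ⬝ᵥ Y *ᵥ (V *ᵥ v) - du * ((V *ᵥ v) ⬝ᵥ (V *ᵥ v))| ≤
        b * ((V *ᵥ v) ⬝ᵥ (V *ᵥ v)) + du * ((V *ᵥ v) ⬝ᵥ (V *ᵥ v)) :=
      (abs_sub _ _).trans (add_le_add e4 (abs_of_nonneg (mul_nonneg hdu e5)).le)
    linarith
  have hRpow : ∀ j, (R ^ j).PosSemidef := fun j => hRp.posSemidef.pow j
  obtain ⟨hpd, htr⟩ := trace_mul_inv_one_sub_pow_le hp0 (hRpow p) hZs hZb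
  have hVGV : V * G * V = 1 := by
    have hGi : G = V⁻¹ * V⁻¹ := by
      rw [← mul_inv_rev, hVV, hRdef, nonsing_inv_nonsing_inv _
        ((isUnit_iff_isUnit_det _).1 hG.isUnit)]
    rw [hGi, ← mul_assoc, mul_nonsing_inv _ hVu, one_mul, nonsing_inv_mul _ hVu]
  have hGY : G + du • 1 - Y = V⁻¹ * (1 - Z) * V⁻¹ := by
    have : 1 - Z = V * (G + du • 1 - Y) * V := by
      rw [hZ, hY', ← hVGV]
      simp only [mul_sub, mul_add, sub_mul, add_mul]
      abel
    rw [this]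
    calc G + du • 1 - Y = (V⁻¹ * V) * (G + du • 1 - Y) * (V * V⁻¹) := by
          rw [nonsing_inv_mul _ hVu, mul_nonsing_inv _ hVu, one_mul, mul_one]
      _ = _ := by simp only [mul_assoc]
  have hVi : V⁻¹.IsSymm := by rw [IsSymm, transpose_nonsing_inv, hV.eq]
  refine ⟨?_, ?_⟩
  · rw [hGY]
    have hinj : Function.Injective V⁻¹.mulVec := by
      rw [mulVec_injective_iff_isUnit, isUnit_iff_isUnit_det]
      exact isUnit_nonsing_inv_det _ hVu
    have := hpd.conjTranspose_mul_mul_same hinj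
    rwa [conjTranspose_eq_transpose_of_trivial, hVi.eq] at this
  · have hinv : (G + du • 1 - Y)⁻¹ = V * (1 - Z)⁻¹ * V := by
      rw [hGY, mul_inv_rev, mul_inv_rev, nonsing_inv_nonsing_inv _ hVu, mul_assoc]
    have hXs : ((1 - Z)⁻¹).IsSymm := by
      rw [IsSymm, transpose_nonsing_inv, transpose_sub, transpose_one, hZs.eq]
    have hRs : R.IsSymm := by
      have := hRp.1
      rwa [IsHermitian, conjTranspose_eq_transpose_of_trivial] at this
    have hcomm : V * R ^ p * V = R ^ (p + 1) := by
      rw [← hVV, ← pow_two, ← pow_mul, ← pow_mul, ← pow_succ', ← pow_succ]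
      congr 1
    -- The Lieb–Thirring inequality separates the powers of the noncommuting factors `R` and `(1 -
    -- Z)⁻¹`. It is available because `p` is a power of two.
    have hlt : ((V * (1 - Z)⁻¹ * V) ^ p).trace ≤ (R ^ p * (1 - Z)⁻¹ ^ p).trace := by
      calc ((V * (1 - Z)⁻¹ * V) ^ p).trace = ((R * (1 - Z)⁻¹) ^ p).trace := by
            rw [trace_mul_pow_comm, ← mul_assoc, hVV]
        _ ≤ _ := by
            rw [hp]; exact (trace_pow_two_pow_le k).2 _ _ hRs hXs
    have t1 : (R ^ p * Z).trace = (R ^ (p + 1) * Y).trace - du * (R ^ (p + 1)).trace := by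
      rw [hZ, ← mul_assoc, trace_mul_comm, ← mul_assoc, ← mul_assoc, hcomm, hY', mul_sub, trace_sub,
        mul_smul_comm, mul_one, trace_smul, smul_eq_mul]
    have t2 : (R ^ p * Z * Z).trace = (R ^ (p + 1) * Y' * R * Y').trace := by
      rw [hZ]
      calc (R ^ p * (V * Y' * V) * (V * Y' * V)).trace
          = ((R ^ p * V * Y' * (V * V) * Y') * V).trace := by simp only [mul_assoc]
        _ = (V * (R ^ p * V * Y' * (V * V) * Y')).trace := trace_mul_comm _ _
        _ = (V * R ^ p * V * Y' * (V * V) * Y').trace := by simp only [mul_assoc]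
        _ = _ := by rw [hcomm, hVV]
    set T := (R ^ (p + 1)).trace with hT
    have hT0 : 0 ≤ T := (hRpow _).trace_nonneg
    -- The parallelogram law: the forms at `Y - du` and `Y + du` add up to twice those at `Y` and at
    -- `du`, and the form at `Y + du` is nonnegative.
    have t3 : (R ^ (p + 1) * Y' * R * Y').trace ≤ 2 * (τ * T) + 2 * (du ^ 2 * (a * T)) := by
      have hXp : 0 ≤ (R ^ (p + 1) * ((Y + du • 1) * R * (Y + du • 1))).trace := by
        refine (hRpow _).trace_mul_nonneg ?_
        have := hRp.posSemidef.conjTranspose_mul_mul_same (Y + du • 1)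
        rwa [conjTranspose_eq_transpose_of_trivial, transpose_add, transpose_smul, transpose_one,
          hY.eq] at this
      have hRa : (R ^ (p + 1) * R).trace ≤ a * T := by
        have hpsd : (a • (1 : Matrix ι ι ℝ) - R).PosSemidef := by
          refine posSemidef_real_iff.2 ⟨?_, fun v => ?_⟩
          · rw [IsSymm, transpose_sub, transpose_smul, transpose_one, hRs.eq]
          · rw [sub_mulVec, dotProduct_sub, smul_mulVec, one_mulVec, dotProduct_smul, smul_eq_mul]
            linarith [hR v]
        have := (hRpow (p + 1)).trace_mul_nonneg hpsd
        rw [mul_sub, trace_sub, mul_smul_comm, mul_one, trace_smul, smul_eq_mul] at this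
        linarith
      have hsum : (R ^ (p + 1) * Y' * R * Y').trace +
          (R ^ (p + 1) * ((Y + du • 1) * R * (Y + du • 1))).trace =
          2 * (R ^ (p + 1) * Y * R * Y).trace + 2 * (du ^ 2 * (R ^ (p + 1) * R).trace) := by
        rw [hY']
        simp only [mul_sub, mul_add, sub_mul, add_mul, trace_add, trace_sub, mul_smul_comm,
          smul_mul_assoc, mul_one, one_mul, trace_smul, smul_eq_mul, ← mul_assoc]
        ring
      have hm := mul_le_mul_of_nonneg_left hRa (sq_nonneg du)
      linarith
    rw [hinv]
    refine hlt.trans (htr.trans ?_)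
    rw [t1, t2]
    -- The gain from the raised barrier is `p du T`. The two second-order terms, `6 p² τ T` and `6
    -- p² a du² T`, are each at most half of it by `h3` and `h2`.
    have m1 := mul_le_mul_of_nonneg_left t3 (by positivity : (0 : ℝ) ≤ 3 * p ^ 2)
    have m2 : (p : ℝ) * (R ^ (p + 1) * Y).trace ≤ 0 :=
      mul_nonpos_of_nonneg_of_nonpos (by positivity) hl
    have m3 : 12 * p * τ * (p * T) ≤ du * (p * T) :=
      mul_le_mul_of_nonneg_right h3 (by positivity)
    have m4 : (p * (a * du)) * (p * du * T) ≤ 1 / 12 * (p * du * T) :=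
      mul_le_mul_of_nonneg_right h2 (by positivity)
    nlinarith

end Matrix

/-! ### Directions of small second variation -/

namespace Matrix

set_option linter.unusedSectionVars false

variable {κ : Type*} [Fintype κ] [DecidableEq κ]

/-- A symmetric matrix that is block diagonal with respect to the fibres of `b` has an orthonormal
basis of eigenvectors each of which is supported in one block. -/
theorem IsHermitian.exists_block_diagonalization {β : Type*} [Fintype β] [DecidableEq β]
    {A : Matrix κ κ ℝ} (hA : A.IsHermitian) (b : κ → β) (hb : ∀ i j, b i ≠ b j → A i j = 0) :
    ∃ (U : Matrix κ κ ℝ) (d : κ → ℝ), Uᵀ * U = 1 ∧ U * Uᵀ = 1 ∧ A = U * diagonal d * Uᵀ ∧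
      ∀ i k, b i ≠ b k → U i k = 0 := by
  have hc : ∀ c : β, (A.submatrix (Subtype.val : {i // b i = c} → κ) Subtype.val).IsHermitian :=
    fun c => IsHermitian.submatrix hA Subtype.val
  choose U d h1 h2 h3 using fun c => (hc c).exists_diagonalization
  let e : κ ≃ (c : β) × {i // b i = c} := (Equiv.sigmaFiberEquiv b).symm
  have he : ∀ i, (e i).1 = b i := fun i => rfl
  have hA' : A = (blockDiagonal' fun c => U c * diagonal (d c) * (U c)ᵀ).submatrix e e := by
    ext i j
    rw [submatrix_apply]
    by_cases hij : b i = b j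
    · have hj : e j = ⟨b i, ⟨j, hij.symm⟩⟩ := by
        rw [Equiv.symm_apply_eq]; rfl
      have hi : e i = ⟨b i, ⟨i, rfl⟩⟩ := rfl
      rw [hj, hi, blockDiagonal'_apply_eq, ← h3]
      rfl
    · rw [blockDiagonal'_apply_ne _ _ _ (by rw [he, he]; exact hij), hb i j hij]
  refine ⟨(blockDiagonal' U).submatrix e e, fun k => d (e k).1 (e k).2, ?_, ?_, ?_, ?_⟩
  · rw [transpose_submatrix, submatrix_mul_equiv, blockDiagonal'_transpose, ← blockDiagonal'_mul]
    simp only [h1]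
    rw [show (fun c => (1 : Matrix {i // b i = c} {i // b i = c} ℝ)) = 1 from rfl,
      blockDiagonal'_one, submatrix_one_equiv]
  · rw [transpose_submatrix, submatrix_mul_equiv, blockDiagonal'_transpose, ← blockDiagonal'_mul]
    simp only [h2]
    rw [show (fun c => (1 : Matrix {i // b i = c} {i // b i = c} ℝ)) = 1 from rfl,
      blockDiagonal'_one, submatrix_one_equiv]
  · have hd : diagonal (fun k => d (e k).1 (e k).2) =
        (blockDiagonal' fun c => diagonal (d c)).submatrix e e := by
      rw [blockDiagonal'_diagonal, submatrix_diagonal_equiv]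
      rfl
    rw [hd, transpose_submatrix, submatrix_mul_equiv, submatrix_mul_equiv,
      blockDiagonal'_transpose, ← blockDiagonal'_mul, ← blockDiagonal'_mul]
    exact hA'
  · intro i k hik
    rw [submatrix_apply, blockDiagonal'_apply_ne _ _ _ (by rw [he, he]; exact hik)]

theorem trace_conj_diagonal_pow {U : Matrix κ κ ℝ} (hU : Uᵀ * U = 1) (hU' : U * Uᵀ = 1)
    (d : κ → ℝ) (k : ℕ) : ((U * diagonal d * Uᵀ) ^ k).trace = ∑ i, d i ^ k := by
  rw [conj_diagonal_pow hU hU', mul_assoc, trace_mul_comm, mul_assoc, hU, mul_one, trace_diagonal]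
  rfl

/-- If a symmetric matrix annihilates the eigenvectors of `A` of eigenvalue above `θ`, then
`Y A Y ≤ θ Y²`. -/
theorem posSemidef_of_mulVec_eigenvector_eq_zero {U Y : Matrix κ κ ℝ} {d : κ → ℝ} {θ : ℝ}
    (hU' : U * Uᵀ = 1) (hY : Y.IsSymm) (h : ∀ k, θ < d k → Y *ᵥ U.col k = 0) :
    (Y * (θ • 1 - U * diagonal d * Uᵀ) * Y).PosSemidef := by
  have e : Y * (θ • 1 - U * diagonal d * Uᵀ) * Y =
      Y * U * diagonal (fun k => θ - d k) * (Y * U)ᵀ := by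
    have : diagonal (fun k => θ - d k) = θ • 1 - diagonal d := by
      ext i j; by_cases hij : i = j
      · subst hij; simp
      · simp [hij]
    rw [this, transpose_mul, hY.eq]
    have h1 : θ • (1 : Matrix κ κ ℝ) = U * (θ • 1) * Uᵀ := by
      rw [mul_smul_comm, smul_mul_assoc, mul_one, hU']
    conv_lhs => rw [h1]
    simp only [mul_sub, sub_mul, mul_assoc]
  -- A negative weight `θ - d k` multiplies a column of `Y * U` that is zero, so it may be replaced
  -- by its positive part.
  have e2 : Y * U * diagonal (fun k => θ - d k) * (Y * U)ᵀ =
      Y * U * diagonal (fun k => max (θ - d k) 0) * (Y * U)ᵀ := by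
    congr 1
    ext i k
    rw [mul_diagonal, mul_diagonal]
    by_cases hk : θ < d k
    · have := congrFun (h k hk) i
      have h0 : (Y * U) i k = 0 := by
        rw [mul_apply]; exact this
      rw [h0, zero_mul, zero_mul]
    · rw [max_eq_left (by linarith)]
  rw [e, e2]
  have := (PosSemidef.diagonal (d := fun k => max (θ - d k) 0)
    (fun k => le_max_right _ _)).mul_mul_conjTranspose_same (Y * U)
  rwa [conjTranspose_eq_transpose_of_trivial] at this

/-- In a subspace of dimension at least half of the total dimension there is a vector with some
coordinate equal to `1` at which a positive semidefinite form is at most four times the average of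
its diagonal entries. -/
theorem PosSemidef.exists_mem_apply_eq_one {J : Type*} [Fintype J] [DecidableEq J]
    {L : Matrix J J ℝ} (hL : L.PosSemidef) (V : Submodule ℝ (J → ℝ))
    (hV : Fintype.card J ≤ 2 * Module.finrank ℝ V) (hJ : 0 < Fintype.card J) :
    ∃ y ∈ V, ∃ i, y i = 1 ∧ Fintype.card J * (y ⬝ᵥ L *ᵥ y) ≤ 4 * L.trace := by
  let V' : Submodule ℝ (EuclideanSpace ℝ J) := V.map (WithLp.linearEquiv 2 ℝ (J → ℝ)).symm.toLinearMap
  have hVV : Module.finrank ℝ V' = Module.finrank ℝ V :=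
    LinearEquiv.finrank_map_eq (WithLp.linearEquiv 2 ℝ (J → ℝ)).symm V
  have hVm : ∀ v ∈ V', (WithLp.linearEquiv 2 ℝ (J → ℝ)) v ∈ V := by
    rintro _ ⟨v, hv, rfl⟩
    exact hv
  let f := stdOrthonormalBasis ℝ V'
  let F : Matrix J (Fin (Module.finrank ℝ V')) ℝ := .of fun i a => (f a : EuclideanSpace ℝ J) i
  have hF : Fᵀ * F = 1 := by
    ext a c
    have := orthonormal_iff_ite.1 f.orthonormal a c
    rw [Submodule.coe_inner, PiLp.inner_apply] at this
    simp only [RCLike.inner_apply, conj_trivial] at this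
    rw [mul_apply, one_apply, ← this]
    exact Finset.sum_congr rfl fun i _ => mul_comm _ _
  -- `P` is the orthogonal projection onto `V`. Its columns, scaled to have diagonal entry `1`, are
  -- the candidates for `y`.
  set P := F * Fᵀ with hP
  have hPs : Pᵀ = P := by rw [hP, transpose_mul, transpose_transpose]
  have hPP : P * P = P := by
    rw [hP]
    calc F * Fᵀ * (F * Fᵀ) = F * (Fᵀ * F) * Fᵀ := by simp only [Matrix.mul_assoc]
      _ = _ := by rw [hF, Matrix.mul_one]
  have hPtr : P.trace = Module.finrank ℝ V' := by
    rw [hP, trace_mul_comm, hF, trace_one, Fintype.card_fin]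
  have hPmem : ∀ i, P.col i ∈ V := by
    intro i
    have : P.col i = ∑ a, F i a • (WithLp.linearEquiv 2 ℝ (J → ℝ)) (f a : EuclideanSpace ℝ J) := by
      ext j
      simp only [hP, col_apply, mul_apply, Finset.sum_apply, Pi.smul_apply, smul_eq_mul,
        transpose_apply]
      exact Finset.sum_congr rfl fun a _ => mul_comm _ _
    rw [this]
    exact Submodule.sum_mem _ fun a _ => Submodule.smul_mem _ _ (hVm _ (f a).2)
  have hPdiag : ∀ i, 0 ≤ P i i := fun i => by
    rw [hP, mul_apply]; exact Finset.sum_nonneg fun a _ => mul_self_nonneg _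
  have hq : ∀ i, (P * L * P) i i = P.col i ⬝ᵥ L *ᵥ P.col i := by
    intro i
    rw [mul_assoc, mul_apply]
    refine Finset.sum_congr rfl fun j _ => ?_
    rw [col_apply, ← congrFun (congrFun hPs i) j, transpose_apply]
    rfl
  have hle : (P * L * P).trace ≤ L.trace := by
    have h1 := (hL.conjTranspose_mul_mul_same (1 - P)).trace_nonneg
    rw [conjTranspose_eq_transpose_of_trivial, transpose_sub, transpose_one, hPs] at h1
    have h2 : (P * L * P).trace = (P * L).trace := by
      rw [trace_mul_comm, ← mul_assoc, hPP]
    have h3 : ((1 - P) * L * (1 - P)).trace = L.trace - (L * P).trace - (P * L).trace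
        + (P * L * P).trace := by
      simp only [sub_mul, mul_sub, one_mul, mul_one, trace_sub]
      ring
    rw [h3, trace_mul_comm L P, h2] at h1
    linarith
  set k : ℝ := (Module.finrank ℝ V' : ℝ) with hk
  have hkD : (Fintype.card J : ℝ) ≤ 2 * k := by
    rw [hk, hVV]; exact_mod_cast hV
  have hD : (0 : ℝ) < Fintype.card J := by exact_mod_cast hJ
  -- If every candidate failed, then summing `4 (tr L) P i i ^ 2 ≤ card J * (P L P) i i`, strict for
  -- some `i`, would give `4 (tr L) ∑ P i i ^ 2 < card J * tr L`. But Cauchy–Schwarz and `tr P = dim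
  -- V ≥ card J / 2` give `∑ P i i ^ 2 ≥ card J / 4`.
  by_contra hcon
  push Not at hcon
  have hLtr := hL.trace_nonneg
  have hstrict : ∀ i, 4 * L.trace * P i i ^ 2 ≤ Fintype.card J * (P * L * P) i i ∧
      (0 < P i i → 4 * L.trace * P i i ^ 2 < Fintype.card J * (P * L * P) i i) := by
    intro i
    have hpos : 0 < P i i → 4 * L.trace * P i i ^ 2 < Fintype.card J * (P * L * P) i i := by
      intro h
      have := hcon ((P i i)⁻¹ • P.col i) (V.smul_mem _ (hPmem i)) i (by
        rw [Pi.smul_apply, col_apply, smul_eq_mul, inv_mul_cancel₀ h.ne'])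
      rw [mulVec_smul, smul_dotProduct, dotProduct_smul, ← hq, smul_eq_mul, smul_eq_mul] at this
      calc 4 * L.trace * P i i ^ 2
          < Fintype.card J * ((P i i)⁻¹ * ((P i i)⁻¹ * (P * L * P) i i)) * P i i ^ 2 :=
            mul_lt_mul_of_pos_right this (by positivity)
        _ = _ := by field_simp
    refine ⟨?_, hpos⟩
    rcases (hPdiag i).eq_or_lt with h | h
    · rw [← h, hq]
      have := (posSemidef_real_iff.1 hL).2 (P.col i)
      simp only [ne_eq, OfNat.ofNat_ne_zero, not_false_eq_true, zero_pow, mul_zero]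
      positivity
    · exact (hpos h).le
  have hex : ∃ i, 0 < P i i := by
    by_contra h
    push Not at h
    have : P.trace ≤ 0 := Finset.sum_nonpos fun i _ => h i
    rw [hPtr] at this
    linarith
  obtain ⟨i₀, hi₀⟩ := hex
  have hsum : ∑ i, 4 * L.trace * P i i ^ 2 < ∑ i, Fintype.card J * (P * L * P) i i :=
    Finset.sum_lt_sum (fun i _ => (hstrict i).1) ⟨i₀, Finset.mem_univ _, (hstrict i₀).2 hi₀⟩
  rw [← Finset.mul_sum, ← Finset.mul_sum] at hsum
  have hcs : k ^ 2 ≤ Fintype.card J * ∑ i, P i i ^ 2 := by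
    have := sq_sum_le_card_mul_sum_sq (s := Finset.univ) (f := fun i => P i i)
    rw [Finset.card_univ] at this
    have h' : ∑ i, P i i = k := hPtr
    rwa [h'] at this
  have h5 : Fintype.card J * ∑ i, (P * L * P) i i ≤ Fintype.card J * L.trace :=
    mul_le_mul_of_nonneg_left hle hD.le
  have h6 : 4 * L.trace * ∑ i, P i i ^ 2 < Fintype.card J * L.trace := hsum.trans_le h5
  have h7 : L.trace * (4 * (Fintype.card J * ∑ i, P i i ^ 2)) <
      L.trace * (Fintype.card J * Fintype.card J) := by nlinarith
  have h8 := lt_of_mul_lt_mul_left h7 hLtr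
  nlinarith

end Matrix

namespace Balancing

open Matrix

set_option linter.unusedSectionVars false

variable {J κ : Type*} [Fintype J] [DecidableEq J] [Fintype κ] [DecidableEq κ]

theorem gram_dotProduct_mulVec (W R : Matrix κ κ ℝ) (B : J → Matrix κ κ ℝ) (ε : ℝ) (y : J → ℝ) :
    y ⬝ᵥ gram W R B ε *ᵥ y =
      (W * (∑ i, y i • B i) * R * ∑ i, y i • B i).trace + ε * (y ⬝ᵥ y) := by
  have e : gram W R B ε = (.of fun i j => (W * B i * R * B j).trace) + ε • 1 := by
    ext i j
    simp [gram, mul_comm]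
  rw [e, add_mulVec, dotProduct_add, smul_mulVec, one_mulVec, dotProduct_smul, smul_eq_mul]
  congr 1
  simp only [dotProduct, mulVec, of_apply, Finset.mul_sum, Finset.sum_mul, trace_sum,
    mul_smul_comm, smul_mul_assoc, trace_smul, smul_eq_mul]
  rw [Finset.sum_comm]
  refine Finset.sum_congr rfl fun i _ => Finset.sum_congr rfl fun j _ => by ring

theorem gram_isSymm {W R : Matrix κ κ ℝ} {B : J → Matrix κ κ ℝ} (hW : W.IsSymm) (hR : R.IsSymm)
    (hB : ∀ i, (B i).IsSymm) (ε : ℝ) : (gram W R B ε).IsSymm := by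
  ext i j
  rw [transpose_apply]
  simp only [gram, of_apply]
  congr 1
  · rw [← trace_transpose]
    simp only [transpose_mul, hW.eq, hR.eq, (hB _).eq]
    rw [← mul_assoc, ← mul_assoc, trace_mul_comm]
    simp only [mul_assoc]
  · rw [one_apply, one_apply]; simp only [eq_comm]

theorem isSymm_sum_smul {B : J → Matrix κ κ ℝ} (hB : ∀ i, (B i).IsSymm) (y : J → ℝ) :
    (∑ i, y i • B i).IsSymm := by
  rw [IsSymm, transpose_sum]
  exact Finset.sum_congr rfl fun i _ => by rw [transpose_smul, (hB i).eq]

theorem _root_.Matrix.PosSemidef.trace_mul_mul_mul_nonneg {W R Y : Matrix κ κ ℝ}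
    (hW : W.PosSemidef) (hR : R.PosSemidef) (hY : Y.IsSymm) : 0 ≤ (W * Y * R * Y).trace := by
  have := hR.conjTranspose_mul_mul_same Y
  rw [conjTranspose_eq_transpose_of_trivial, hY.eq] at this
  have := hW.trace_mul_nonneg this
  rwa [← mul_assoc, ← mul_assoc] at this

theorem gram_posDef {W R : Matrix κ κ ℝ} {B : J → Matrix κ κ ℝ} (hW : W.PosSemidef)
    (hR : R.PosSemidef) (hB : ∀ i, (B i).IsSymm) {ε : ℝ} (hε : 0 < ε) :
    (gram W R B ε).PosDef := by
  refine posDef_real_iff.2 ⟨gram_isSymm (posSemidef_real_iff.1 hW).1 (posSemidef_real_iff.1 hR).1 hB ε,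
    fun y hy => ?_⟩
  rw [gram_dotProduct_mulVec]
  have h1 := hW.trace_mul_mul_mul_nonneg hR (isSymm_sum_smul hB y)
  have h2 := mul_pos hε (dotProduct_self_pos hy)
  linarith

/-- Among the combinations of block diagonal matrices with some coefficient equal to `1` there is one
of small second variation. -/
theorem exists_small_direction {β : Type*} [Fintype β] [DecidableEq β] {R : Matrix κ κ ℝ}
    (hR : R.PosDef) (b : κ → β) (hRb : ∀ i j, b i ≠ b j → R i j = 0) {q : ℕ}
    (hq : ∀ c, (Finset.univ.filter fun i => b i = c).card ≤ q) {B : J → Matrix κ κ ℝ}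
    (hBs : ∀ j, (B j).IsSymm) (hBb : ∀ l i j, b i ≠ b j → B l i j = 0)
    (hB4 : ∀ j v, (B j *ᵥ v) ⬝ᵥ (B j *ᵥ v) ≤ 4 * (v ⬝ᵥ v)) {M : Finset J} (hM : M.Nonempty)
    {p : ℕ} {θ Φ ε : ℝ} (hθ : 0 < θ) (hΦ : (R ^ p).trace ≤ Φ)
    (hcount : 2 * q * Φ ≤ M.card * θ ^ p) (hε : 0 < ε) :
    ∃ i ∈ M, ∃ y : J → ℝ, y i = 1 ∧ y ⬝ᵥ gram (R ^ (p + 1)) R B ε *ᵥ y ≤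
      4 * (4 * θ * (R ^ (p + 1)).trace + ε) := by
  classical
  obtain ⟨U, d, hU, hU', hd, hUb⟩ := hR.1.exists_block_diagonalization b hRb
  have hWp : (R ^ (p + 1)).PosSemidef := hR.posSemidef.pow _
  set W := R ^ (p + 1) with hW
  have hWs : W.IsSymm := (posSemidef_real_iff.1 hWp).1
  have hdn : ∀ i, 0 ≤ d i := by
    intro i
    have h := (hR.posSemidef.conjTranspose_mul_mul_same U).diag_nonneg (i := i)
    rw [hd, conjTranspose_eq_transpose_of_trivial] at h
    have : Uᵀ * (U * diagonal d * Uᵀ) * U = diagonal d := by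
      calc _ = (Uᵀ * U) * diagonal d * (Uᵀ * U) := by simp only [mul_assoc]
        _ = _ := by rw [hU, one_mul, mul_one]
    rw [this] at h
    simpa using h
  -- The large eigenvalues, counted by Markov's inequality for `tr R ^ p`.
  let H := Finset.univ.filter fun k => θ < d k
  have hH : 2 * (q * H.card) ≤ M.card := by
    have h1 : (H.card : ℝ) * θ ^ p ≤ Φ := by
      refine le_trans ?_ hΦ
      rw [hd, trace_conj_diagonal_pow hU hU']
      calc (H.card : ℝ) * θ ^ p = ∑ _k ∈ H, θ ^ p := by rw [Finset.sum_const, nsmul_eq_mul]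
        _ ≤ ∑ k ∈ H, d k ^ p := Finset.sum_le_sum fun k hk =>
            pow_le_pow_left₀ hθ.le (Finset.mem_filter.1 hk).2.le p
        _ ≤ _ := Finset.sum_le_univ_sum_of_nonneg fun k => pow_nonneg (hdn k) p
    have h2 : (2 * (q * H.card) : ℝ) * θ ^ p ≤ M.card * θ ^ p := by
      refine le_trans ?_ hcount
      have := mul_le_mul_of_nonneg_left h1 (by positivity : (0 : ℝ) ≤ 2 * q)
      linarith
    have := le_of_mul_le_mul_right h2 (pow_pos hθ p)
    exact_mod_cast this
  let ext : (M → ℝ) →ₗ[ℝ] Matrix κ κ ℝ :=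
    { toFun := fun y => ∑ i, y i • B i
      map_add' := fun y z => by simp [add_smul, Finset.sum_add_distrib]
      map_smul' := fun c y => by simp [Finset.smul_sum, smul_smul] }
  have hext : ∀ y, ext y = ∑ i : M, y i • B i := fun _ => rfl
  -- One linear condition for each large eigenvector and each index in its block. The product of a
  -- block diagonal matrix with this eigenvector vanishes outside the block anyway.
  let Con := Finset.univ.filter fun x : κ × κ => x.1 ∈ H ∧ b x.2 = b x.1
  have hCon : Con.card ≤ q * H.card := by
    have : Con = H.biUnion fun k => (Finset.univ.filter fun i => b i = b k).image fun i => (k, i) := by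
      ext ⟨k, i⟩
      simp only [Con, Finset.mem_filter, Finset.mem_univ, true_and, Finset.mem_biUnion,
        Finset.mem_image, Prod.mk.injEq]
      constructor
      · rintro ⟨h1, h2⟩; exact ⟨k, h1, i, h2, rfl, rfl⟩
      · rintro ⟨k', h1, i', h2, rfl, rfl⟩; exact ⟨h1, h2⟩
    rw [this, mul_comm]
    exact Finset.card_biUnion_le_card_mul _ _ _ fun k _ => Finset.card_image_le.trans (hq _)
  let T : (M → ℝ) →ₗ[ℝ] (Con → ℝ) :=
    LinearMap.pi fun x => (LinearMap.proj x.1.2).comp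
      ((LinearMap.applyₗ (U.col x.1.1)).comp ((toLin' : Matrix κ κ ℝ ≃ₗ[ℝ] _).toLinearMap.comp ext))
  have hT : ∀ y x, T y x = (ext y *ᵥ U.col x.1.1) x.1.2 := fun y x => by
    simp [T, toLin'_apply]
  have hextb : ∀ y i j, b i ≠ b j → ext y i j = 0 := by
    intro y i j hij
    rw [hext, Matrix.sum_apply]
    exact Finset.sum_eq_zero fun l _ => by rw [Matrix.smul_apply, hBb _ _ _ hij, smul_zero]
  have hker : ∀ y ∈ LinearMap.ker T, ∀ k, θ < d k → ext y *ᵥ U.col k = 0 := by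
    intro y hy k hk
    ext i
    by_cases hik : b i = b k
    · have := congrFun (LinearMap.mem_ker.1 hy) ⟨(k, i), by simp [Con, H, hk, hik]⟩
      rwa [hT] at this
    · refine Finset.sum_eq_zero fun j _ => ?_
      by_cases hij : b i = b j
      · rw [col_apply, hUb j k (by rw [← hij]; exact hik), mul_zero]
      · exact mul_eq_zero_of_left (hextb y i j hij) _
  -- There are at most `q * H.card` conditions, and this is at most half of `M.card`.
  have hdim : Fintype.card M ≤ 2 * Module.finrank ℝ (LinearMap.ker T) := by
    have h1 := LinearMap.finrank_range_add_finrank_ker T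
    have h2 := Submodule.finrank_le (LinearMap.range T)
    rw [Module.finrank_fintype_fun_eq_card] at h1 h2
    rw [Fintype.card_coe] at *
    omega
  have hextS : ∀ y, (ext y).IsSymm := fun y => isSymm_sum_smul (fun i : M => hBs i) y
  have hθ1 : (θ • (1 : Matrix κ κ ℝ)).PosSemidef := PosSemidef.one.smul hθ.le
  -- The averaging is done for the form with `θ` in place of `R`. Its diagonal is controlled by `B j
  -- ^ 2 ≤ 4`, whereas that of the true form may be large.
  set L := gram W (θ • 1) (fun i : M => B i) ε with hL
  have hLp : L.PosSemidef := (gram_posDef hWp hθ1 (fun i : M => hBs i) hε).posSemidef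
  obtain ⟨y, hy, i, hyi, hyL⟩ := hLp.exists_mem_apply_eq_one (LinearMap.ker T) hdim
    (by rw [Fintype.card_coe]; exact hM.card_pos)
  have hMpos : (0 : ℝ) < Fintype.card M := by
    rw [Fintype.card_coe]; exact_mod_cast hM.card_pos
  have hLtr : L.trace ≤ Fintype.card M * (4 * θ * W.trace + ε) := by
    have : ∀ j, L j j ≤ 4 * θ * W.trace + ε := by
      intro j
      have hpsd : ((4 : ℝ) • (1 : Matrix κ κ ℝ) - B j * B j).PosSemidef := by
        refine posSemidef_real_iff.2 ⟨?_, fun v => ?_⟩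
        · rw [IsSymm, transpose_sub, transpose_smul, transpose_one, transpose_mul, (hBs j).eq]
        · rw [sub_mulVec, dotProduct_sub, smul_mulVec, one_mulVec, dotProduct_smul, smul_eq_mul,
            ← mulVec_mulVec, (hBs j).dotProduct_mulVec_comm]
          linarith [hB4 j v]
      have h := hWp.trace_mul_nonneg hpsd
      rw [mul_sub, trace_sub, mul_smul_comm, mul_one, trace_smul, smul_eq_mul, ← mul_assoc] at h
      simp only [hL, gram, of_apply, one_apply_eq, one_mul, mul_smul_comm, mul_one, smul_mul_assoc,
        trace_smul, smul_eq_mul]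
      nlinarith
    calc L.trace ≤ ∑ _j : M, (4 * θ * W.trace + ε) := Finset.sum_le_sum fun j _ => this j
      _ = _ := by rw [Finset.sum_const, Finset.card_univ, nsmul_eq_mul]
  have hyL' : y ⬝ᵥ L *ᵥ y ≤ 4 * (4 * θ * W.trace + ε) := by
    have : Fintype.card M * (y ⬝ᵥ L *ᵥ y) ≤ Fintype.card M * (4 * (4 * θ * W.trace + ε)) := by
      linarith
    exact le_of_mul_le_mul_left this hMpos
  let z : J → ℝ := fun j => if h : j ∈ M then y ⟨j, h⟩ else 0
  have hz : ∀ j : M, z j = y j := fun j => by simp [z]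
  have hz' : ∀ j ∉ M, z j = 0 := fun j hj => by simp [z, hj]
  have hzsum : ∑ j, z j • B j = ext y := by
    rw [hext, ← Finset.sum_subset (Finset.subset_univ M) fun j _ hj => by rw [hz' j hj, zero_smul],
      ← Finset.sum_coe_sort]
    exact Finset.sum_congr rfl fun j _ => by rw [hz]
  have hzz : z ⬝ᵥ z = y ⬝ᵥ y := by
    rw [dotProduct, ← Finset.sum_subset (Finset.subset_univ M) fun j _ hj => by
      rw [hz' j hj, zero_mul], ← Finset.sum_coe_sort]
    exact Finset.sum_congr rfl fun j _ => by rw [hz]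
  refine ⟨i, i.2, z, by rw [hz, hyi], ?_⟩
  refine le_trans ?_ hyL'
  rw [gram_dotProduct_mulVec, hL, gram_dotProduct_mulVec, hzsum, hzz, ← hext]
  -- On the kernel of the conditions the true form is at most the form with `θ`.
  have h1 := hWp.trace_mul_nonneg
    (posSemidef_of_mulVec_eigenvector_eq_zero hU' (hextS y) (hker y hy))
  rw [← hd, mul_sub, sub_mul, mul_sub, trace_sub] at h1
  simp only [← mul_assoc] at h1
  linarith

/-- A column of the inverse of a positive definite matrix minimises the quadratic form under a
constraint on one coordinate. -/
theorem _root_.Matrix.PosDef.inv_diag_mul_le {Q : Matrix J J ℝ} (hQ : Q.PosDef) (y : J → ℝ) (i : J)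
    (hy : y i = 1) : 1 ≤ (Q⁻¹ i i) * (y ⬝ᵥ Q *ᵥ y) := by
  have hQs := (posDef_real_iff.1 hQ).1
  have hpos : 0 < Q⁻¹ i i := hQ.inv.diag_pos
  have hdet := (isUnit_iff_isUnit_det _).1 hQ.isUnit
  -- At this vector the form equals `s² yᵀQy - s`, where `s = Q⁻¹ i i > 0`.
  have h := (posSemidef_real_iff.1 hQ.posSemidef).2 (Q⁻¹ i i • y - Q⁻¹.col i)
  have e1 : Q *ᵥ Q⁻¹.col i = Pi.single i 1 := by
    ext j
    have : (Q *ᵥ Q⁻¹.col i) j = (Q * Q⁻¹) j i := rfl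
    rw [this, mul_nonsing_inv _ hdet, one_apply, Pi.single_apply]
  have e2 : Q⁻¹.col i ⬝ᵥ Q *ᵥ y = 1 := by
    rw [hQs.dotProduct_mulVec_comm, e1, single_one_dotProduct, hy]
  rw [mulVec_sub, mulVec_smul, e1, sub_dotProduct, dotProduct_sub, dotProduct_sub, smul_dotProduct,
    smul_dotProduct, dotProduct_smul, dotProduct_smul, e2, dotProduct_single_one,
    dotProduct_single_one, hy, col_apply] at h
  simp only [smul_eq_mul, mul_one, sub_self, sub_zero] at h
  by_contra hcon
  push Not at hcon
  nlinarith

end Balancing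

/-! ### Elimination of a pivot coordinate, the reduced direction and the step length -/

namespace Balancing

open Matrix

set_option linter.unusedSectionVars false

variable {n w q : ℕ} {D : Fin n → Matrix (Fin w) (Fin w) ℝ} {x : Fin n → ℝ}

/-- A family of symmetric contractions, block diagonal for a common partition into blocks of size at
most `q`. -/
structure BlockFamily (q : ℕ) (D : Fin n → Matrix (Fin w) (Fin w) ℝ) : Prop where
  symm : ∀ i, (D i).IsSymm
  contr : ∀ i v, (D i *ᵥ v) ⬝ᵥ (D i *ᵥ v) ≤ v ⬝ᵥ v
  block : ∃ b : Fin w → Fin w, (∀ c, (Finset.univ.filter fun i => b i = c).card ≤ q) ∧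
    ∀ l i j, b i ≠ b j → D l i j = 0

/-- The coordinates that are not yet `±1`. -/
noncomputable def live (x : Fin n → ℝ) : Finset (Fin n) :=
  Finset.univ.filter fun i => x i * x i ≠ 1

theorem mem_live {i : Fin n} : i ∈ live x ↔ x i * x i ≠ 1 := by simp [live]

theorem mask_of_mem {i : Fin n} (h : i ∈ live x) : mask x i = 1 := if_neg (mem_live.1 h)

theorem mask_of_notMem {i : Fin n} (h : i ∉ live x) : mask x i = 0 :=
  if_pos (not_not.1 (mt mem_live.2 h))

theorem sum_mask (x : Fin n → ℝ) : ∑ i, mask x i = (live x).card := by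
  rw [live, Finset.card_filter, Nat.cast_sum]
  refine Finset.sum_congr rfl fun i _ => ?_
  by_cases h : x i * x i = 1 <;> simp [mask, h]

theorem redMask_of_mem {i j₀ : Fin n} (h : i ∈ (live x).erase j₀) : redMask x j₀ i = 1 := by
  rw [Finset.mem_erase] at h
  simp [redMask, mask_of_mem h.2, h.1]

theorem redMask_of_notMem {i j₀ : Fin n} (h : i ∉ (live x).erase j₀) : redMask x j₀ i = 0 := by
  rw [Finset.mem_erase, not_and_or, not_not] at h
  rcases h with h | h
  · simp [redMask, h]
  · simp [redMask, mask_of_notMem h]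

/-- The pivot is a live coordinate of maximal absolute value. -/
structure IsPivot (x : Fin n → ℝ) (j₀ : Fin n) : Prop where
  mem : j₀ ∈ live x
  abs_le : ∀ j ∈ live x, |x j| ≤ |x j₀|

/-- The summand `1` lets a live coordinate with `x j = 0` still win against all frozen ones. -/
theorem isPivot_of_forall_le {j₀ : Fin n} (hx : (live x).Nonempty)
    (h : ∀ j, mask x j * (1 + |x j|) ≤ mask x j₀ * (1 + |x j₀|)) : IsPivot x j₀ := by
  have hm : j₀ ∈ live x := by
    by_contra hj
    obtain ⟨j, hj'⟩ := hx
    have := h j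
    rw [mask_of_mem hj', mask_of_notMem hj] at this
    linarith [abs_nonneg (x j)]
  refine ⟨hm, fun j hj => ?_⟩
  have := h j
  rw [mask_of_mem hj, mask_of_mem hm] at this
  linarith

namespace IsPivot

variable {j₀ : Fin n}

/-- If the pivot value is `0`, then by maximality every live value is `0`, so the convention `x / 0
= 0` gives the right ratio. -/
theorem ratio_mul (h : IsPivot x j₀) {j : Fin n} (hj : j ∈ live x) : x j / x j₀ * x j₀ = x j := by
  by_cases h0 : x j₀ = 0
  · have := h.abs_le j hj
    rw [h0, abs_zero, abs_nonpos_iff] at this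
    rw [this, h0]; simp
  · exact div_mul_cancel₀ _ h0

theorem ratio_sq_le (h : IsPivot x j₀) {j : Fin n} (hj : j ∈ live x) : (x j / x j₀) ^ 2 ≤ 1 := by
  rw [← sq_abs, abs_div]
  exact pow_le_one₀ (by positivity) (div_le_one_of_le₀ (h.abs_le j hj) (abs_nonneg _))

end IsPivot

theorem BlockFamily.redMat_symm (hD : BlockFamily q D) (j₀ i : Fin n) :
    (redMat D x j₀ i).IsSymm := by
  rw [redMat, IsSymm, transpose_smul, transpose_sub, transpose_smul, (hD.symm _).eq, (hD.symm _).eq]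

/-- `|s - ρ t|² ≤ 2 |s|² + 2 ρ² |t|²`. The bound `ρ² ≤ 1` is the reason for choosing the pivot of
maximal absolute value. -/
theorem BlockFamily.redMat_contr (hD : BlockFamily q D) {j₀ : Fin n} (hj₀ : IsPivot x j₀) (i : Fin n)
    (v : Fin w → ℝ) : (redMat D x j₀ i *ᵥ v) ⬝ᵥ (redMat D x j₀ i *ᵥ v) ≤ 4 * (v ⬝ᵥ v) := by
  by_cases hi : i ∈ (live x).erase j₀
  · have hr := hj₀.ratio_sq_le (Finset.mem_of_mem_erase hi)
    have h1 := hD.contr i v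
    have h2 := hD.contr j₀ v
    rw [redMat, redMask_of_mem hi, one_smul, sub_mulVec, smul_mulVec]
    generalize x i / x j₀ = ρ at *
    generalize D i *ᵥ v = s at *
    generalize D j₀ *ᵥ v = t at *
    have h3 := dotProduct_self_nonneg' (s + ρ • t)
    simp only [sub_dotProduct, dotProduct_sub, add_dotProduct, dotProduct_add, smul_dotProduct,
      dotProduct_smul, smul_eq_mul] at h3 ⊢
    have h4 := mul_le_mul hr h2 (dotProduct_self_nonneg' t) zero_le_one
    linarith
  · rw [redMat, redMask_of_notMem hi, zero_smul, zero_mulVec, zero_dotProduct]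
    exact mul_nonneg (by norm_num) (dotProduct_self_nonneg' v)

section direction

variable {j₀ i₀ : Fin n} {v : Fin n → ℝ}

theorem sum_fullDir_smul (hv : ∀ i, redMask x j₀ i * v i = v i) :
    ∑ i, fullDir v x j₀ i • D i = ∑ i, v i • redMat D x j₀ i := by
  have h : ∀ i, v i • redMat D x j₀ i = v i • D i - (x i / x j₀ * v i) • D j₀ := by
    intro i
    rw [redMat, smul_smul, mul_comm, hv, smul_sub, smul_smul, mul_comm (v i)]
  simp only [h, Finset.sum_sub_distrib, fullDir, sub_smul, ← Finset.sum_smul]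
  congr 1
  simp [ite_smul]

/-- Orthogonality to `x` removes the linear term of `|x + z|²`, so a step raises `|x|²`, and with it
the barrier, by exactly the squared length of the step. -/
theorem sum_mul_fullDir (hj₀ : IsPivot x j₀) (hv : ∀ i, redMask x j₀ i * v i = v i) :
    ∑ i, x i * fullDir v x j₀ i = 0 := by
  have h : ∀ i, x j₀ * (x i / x j₀ * v i) = x i * v i := by
    intro i
    by_cases hi : i ∈ live x
    · rw [← mul_assoc, mul_comm (x j₀), hj₀.ratio_mul hi]
    · have : v i = 0 := by
        rw [← hv, redMask_of_notMem fun h => hi (Finset.mem_of_mem_erase h), zero_mul]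
      rw [this]; ring
  simp only [fullDir, mul_sub, Finset.sum_sub_distrib]
  rw [sub_eq_zero]
  simp [Finset.mul_sum, h]

theorem fullDir_of_notMem (hj₀ : IsPivot x j₀) (hv : ∀ i, redMask x j₀ i * v i = v i) {i : Fin n}
    (hi : i ∉ live x) : fullDir v x j₀ i = 0 := by
  have h1 : v i = 0 := by
    rw [← hv, redMask_of_notMem fun h => hi (Finset.mem_of_mem_erase h), zero_mul]
  have h2 : i ≠ j₀ := fun h => hi (h ▸ hj₀.mem)
  simp [fullDir, h1, h2]

theorem redMask_mul_redDir (S : Matrix (Fin n) (Fin n) ℝ) (i : Fin n) :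
    redMask x j₀ i * redDir S x j₀ i₀ i = redDir S x j₀ i₀ i := by
  by_cases hi : i ∈ (live x).erase j₀
  · rw [redMask_of_mem hi, one_mul]
  · rw [redDir, redMask_of_notMem hi]; ring

/-- The reduced direction does not exceed the minimum of the quadratic form under the constraint that
one of the coordinates is `1`. -/
theorem redDir_gram_le {W R : Matrix (Fin w) (Fin w) ℝ} {ε : ℝ}
    (hQ : (gram W R (redMat D x j₀) ε).PosDef) (hε : 0 ≤ ε)
    (hmax : ∀ i, redMask x j₀ i * (gram W R (redMat D x j₀) ε)⁻¹ i i ≤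
      redMask x j₀ i₀ * (gram W R (redMat D x j₀) ε)⁻¹ i₀ i₀) {i : Fin n}
    (hi : i ∈ (live x).erase j₀) {y : Fin n → ℝ} (hy : y i = 1) :
    i₀ ∈ (live x).erase j₀ ∧ redDir (gram W R (redMat D x j₀) ε)⁻¹ x j₀ i₀ i₀ = 1 ∧
    redDir (gram W R (redMat D x j₀) ε)⁻¹ x j₀ i₀ ⬝ᵥ gram W R (redMat D x j₀) ε *ᵥ
      redDir (gram W R (redMat D x j₀) ε)⁻¹ x j₀ i₀ ≤
      y ⬝ᵥ gram W R (redMat D x j₀) ε *ᵥ y := by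
  have hmin := hQ.inv_diag_mul_le y i hy
  have hpos : ∀ i, 0 < (gram W R (redMat D x j₀) ε)⁻¹ i i := fun i => hQ.inv.diag_pos
  have hdet := (isUnit_iff_isUnit_det _).1 hQ.isUnit
  have hi₀ : i₀ ∈ (live x).erase j₀ := by
    by_contra h
    have := hmax i
    rw [redMask_of_mem hi, redMask_of_notMem h] at this
    linarith [hpos i]
  have hle := hmax i
  rw [redMask_of_mem hi, redMask_of_mem hi₀, one_mul, one_mul] at hle
  set Q := gram W R (redMat D x j₀) ε with hQdef
  set S := Q⁻¹ with hS
  have hone : redDir S x j₀ i₀ i₀ = 1 := by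
    rw [redDir, redMask_of_mem hi₀, one_mul, div_self (hpos i₀).ne']
  refine ⟨hi₀, hone, ?_⟩
  set v := redDir S x j₀ i₀ with hv
  -- `u` is the exact minimiser, with value `1 / S i₀ i₀`, and `v` is `u` restricted to the reduced
  -- coordinates. The restriction loses nothing: the reduced matrices vanish elsewhere, and `|v|² ≤
  -- |u|²`.
  let u : Fin n → ℝ := (S i₀ i₀)⁻¹ • S.col i₀
  have hvu : ∀ i, v i = redMask x j₀ i * u i := fun i => by
    simp only [hv, redDir, u, Pi.smul_apply, col_apply, smul_eq_mul]; ring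
  have hmul : ∀ i, redMask x j₀ i * redMask x j₀ i = redMask x j₀ i := fun i => by
    by_cases h : i ∈ (live x).erase j₀
    · rw [redMask_of_mem h]; ring
    · rw [redMask_of_notMem h]; ring
  have hsum : ∑ i, v i • redMat D x j₀ i = ∑ i, u i • redMat D x j₀ i := by
    refine Finset.sum_congr rfl fun i _ => ?_
    rw [hvu, redMat, smul_smul, smul_smul, mul_right_comm, hmul, mul_comm]
  have hvv : v ⬝ᵥ v ≤ u ⬝ᵥ u := by
    refine Finset.sum_le_sum fun i _ => ?_
    rw [hvu]
    by_cases h : i ∈ (live x).erase j₀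
    · rw [redMask_of_mem h, one_mul]
    · rw [redMask_of_notMem h, zero_mul, zero_mul]; exact mul_self_nonneg _
  have huQ : u ⬝ᵥ Q *ᵥ u = (S i₀ i₀)⁻¹ := by
    have e1 : Q *ᵥ S.col i₀ = Pi.single i₀ 1 := by
      ext j
      have : (Q *ᵥ S.col i₀) j = (Q * S) j i₀ := rfl
      rw [this, hS, mul_nonsing_inv _ hdet, one_apply, Pi.single_apply]
    simp only [u]
    rw [mulVec_smul, e1, smul_dotProduct, dotProduct_smul, dotProduct_single_one, col_apply,
      smul_eq_mul, smul_eq_mul]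
    field_simp [(hpos i₀).ne']
  have h1 : v ⬝ᵥ Q *ᵥ v ≤ u ⬝ᵥ Q *ᵥ u := by
    rw [hQdef, gram_dotProduct_mulVec, gram_dotProduct_mulVec, hsum]
    linarith [mul_le_mul_of_nonneg_left hvv hε]
  refine h1.trans ?_
  rw [huQ, inv_le_iff_one_le_mul₀ (hpos i₀)]
  have hyQ := (posSemidef_real_iff.1 hQ.posSemidef).2 y
  have := mul_le_mul_of_nonneg_right hle hyQ
  linarith

end direction

/-- A positive semidefinite matrix whose `p`-th power has trace at most `a ^ p` is at most `a`. -/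
theorem _root_.Matrix.PosSemidef.dotProduct_mulVec_le_of_trace_pow {R : Matrix (Fin w) (Fin w) ℝ}
    (hR : R.PosSemidef) {p : ℕ} (hp : p ≠ 0) {a : ℝ} (ha : 0 ≤ a) (h : (R ^ p).trace ≤ a ^ p)
    (v : Fin w → ℝ) : v ⬝ᵥ R *ᵥ v ≤ a * (v ⬝ᵥ v) := by
  obtain ⟨U, d, hU, hU', hd⟩ := hR.1.exists_diagonalization
  have hdn : ∀ i, 0 ≤ d i := by
    intro i
    have h := (hR.conjTranspose_mul_mul_same U).diag_nonneg (i := i)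
    rw [hd, conjTranspose_eq_transpose_of_trivial] at h
    have : Uᵀ * (U * diagonal d * Uᵀ) * U = diagonal d := by
      calc _ = (Uᵀ * U) * diagonal d * (Uᵀ * U) := by simp only [mul_assoc]
        _ = _ := by rw [hU, one_mul, mul_one]
    rw [this] at h
    simpa using h
  have hda : ∀ i, d i ≤ a := by
    intro i
    rw [hd, trace_conj_diagonal_pow hU hU'] at h
    have h1 : d i ^ p ≤ a ^ p :=
      (Finset.single_le_sum (fun j _ => pow_nonneg (hdn j) p) (Finset.mem_univ i)).trans h
    exact le_of_pow_le_pow_left₀ hp ha h1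
  have e : v ⬝ᵥ v = (Uᵀ *ᵥ v) ⬝ᵥ (Uᵀ *ᵥ v) := by
    rw [dotProduct_mulVec, vecMul_transpose, mulVec_mulVec, hU', one_mulVec]
  have e' : v ⬝ᵥ R *ᵥ v = (Uᵀ *ᵥ v) ⬝ᵥ diagonal d *ᵥ (Uᵀ *ᵥ v) := by
    rw [dotProduct_mulVec (Uᵀ *ᵥ v), ← mulVec_transpose, diagonal_transpose, hd]
    rw [← mulVec_mulVec, ← mulVec_mulVec, dotProduct_mulVec, ← mulVec_transpose,
      dotProduct_mulVec, ← mulVec_transpose, diagonal_transpose, dotProduct_comm, dotProduct_comm]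
  rw [e, e', dotProduct, dotProduct, Finset.mul_sum]
  refine Finset.sum_le_sum fun i _ => ?_
  rw [mulVec_diagonal]
  nlinarith [hda i, mul_self_nonneg ((Uᵀ *ᵥ v) i)]

theorem BlockFamily.abs_dotProduct_le (hD : BlockFamily q D) (i : Fin n) (v : Fin w → ℝ) :
    |v ⬝ᵥ D i *ᵥ v| ≤ v ⬝ᵥ v := by
  have h := hD.contr i v
  generalize D i *ᵥ v = s at *
  have h1 := dotProduct_self_nonneg' (v + s)
  have h2 := dotProduct_self_nonneg' (v - s)
  simp only [sub_dotProduct, dotProduct_sub, add_dotProduct, dotProduct_add,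
    dotProduct_comm s v] at h1 h2
  rw [abs_le]
  constructor <;> linarith

theorem BlockFamily.abs_sum_dotProduct_le (hD : BlockFamily q D) (y : Fin n → ℝ) (v : Fin w → ℝ) :
    |v ⬝ᵥ (∑ i, y i • D i) *ᵥ v| ≤ (∑ i, |y i|) * (v ⬝ᵥ v) := by
  rw [sum_mulVec, dotProduct_sum, Finset.sum_mul]
  refine (Finset.abs_sum_le_sum_abs _ _).trans (Finset.sum_le_sum fun i _ => ?_)
  rw [smul_mulVec, dotProduct_smul, smul_eq_mul, abs_mul]
  exact mul_le_mul_of_nonneg_left (hD.abs_dotProduct_le i v) (abs_nonneg _)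

theorem sum_abs_sq_le {y : Fin n → ℝ} {M : Finset (Fin n)} (h : ∀ i ∉ M, y i = 0) :
    (∑ i, |y i|) ^ 2 ≤ M.card * ∑ i, y i * y i := by
  have h1 : ∑ i, |y i| = ∑ i ∈ M, |y i| :=
    (Finset.sum_subset (Finset.subset_univ M) fun i _ hi => by rw [h i hi, abs_zero]).symm
  have h2 : ∑ i, y i * y i = ∑ i ∈ M, |y i| ^ 2 := by
    rw [← Finset.sum_subset (Finset.subset_univ M) fun i _ hi => by rw [h i hi, zero_mul]]
    exact Finset.sum_congr rfl fun i _ => by rw [sq_abs, sq]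
  rw [h1, h2]
  exact sq_sum_le_card_mul_sum_sq

section rate

variable {z : Fin n → ℝ} {r : ℝ}

theorem abs_add_div_le_one {i : Fin n} (hx : |x i| ≤ 1) (hz : i ∉ live x → z i = 0) (hr : 0 < r)
    (h : rate x z i ≤ r) : |x i + z i / r| ≤ 1 := by
  by_cases hi : i ∈ live x
  · have hne := mem_live.1 hi
    rw [abs_le] at hx
    have h1 : 0 < 1 - x i := by
      rcases hx.2.lt_or_eq with h | h
      · linarith
      · exact absurd (by rw [h]; norm_num) hne
    have h2 : 0 < 1 + x i := by
      rcases hx.1.lt_or_eq with h | h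
      · linarith
      · exact absurd (by rw [← h]; norm_num) hne
    obtain ⟨h3, h4⟩ := max_le_iff.1 h
    rw [div_le_iff₀ h1] at h3
    rw [div_le_iff₀ h2] at h4
    have h5 : z i / r ≤ 1 - x i := by rw [div_le_iff₀ hr]; linarith
    have h6 : -(1 + x i) ≤ z i / r := by rw [le_div_iff₀ hr]; linarith
    rw [abs_le]
    constructor <;> linarith
  · rw [hz hi, zero_div, add_zero]; exact hx

/-- A frozen coordinate has `z i = 0`, so both quotients in its rate are `0`, including a possible
`0 / 0`. It cannot attain the positive value `r`. -/
theorem mul_self_eq_one_of_rate_eq {i : Fin n} (hx : |x i| ≤ 1) (hz : i ∉ live x → z i = 0)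
    (hr : 0 < r) (h : rate x z i = r) :
    i ∈ live x ∧ (x i + z i / r) * (x i + z i / r) = 1 := by
  by_cases hi : i ∈ live x
  · refine ⟨hi, ?_⟩
    have hne := mem_live.1 hi
    rw [abs_le] at hx
    have h1 : 0 < 1 - x i := by
      rcases hx.2.lt_or_eq with h | h
      · linarith
      · exact absurd (by rw [h]; norm_num) hne
    have h2 : 0 < 1 + x i := by
      rcases hx.1.lt_or_eq with h | h
      · linarith
      · exact absurd (by rw [← h]; norm_num) hne
    rw [rate] at h
    rcases max_choice (z i / (1 - x i)) (-z i / (1 + x i)) with h' | h'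
    · rw [h', div_eq_iff h1.ne'] at h
      have : z i / r = 1 - x i := by rw [h]; field_simp
      rw [this]; ring
    · rw [h', div_eq_iff h2.ne'] at h
      have : z i / r = -(1 + x i) := by rw [div_eq_iff hr.ne']; linarith
      rw [this]; ring
  · rw [rate, hz hi] at h
    simp at h
    exact absurd h hr.ne

end rate

theorem descSign_mul_nonpos (l : ℝ) : descSign l * l ≤ 0 := by
  unfold descSign; split_ifs <;> linarith

theorem descSign_mul_self (l : ℝ) : descSign l * descSign l = 1 := by
  unfold descSign; split_ifs <;> norm_num

end Balancing

/-! ### The barrier invariant and its preservation by one step -/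

namespace Balancing

open Matrix

set_option linter.unusedSectionVars false

variable {n w q : ℕ} {D : Fin n → Matrix (Fin w) (Fin w) ℝ} {x xs : Fin n → ℝ}

/-- The parameters of a phase that starts with `N` live coordinates. -/
structure PhaseParams (n c w p q N : ℕ) (u₀ : ℝ) : Prop where
  pow : ∃ k, p = 2 ^ (k + 1)
  p_le : p ≤ 16 * n
  pos : 0 < u₀
  sq : u₀ * u₀ = 432 * p * N
  one_le_N : 1 ≤ N
  N_le : N ≤ n
  one_le_c : 1 ≤ c
  size : w ≤ 2 ^ p * c
  count : 32 * (q * w) ≤ 2 ^ p * N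

/-- The barrier controls the slack. -/
structure Barrier (D : Fin n → Matrix (Fin w) (Fin w) ℝ) (p : ℕ) (u₀ : ℝ) (xs x : Fin n → ℝ) :
    Prop where
  posDef : (slack D p u₀ x xs).PosDef
  trace_le : ((slack D p u₀ x xs)⁻¹ ^ p).trace ≤ w / u₀ ^ p

variable {c p N : ℕ} {u₀ : ℝ}

theorem PhaseParams.p_ne_zero (hP : PhaseParams n c w p q N u₀) : p ≠ 0 := by
  obtain ⟨k, rfl⟩ := hP.pow; positivity

theorem PhaseParams.two_le (hP : PhaseParams n c w p q N u₀) : ∃ h, p = 2 * h ∧ 1 ≤ h := by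
  obtain ⟨k, rfl⟩ := hP.pow
  exact ⟨2 ^ k, by ring, Nat.one_le_two_pow⟩

/-- The inverse of the slack is at most `2 √c / u₀`. -/
theorem Barrier.inv_le (hB : Barrier D p u₀ xs x) (hP : PhaseParams n c w p q N u₀)
    (v : Fin w → ℝ) :
    v ⬝ᵥ (slack D p u₀ x xs)⁻¹ *ᵥ v ≤ (2 * Real.sqrt c / u₀) * (v ⬝ᵥ v) := by
  have hu := hP.pos
  refine hB.posDef.inv.posSemidef.dotProduct_mulVec_le_of_trace_pow hP.p_ne_zero (by positivity)
    (hB.trace_le.trans ?_) v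
  rw [div_pow]
  refine div_le_div_of_nonneg_right ?_ (by positivity)
  -- As `p ≥ 2` is even, `w ≤ 2 ^ p c ≤ (2 √c) ^ p`.
  obtain ⟨h, h2, h1⟩ := hP.two_le
  have hs : (w : ℝ) ≤ 2 ^ p * c := by exact_mod_cast hP.size
  refine hs.trans ?_
  rw [mul_pow]
  refine mul_le_mul_of_nonneg_left ?_ (by positivity)
  rw [h2, pow_mul, Real.sq_sqrt (Nat.cast_nonneg _)]
  have hc : (1 : ℝ) ≤ c := by exact_mod_cast hP.one_le_c
  exact le_self_pow₀ hc (by omega)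

/-- The two smallness conditions of `PosDef.trace_inv_pow_barrier_le` for `a = 2 √c / u₀`, `b = √(N
σ)` and `du = 432 p σ / u₀`. Since `u₀² = 432 p N`, the square of the first quantity is `p c σ /
108` and the second is `2 p √c σ / N`. As `p ≤ 16 n`, a step length `σ ≤ 1 / (1024 n c)` suffices.
-/
theorem PhaseParams.step_bounds (hP : PhaseParams n c w p q N u₀) (hn : 0 < n) {σ : ℝ}
    (hσ0 : 0 ≤ σ) (hσ1 : σ * (1024 * (n * c)) ≤ 1) :
    p * (2 * Real.sqrt c / u₀ * Real.sqrt (N * σ)) ≤ 1 / 4 ∧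
      p * (2 * Real.sqrt c / u₀ * (432 * p * σ / u₀)) ≤ 1 / 12 := by
  have hu := hP.pos
  have hn' : (1 : ℝ) ≤ n := by exact_mod_cast hn
  have hc' : (1 : ℝ) ≤ c := by exact_mod_cast hP.one_le_c
  have hN' : (1 : ℝ) ≤ N := by exact_mod_cast hP.one_le_N
  have hp' : (1 : ℝ) ≤ p := by exact_mod_cast Nat.one_le_iff_ne_zero.2 hP.p_ne_zero
  have hpn : (p : ℝ) ≤ 16 * n := by exact_mod_cast hP.p_le
  have hcs := Real.mul_self_sqrt (by positivity : (0 : ℝ) ≤ c)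
  have hNs := Real.mul_self_sqrt (by positivity : (0 : ℝ) ≤ N * σ)
  have hcs0 := Real.sqrt_nonneg (c : ℝ)
  have hNs0 := Real.sqrt_nonneg (N * σ)
  have hcs1 : Real.sqrt c ≤ c := by nlinarith [Real.one_le_sqrt.2 hc']
  have h1 : p * (2 * Real.sqrt c / u₀ * Real.sqrt (N * σ)) ≤ 1 / 4 := by
    refine abs_le_of_sq_le_sq' ?_ (by norm_num) |>.2
    have : (p * (2 * Real.sqrt c / u₀ * Real.sqrt (N * σ))) ^ 2 = p * (c * σ) / 108 := by
      calc _ = p ^ 2 * 4 * (Real.sqrt c * Real.sqrt c) *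
            (Real.sqrt (N * σ) * Real.sqrt (N * σ)) / (u₀ * u₀) := by ring
        _ = _ := by rw [hcs, hNs, hP.sq]; field_simp; ring
    rw [this]
    have : p * (c * σ) ≤ 16 * n * (c * σ) := mul_le_mul_of_nonneg_right hpn (by positivity)
    nlinarith
  have h2 : p * (2 * Real.sqrt c / u₀ * (432 * p * σ / u₀)) ≤ 1 / 12 := by
    have : p * (2 * Real.sqrt c / u₀ * (432 * p * σ / u₀)) = 2 * p * Real.sqrt c * σ / N := by
      calc _ = 864 * p ^ 2 * Real.sqrt c * σ / (u₀ * u₀) := by ring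
        _ = _ := by rw [hP.sq]; field_simp; ring
    rw [this, div_le_iff₀ (by positivity)]
    have h3 : 2 * p * Real.sqrt c * σ ≤ 2 * (16 * n) * c * σ := by gcongr
    nlinarith
  exact ⟨h1, h2⟩

section step

variable (hD : BlockFamily q D) (hP : PhaseParams n c w p q N u₀) (hw : 0 < w)
  (hB : Barrier D p u₀ xs x)

include hD hP hw hB

theorem trace_pow_pos : 0 < ((slack D p u₀ x xs)⁻¹ ^ (p + 1)).trace := by
  have : Nonempty (Fin w) := ⟨⟨0, hw⟩⟩
  exact ((hB.posDef.inv.posSemidef.pow _).posDef_iff_isUnit.2 (hB.posDef.inv.isUnit.pow _)).trace_pos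

theorem gram_slack_posDef (j₀ : Fin n) :
    (gram ((slack D p u₀ x xs)⁻¹ ^ (p + 1)) (slack D p u₀ x xs)⁻¹ (redMat D x j₀)
      (((slack D p u₀ x xs)⁻¹ ^ (p + 1)).trace / u₀)).PosDef :=
  gram_posDef (hB.posDef.inv.posSemidef.pow _) hB.posDef.inv.posSemidef
    (fun i => hD.redMat_symm j₀ i) (div_pos (trace_pow_pos hD hP hw hB) hP.pos)

-- The slack has an eigenbasis supported in blocks, and its inverse is diagonal in the same basis.
omit hw in
theorem slack_inv_block {b : Fin w → Fin w} (hb : ∀ l i j, b i ≠ b j → D l i j = 0) (i j : Fin w)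
    (hij : b i ≠ b j) : (slack D p u₀ x xs)⁻¹ i j = 0 := by
  have hS : ∀ i j, b i ≠ b j → slack D p u₀ x xs i j = 0 := by
    intro i j hij
    have hne : i ≠ j := fun h => hij (h ▸ rfl)
    rw [slack, Matrix.sub_apply, Matrix.smul_apply, one_apply_ne hne, Matrix.sum_apply, smul_zero,
      zero_sub, neg_eq_zero]
    exact Finset.sum_eq_zero fun l _ => by rw [Matrix.smul_apply, hb l i j hij, smul_zero]
  obtain ⟨U, d, hU, hU', hd, hUb⟩ := hB.posDef.1.exists_block_diagonalization b hS
  have hdet := (isUnit_iff_isUnit_det _).1 hB.posDef.isUnit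
  have hdn : ∀ i, d i ≠ 0 := by
    intro i h0
    rw [hd, det_mul, det_mul, det_diagonal, Finset.prod_eq_zero (Finset.mem_univ i) h0] at hdet
    simp at hdet
  have hinv : (slack D p u₀ x xs)⁻¹ = U * diagonal (fun i => (d i)⁻¹) * Uᵀ := by
    refine inv_eq_right_inv ?_
    rw [hd]
    calc _ = U * diagonal d * (Uᵀ * U) * diagonal (fun i => (d i)⁻¹) * Uᵀ := by
          simp only [mul_assoc]
      _ = U * (diagonal d * diagonal (fun i => (d i)⁻¹)) * Uᵀ := by
          rw [hU, mul_one]; simp only [mul_assoc]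
      _ = 1 := by
          rw [diagonal_mul_diagonal]
          simp only [mul_inv_cancel₀ (hdn _)]
          rw [diagonal_one, mul_one, hU']
  rw [hinv, mul_apply]
  refine Finset.sum_eq_zero fun k _ => ?_
  rw [mul_diagonal, transpose_apply]
  by_cases hik : b i = b k
  · rw [hUb j k fun h => hij (hik.trans h.symm), mul_zero]
  · rw [hUb i k hik]; ring

-- `exists_small_direction` with threshold `θ = 2 / u₀` and regularisation `ε = T / u₀`, where `T =
-- tr R ^ (p + 1)`. The constant is `4 (4 * 2 + 1) = 36`; the regularisation is of the order of the
-- main term, so it costs only a constant factor.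
omit hw in
theorem exists_reduced_direction (hw : 0 < w) (hd2 : 2 ≤ (live x).card) (hdN : N ≤ 2 * (live x).card)
    {j₀ : Fin n} (hj₀ : IsPivot x j₀) :
    ∃ i ∈ (live x).erase j₀, ∃ y : Fin n → ℝ, y i = 1 ∧
      y ⬝ᵥ gram ((slack D p u₀ x xs)⁻¹ ^ (p + 1)) (slack D p u₀ x xs)⁻¹ (redMat D x j₀)
      (((slack D p u₀ x xs)⁻¹ ^ (p + 1)).trace / u₀) *ᵥ y ≤
      36 / u₀ * ((slack D p u₀ x xs)⁻¹ ^ (p + 1)).trace := by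
  obtain ⟨b, hbq, hb⟩ := hD.block
  have hu := hP.pos
  have hcard : ((live x).erase j₀).card = (live x).card - 1 := Finset.card_erase_of_mem hj₀.mem
  have hBb : ∀ l i j, b i ≠ b j → redMat D x j₀ l i j = 0 := by
    intro l i j hij
    simp [redMat, hb _ i j hij]
  have hcount : 2 * (q : ℝ) * (w / u₀ ^ p) ≤ ((live x).erase j₀).card * (2 / u₀) ^ p := by
    rw [div_pow, ← mul_div_assoc, ← mul_div_assoc]
    refine div_le_div_of_nonneg_right ?_ (by positivity)
    rw [hcard]
    have h1 := hP.count
    -- Two live coordinates suffice for `2 card ≤ 4 (card - 1)`, so losing the pivot is harmless.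
    have h2 : N ≤ 4 * ((live x).card - 1) := by omega
    have h3 : 2 * (q * w) ≤ ((live x).card - 1) * 2 ^ p := by
      have := Nat.mul_le_mul_left (2 ^ p) h2
      nlinarith [Nat.zero_le (q * w)]
    have : (2 * ((q : ℝ) * w)) ≤ ((live x).card - 1 : ℕ) * 2 ^ p := by exact_mod_cast h3
    linarith
  obtain ⟨i, hi, y, hy, hyQ⟩ := exists_small_direction (ε := ((slack D p u₀ x xs)⁻¹ ^ (p + 1)).trace / u₀)
    hB.posDef.inv b
    (slack_inv_block hD hP hB hb) hbq (fun i => hD.redMat_symm j₀ i) hBb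
    (fun i v => hD.redMat_contr hj₀ i v) (M := (live x).erase j₀)
    (Finset.card_pos.1 (by omega)) (by positivity) hB.trace_le hcount
    (div_pos (trace_pow_pos hD hP hw hB) hP.pos)
  refine ⟨i, hi, y, hy, hyQ.trans (le_of_eq ?_)⟩
  field_simp
  ring

set_option maxHeartbeats 1000000 in
/-- The step of the algorithm keeps the barrier. -/
theorem Barrier.step (hx : ∀ i, |x i| ≤ 1) (hd2 : 2 ≤ (live x).card)
    (hdN : N ≤ 2 * (live x).card) (hdN' : (live x).card ≤ N) {j₀ i₀ k : Fin n} (hj₀ : IsPivot x j₀)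
    {W : Matrix (Fin w) (Fin w) ℝ} {S : Matrix (Fin n) (Fin n) ℝ} {l r : ℝ} {y z x' : Fin n → ℝ}
    (hW : W = (slack D p u₀ x xs)⁻¹ ^ (p + 1))
    (hS : S = (gram W (slack D p u₀ x xs)⁻¹ (redMat D x j₀) (W.trace / u₀))⁻¹)
    (hmax : ∀ i, redMask x j₀ i * S i i ≤ redMask x j₀ i₀ * S i₀ i₀)
    (hy : y = fullDir (redDir S x j₀ i₀) x j₀) (hl : l = (W * ∑ i, y i • D i).trace)
    (hz : z = descSign l • y) (hk : ∀ i, rate x z i ≤ rate x z k)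
    (hr : r = max (Real.sqrt ((∑ i, z i * z i) * (1024 * (n * c)))) (rate x z k))
    (hx' : x' = fun i => x i + z i / r) :
    Barrier D p u₀ xs x' ∧ (∀ i, |x' i| ≤ 1) ∧ (∀ i ∉ live x, x' i = x i) ∧
      ∑ i, x i * x i ≤ ∑ i, x' i * x' i ∧
      (∑ i, x i * x i + 1 / (1024 * (n * c)) ≤ ∑ i, x' i * x' i ∨ ∃ i ∈ live x, i ∉ live x') := by
  have hu := hP.pos
  have hn : 0 < n := lt_of_lt_of_le hP.one_le_N hP.N_le
  have hn' : (1 : ℝ) ≤ n := by exact_mod_cast hn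
  have hc' : (1 : ℝ) ≤ c := by exact_mod_cast hP.one_le_c
  have hN' : (1 : ℝ) ≤ N := by exact_mod_cast hP.one_le_N
  have hp' : (1 : ℝ) ≤ p := by exact_mod_cast Nat.one_le_iff_ne_zero.2 hP.p_ne_zero
  have hpn : (p : ℝ) ≤ 16 * n := by exact_mod_cast hP.p_le
  obtain ⟨i, hi, y', hy'1, hy'Q⟩ := exists_reduced_direction hD hP hB hw hd2 hdN hj₀
  have hQ := gram_slack_posDef hD hP hw hB j₀
  have hWtr := trace_pow_pos hD hP hw hB
  have hRp := hB.posDef.inv.posSemidef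
  have hinv := hB.inv_le hP
  rw [← hW] at hy'Q hQ hWtr
  have hWp : W.PosSemidef := hW ▸ hRp.pow _
  subst hS
  set v := redDir (gram W (slack D p u₀ x xs)⁻¹ (redMat D x j₀) (W.trace / u₀))⁻¹ x j₀ i₀ with hv
  obtain ⟨hi₀, hv1, hvQ⟩ := redDir_gram_le hQ (div_pos hWtr hu).le hmax hi hy'1
  rw [← hv] at hv1 hvQ
  have hvm : ∀ i, redMask x j₀ i * v i = v i := fun i => redMask_mul_redDir _ i
  have hyz : ∀ i ∉ live x, z i = 0 := fun i hi => by
    rw [hz, Pi.smul_apply, hy, fullDir_of_notMem hj₀ hvm hi, smul_zero]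
  have hxy : ∑ i, x i * y i = 0 := by rw [hy]; exact sum_mul_fullDir hj₀ hvm
  have hxz : ∑ i, x i * z i = 0 := by
    rw [← mul_zero (descSign l), ← hxy, Finset.mul_sum]
    exact Finset.sum_congr rfl fun i _ => by rw [hz, Pi.smul_apply, smul_eq_mul]; ring
  have hzz : ∑ i, z i * z i = ∑ i, y i * y i := by
    refine Finset.sum_congr rfl fun i _ => ?_
    rw [hz, Pi.smul_apply, smul_eq_mul]
    linear_combination (y i * y i) * descSign_mul_self l
  -- The coordinate `i₀` differs from the pivot and has value `1` in `y`. Hence the bound on the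
  -- second variation is also a bound per unit of `|z|²`.
  have hyy : 1 ≤ ∑ i, z i * z i := by
    rw [hzz]
    have hyi₀ : y i₀ = 1 := by
      rw [hy, fullDir, if_neg (Finset.ne_of_mem_erase hi₀), hv1]; ring
    refine le_trans ?_ (Finset.single_le_sum (fun j _ => mul_self_nonneg (y j)) (Finset.mem_univ i₀))
    rw [hyi₀]; norm_num
  set s := ∑ i, z i * z i with hs
  have hsq : 0 < Real.sqrt (s * (1024 * (n * c))) := Real.sqrt_pos.2 (by positivity)
  have hr0 : 0 < r := hr ▸ lt_of_lt_of_le hsq (le_max_left _ _)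
  set σ := s / (r * r) with hσ
  have hσ0 : 0 < σ := by positivity
  have hσ1 : σ * (1024 * (n * c)) ≤ 1 := by
    rw [hσ, div_mul_eq_mul_div, div_le_one (by positivity)]
    have h1 : Real.sqrt (s * (1024 * (n * c))) ≤ r := hr ▸ le_max_left _ _
    have h2 := Real.mul_self_sqrt (by positivity : 0 ≤ s * (1024 * (n * c)))
    nlinarith
  have hzr : ∑ i, z i / r * (z i / r) = σ := by
    rw [hσ, hs, Finset.sum_div]
    exact Finset.sum_congr rfl fun i _ => by field_simp
  -- The cross term vanishes because `z` is orthogonal to `x`.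
  have hgrow : ∑ i, x' i * x' i = ∑ i, x i * x i + σ := by
    have : ∀ i, x' i * x' i = x i * x i + 2 / r * (x i * z i) + z i / r * (z i / r) := fun i => by
      rw [hx']; ring
    simp only [this, Finset.sum_add_distrib, ← Finset.mul_sum, hxz, hzr]
    ring
  have hkr : rate x z k ≤ r := hr ▸ le_max_right _ _
  refine ⟨?_, fun i => ?_, fun i hi => ?_, by linarith, ?_⟩
  · set Y := ∑ i, (z i / r) • D i with hY
    have hYs : Y.IsSymm := isSymm_sum_smul hD.symm _
    have hslack : slack D p u₀ x' xs = slack D p u₀ x xs + (432 * p * σ / u₀) • 1 - Y := by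
      have h1 : level p u₀ x' xs = level p u₀ x xs + 432 * p * σ / u₀ := by
        simp only [level, Finset.sum_sub_distrib, hgrow]; ring
      have h2 : ∑ i, (x' i - xs i) • D i = ∑ i, (x i - xs i) • D i + Y := by
        rw [hY, ← Finset.sum_add_distrib]
        refine Finset.sum_congr rfl fun i _ => ?_
        rw [← add_smul, hx']; congr 1; ring
      rw [slack, slack, h1, h2, add_smul]; abel
    have hYB : Y = (descSign l / r) • ∑ i, v i • redMat D x j₀ i := by
      rw [← sum_fullDir_smul hvm, ← hy, Finset.smul_sum, hY]
      refine Finset.sum_congr rfl fun i _ => ?_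
      rw [hz, Pi.smul_apply, smul_smul, smul_eq_mul]; congr 1; ring
    have hYl : Y = (descSign l / r) • ∑ i, y i • D i := by
      rw [hYB, ← sum_fullDir_smul hvm, ← hy]
    have hYQ : (W * Y * (slack D p u₀ x xs)⁻¹ * Y).trace ≤ 36 * σ / u₀ * W.trace := by
      have h1 := hvQ.trans hy'Q
      rw [gram_dotProduct_mulVec] at h1
      have h2 := mul_nonneg (div_pos hWtr hu).le (dotProduct_self_nonneg' v)
      have h3 : (W * Y * (slack D p u₀ x xs)⁻¹ * Y).trace = 1 / (r * r) *
          (W * (∑ i, v i • redMat D x j₀ i) * (slack D p u₀ x xs)⁻¹ *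
            ∑ i, v i • redMat D x j₀ i).trace := by
        rw [hYB]
        simp only [mul_smul_comm, smul_mul_assoc, trace_smul, smul_eq_mul]
        rw [← mul_assoc]
        congr 1
        rw [div_mul_div_comm, descSign_mul_self]
      rw [h3]
      have h4 : 1 / (r * r) * (W * (∑ i, v i • redMat D x j₀ i) * (slack D p u₀ x xs)⁻¹ *
            ∑ i, v i • redMat D x j₀ i).trace ≤ 1 / (r * r) * (36 / u₀ * W.trace) :=
        mul_le_mul_of_nonneg_left (by linarith) (by positivity)
      refine h4.trans ?_
      have h5 : 1 / (r * r) ≤ σ := by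
        rw [hσ]; exact div_le_div_of_nonneg_right hyy (by positivity)
      calc _ ≤ σ * (36 / u₀ * W.trace) := mul_le_mul_of_nonneg_right h5 (by positivity)
        _ = _ := by ring
    have hYb : ∀ v, |v ⬝ᵥ Y *ᵥ v| ≤ Real.sqrt (N * σ) * (v ⬝ᵥ v) := by
      intro v
      refine (hD.abs_sum_dotProduct_le _ v).trans
        (mul_le_mul_of_nonneg_right (Real.le_sqrt_of_sq_le ?_) (dotProduct_self_nonneg' v))
      refine (sum_abs_sq_le (M := live x) fun i hi => by rw [hyz i hi, zero_div]).trans ?_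
      rw [hzr]
      exact mul_le_mul_of_nonneg_right (by exact_mod_cast hdN') hσ0.le
    obtain ⟨h1, h2⟩ := hP.step_bounds hn hσ0.le hσ1
    have hNs0 := Real.sqrt_nonneg (N * σ)
    have hYtr : ((slack D p u₀ x xs)⁻¹ ^ (p + 1) * Y).trace ≤ 0 := by
      rw [← hW, hYl, mul_smul_comm, trace_smul, smul_eq_mul, ← hl, div_mul_eq_mul_div]
      exact div_nonpos_of_nonpos_of_nonneg (descSign_mul_nonpos l) hr0.le
    obtain ⟨kp, hkp⟩ := hP.pow
    -- Here `12 p τ = du` holds with equality: `12 * 36 = 432` is the source of the constant in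
    -- `level`.
    have := hB.posDef.trace_inv_pow_barrier_le (p := p) (k := kp + 1) (du := 432 * p * σ / u₀)
      (τ := 36 * σ / u₀) hYs hkp (by positivity) hinv hYb hNs0 h1 h2 hYtr (by rw [← hW]; exact hYQ)
      (le_of_eq (by ring))
    rw [← hslack] at this
    exact ⟨this.1, this.2.trans hB.trace_le⟩
  · rw [hx']; exact abs_add_div_le_one (hx i) (hyz i) hr0 ((hk i).trans hkr)
  · simp only [hx']; rw [hyz i hi, zero_div, add_zero]
  -- If the first term of the maximum decides, the step has full length `σ = 1 / (1024 n c)`; if the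
  -- second does, coordinate `k` arrives at `±1`.
  · rcases max_choice (Real.sqrt (s * (1024 * (n * c)))) (rate x z k) with h | h
    · left
      rw [hgrow, hσ]
      rw [h] at hr
      have h2 := Real.mul_self_sqrt (by positivity : 0 ≤ s * (1024 * (n * c)))
      rw [← hr] at h2
      rw [h2]
      refine le_of_eq ?_
      congr 1
      have : s ≠ 0 := by positivity
      field_simp
    · right
      rw [h] at hr
      have := mul_self_eq_one_of_rate_eq (hx k) (hyz k) hr0 hr.symm
      exact ⟨k, this.1, fun h => mem_live.1 h (by rw [hx']; exact this.2)⟩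

end step

end Balancing

/-! ### Phases: telescoping of the discrepancy, number of steps, choice of parameters -/

namespace Balancing

open Matrix

set_option linter.unusedSectionVars false

/-- The discrepancy that the algorithm allows itself while `N` coordinates are live. -/
noncomputable def allowance (K : ℝ) (N : ℕ) : ℝ := Real.sqrt (N * Real.log (K / N))

theorem four_le_log {y : ℝ} (hy : 64 ≤ y) : 4 ≤ Real.log y := by
  have h1 : Real.log 64 ≤ Real.log y := Real.log_le_log (by norm_num) hy
  have h2 : Real.log 64 = 6 * Real.log 2 := by
    rw [show (64 : ℝ) = 2 ^ 6 by norm_num, Real.log_pow]; norm_num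
  linarith [Real.log_two_gt_d9]

/-- With `L = log (K / N) ≥ 4` and `log (N / N') ≤ N / N' - 1`, one gets `N' log (K / N') ≤ N' (L -
1) + N ≤ N (L + 1) / 2 ≤ (5/8) N L`, and `5/8 < (4/5)²`. -/
theorem allowance_le_of_lt_half {K : ℝ} {N N' : ℕ} (hN' : 1 ≤ N') (hlt : 2 * N' < N)
    (hK : 64 * N ≤ K) : allowance K N' ≤ 4 / 5 * allowance K N := by
  have hN'0 : (0 : ℝ) < N' := by exact_mod_cast hN'
  have hN0 : (0 : ℝ) < N := by exact_mod_cast (by omega : 0 < N)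
  have hlt' : 2 * (N' : ℝ) < N := by exact_mod_cast hlt
  have hK0 : 0 < K := by linarith
  have hL : 4 ≤ Real.log (K / N) := four_le_log (by rw [le_div_iff₀ hN0]; linarith)
  unfold allowance
  rw [show (4 / 5 : ℝ) = Real.sqrt (16 / 25) by
    rw [show (16 / 25 : ℝ) = (4 / 5) ^ 2 by norm_num, Real.sqrt_sq (by norm_num)],
    ← Real.sqrt_mul (by norm_num)]
  refine Real.sqrt_le_sqrt ?_
  have e : Real.log (K / N') = Real.log (K / N) + Real.log (N / N') := by
    rw [← Real.log_mul (by positivity) (by positivity)]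
    congr 1
    field_simp
  have h1 : Real.log (N / N') ≤ N / N' - 1 := Real.log_le_sub_one_of_pos (by positivity)
  have h2 : N' * Real.log (N / N') ≤ N - N' := by
    calc N' * Real.log (N / N') ≤ N' * (N / N' - 1) := mul_le_mul_of_nonneg_left h1 hN'0.le
      _ = _ := by field_simp
  rw [e, mul_add]
  nlinarith

variable {n w q c p N : ℕ} {D : Fin n → Matrix (Fin w) (Fin w) ℝ} {x xs : Fin n → ℝ} {u₀ K : ℝ}

/-- The state of the main loop. -/
structure Progress (D : Fin n → Matrix (Fin w) (Fin w) ℝ) (K : ℝ) (c q N p : ℕ) (u₀ : ℝ)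
    (xs x : Fin n → ℝ) : Prop where
  params : PhaseParams n c w p q N u₀
  barrier : Barrier D p u₀ xs x
  abs_le : ∀ i, |x i| ≤ 1
  fixed : ∀ i ∉ live xs, x i = xs i
  card_xs : (live xs).card = N
  card_le : (live x).card ≤ N
  past : ∀ v, v ⬝ᵥ (∑ i, xs i • D i) *ᵥ v ≤
    360 * (allowance K n - allowance K N) * (v ⬝ᵥ v)
  le_allowance : u₀ ≤ 36 * allowance K N

/-- Positivity of the slack bounds the discrepancy of the current phase by the level. Only
coordinates live at `xs` have moved, and each adds at most `1` to `|x|² - |xs|²`; so the level is at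
most `u₀ + (432 p / u₀) N = 2 u₀`. -/
theorem Progress.sum_le (h : Progress D K c q N p u₀ xs x) (v : Fin w → ℝ) :
    v ⬝ᵥ (∑ i, x i • D i) *ᵥ v ≤
      (360 * (allowance K n - allowance K N) + 72 * allowance K N) * (v ⬝ᵥ v) := by
  have hu := h.params.pos
  have h1 := (posSemidef_real_iff.1 h.barrier.posDef.posSemidef).2 v
  have h2 := h.past v
  have h3 : ∑ i, x i • D i = ∑ i, xs i • D i + ∑ i, (x i - xs i) • D i := by
    rw [← Finset.sum_add_distrib]
    exact Finset.sum_congr rfl fun i _ => by rw [← add_smul]; congr 1; ring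
  have h4 : level p u₀ x xs ≤ 2 * u₀ := by
    have h5 : ∑ i, (x i * x i - xs i * xs i) ≤ N := by
      rw [← Finset.sum_subset (Finset.subset_univ (live xs)) fun i _ hi => by
        rw [h.fixed i hi, sub_self], ← h.card_xs, ← nsmul_one, ← Finset.sum_const]
      refine Finset.sum_le_sum fun i _ => ?_
      have := _root_.abs_le.1 (h.abs_le i)
      nlinarith [mul_self_nonneg (xs i)]
    have h6 : 432 * p / u₀ * ∑ i, (x i * x i - xs i * xs i) ≤ 432 * p / u₀ * N :=
      mul_le_mul_of_nonneg_left h5 (by positivity)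
    have h7 : 432 * p / u₀ * N = u₀ := by
      rw [div_mul_eq_mul_div, ← h.params.sq]; field_simp
    rw [level]; linarith
  rw [slack, sub_mulVec, dotProduct_sub, smul_mulVec, one_mulVec, dotProduct_smul,
    smul_eq_mul] at h1
  rw [h3, add_mulVec, dotProduct_add]
  have h8 := dotProduct_self_nonneg' v
  have h9 : level p u₀ x xs ≤ 72 * allowance K N := by linarith [h.le_allowance]
  have h10 := mul_le_mul_of_nonneg_right h9 h8
  linarith

theorem slack_self (D : Fin n → Matrix (Fin w) (Fin w) ℝ) (p : ℕ) (u₀ : ℝ) (x : Fin n → ℝ) :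
    slack D p u₀ x x = u₀ • 1 := by
  simp [slack, level]

theorem barrier_self (hu : 0 < u₀) : Barrier D p u₀ x x := by
  have e : slack D p u₀ x x = u₀ • (1 : Matrix (Fin w) (Fin w) ℝ) := slack_self D p u₀ x
  have hinv : (u₀ • (1 : Matrix (Fin w) (Fin w) ℝ))⁻¹ = u₀⁻¹ • 1 := by
    refine inv_eq_right_inv ?_
    rw [smul_mul_smul_comm, mul_one, mul_inv_cancel₀ hu.ne', one_smul]
  refine ⟨e ▸ PosDef.one.smul hu, ?_⟩
  rw [e, hinv, smul_pow, one_pow, trace_smul, trace_one, Fintype.card_fin, smul_eq_mul, inv_pow]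
  exact le_of_eq (by ring)

/-- A phase starts. -/
theorem Progress.start (hP : PhaseParams n c w p q N u₀) (hx : ∀ i, |x i| ≤ 1)
    (hN : (live x).card = N) (hu : u₀ ≤ 36 * allowance K N)
    (hpast : ∀ v, v ⬝ᵥ (∑ i, x i • D i) *ᵥ v ≤
      360 * (allowance K n - allowance K N) * (v ⬝ᵥ v)) : Progress D K c q N p u₀ x x :=
  ⟨hP, barrier_self hP.pos, hx, fun _ _ => rfl, hN, hN.le, hpast, hu⟩

/-- The bound on the past at the end of a phase. -/
theorem Progress.past_of_lt_half (h : Progress D K c q N p u₀ xs x) (hK : 64 * n ≤ K) {N' : ℕ}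
    (hN' : 1 ≤ N') (hlt : 2 * N' < N) (v : Fin w → ℝ) :
    v ⬝ᵥ (∑ i, x i • D i) *ᵥ v ≤ 360 * (allowance K n - allowance K N') * (v ⬝ᵥ v) := by
  refine (h.sum_le v).trans (mul_le_mul_of_nonneg_right ?_ (dotProduct_self_nonneg' v))
  have hNn : (N : ℝ) ≤ n := by exact_mod_cast h.params.N_le
  -- The phase costs `72 = 360 / 5` times its allowance, and the allowance drops by at least a
  -- fifth.
  linarith [allowance_le_of_lt_half (K := K) hN' hlt (by linarith)]

/-- The measure that bounds the number of steps. -/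
noncomputable def remaining (n c : ℕ) (x : Fin n → ℝ) : ℝ :=
  (n - ∑ i, x i * x i) * (1024 * (n * c)) + (live x).card

theorem remaining_nonneg (hx : ∀ i, |x i| ≤ 1) : 0 ≤ remaining n c x := by
  have : ∑ i, x i * x i ≤ n := by
    calc ∑ i, x i * x i ≤ ∑ _i : Fin n, (1 : ℝ) := Finset.sum_le_sum fun i _ => by
          have := abs_le.1 (hx i); nlinarith
      _ = n := by simp
  have : 0 ≤ n - ∑ i, x i * x i := by linarith
  unfold remaining
  positivity

theorem live_subset_of_fixed {x' : Fin n → ℝ} (h : ∀ i ∉ live x, x' i = x i) :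
    live x' ⊆ live x := by
  intro i hi
  by_contra hx
  have := mem_live.1 hi
  rw [h i hx] at this
  exact hx (mem_live.2 this)

/-- The weights in `remaining` are such that either outcome of a step, growth of `|x|²` or a newly
frozen coordinate, lowers it by at least one. -/
theorem remaining_step (hn : 0 < n) (hc : 0 < c) {x' : Fin n → ℝ}
    (hfix : ∀ i ∉ live x, x' i = x i) (hmono : ∑ i, x i * x i ≤ ∑ i, x' i * x' i)
    (h : ∑ i, x i * x i + 1 / (1024 * (n * c)) ≤ ∑ i, x' i * x' i ∨
      ∃ i ∈ live x, i ∉ live x') : remaining n c x' + 1 ≤ remaining n c x := by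
  have hsub := live_subset_of_fixed hfix
  have hpos : (0 : ℝ) < 1024 * (n * c) := by positivity
  unfold remaining
  rcases h with h | ⟨i, hi, hi'⟩
  · have h1 : ((live x').card : ℝ) ≤ (live x).card := by exact_mod_cast Finset.card_le_card hsub
    have h2 := mul_le_mul_of_nonneg_right h hpos.le
    rw [add_mul, one_div_mul_cancel hpos.ne'] at h2
    linarith
  · have h1 : ((live x').card : ℝ) + 1 ≤ (live x).card := by
      exact_mod_cast Finset.card_lt_card ⟨hsub, fun h => hi' (h hi)⟩
    have h2 := mul_le_mul_of_nonneg_right hmono hpos.le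
    linarith

/-- The parameters computed at the start of a phase are admissible. -/
theorem PhaseParams.of_minimal {m k : ℕ} (hw : w = m + m) (hc : c = n - (n - m)) (hn : 1 ≤ n)
    (hm : 1 ≤ m) (hq : 1 ≤ q) (hN1 : 1 ≤ N) (hNn : N ≤ n) (hnqm : n ≤ q * m)
    (hbig : q * m ≤ 2 ^ n * n) (hp : p = 2 ^ (k + 1)) (hcount : 64 * (q * m) ≤ 2 ^ p * N)
    (hmin : p = 2 ∨ 2 ^ (p / 2) * N < 64 * (q * m)) (hu : u₀ = Real.sqrt (432 * p * N)) :
    PhaseParams n c w p q N u₀ ∧ u₀ ≤ 36 * allowance (64 * (q * m)) N := by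
  have hp2 : 2 ≤ p := by rw [hp, pow_succ]; have := Nat.one_le_two_pow (n := k); omega
  have hp0 : 0 < p := by omega
  have hN0 : (0 : ℝ) < N := by exact_mod_cast hN1
  have hsq : u₀ * u₀ = 432 * p * N := by rw [hu, Real.mul_self_sqrt (by positivity)]
  have hqm : 1 ≤ q * m := Nat.mul_pos hq hm
  have hmqm : m ≤ q * m := Nat.le_mul_of_pos_left _ hq
  refine ⟨⟨⟨k, hp⟩, ?_, ?_, hsq, hN1, hNn, by omega, ?_, ?_⟩, ?_⟩
  · rcases hmin with h | h
    · omega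
    -- From `q m ≤ 2 ^ n n ≤ 4 ^ n` the failed test at `p / 2` gives `p / 2 < 6 + 2 n`.
    · have h1 : 2 ^ (p / 2) < 2 ^ (6 + n + n) := by
        calc 2 ^ (p / 2) ≤ 2 ^ (p / 2) * N := Nat.le_mul_of_pos_right _ hN1
          _ < 64 * (q * m) := h
          _ ≤ 64 * (2 ^ n * n) := Nat.mul_le_mul_left _ hbig
          _ ≤ 64 * (2 ^ n * 2 ^ n) := Nat.mul_le_mul_left _ (Nat.mul_le_mul_left _ Nat.lt_two_pow_self.le)
          _ = _ := by rw [pow_add, pow_add]; ring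
      have := (Nat.pow_lt_pow_iff_right (by norm_num)).1 h1
      omega
  · rw [hu]; exact Real.sqrt_pos.2 (by positivity)
  -- Here `c = min(n, m)`. For `c = n` the size bound comes from `hcount`, for `c = m` from `2 ^ p ≥
  -- 4`.
  · have h4 : 2 ^ 2 ≤ 2 ^ p := Nat.pow_le_pow_right (by norm_num) hp2
    rcases le_total n m with h | h
    · have : c = n := by omega
      have h5 : 2 ^ p * N ≤ 2 ^ p * n := Nat.mul_le_mul_left _ hNn
      rw [this]; omega
    · have : c = m := by omega
      have h5 : 2 ^ 2 * m ≤ 2 ^ p * m := Nat.mul_le_mul_right _ h4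
      rw [this]; omega
  · rw [hw, ← two_mul]
    calc 32 * (q * (2 * m)) = 64 * (q * m) := by ring
      _ ≤ _ := hcount
  · have hKN : (64 : ℝ) ≤ 64 * (q * m) / N := by
      rw [le_div_iff₀ hN0]
      have : (N : ℝ) ≤ q * m := by exact_mod_cast hNn.trans hnqm
      linarith
    have hL := four_le_log hKN
    -- By minimality `p` is at most `(2 / log 2) log (K / N)`, and `2 / log 2 < 3`. Then `432 * 3 =
    -- 36²` yields the bound on `u₀`.
    have hpL : (p : ℝ) ≤ 3 * Real.log (64 * (q * m) / N) := by
      rcases hmin with h | h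
      · rw [h]; push_cast; linarith
      · have h1 : ((2 : ℝ) ^ (p / 2)) ≤ 64 * (q * m) / N := by
          rw [le_div_iff₀ hN0]; exact_mod_cast h.le
        have h2 := Real.log_le_log (by positivity) h1
        rw [Real.log_pow] at h2
        have h3 : p = 2 * (p / 2) := by rw [hp, pow_succ]; omega
        have h4 : (p : ℝ) = 2 * ((p / 2 : ℕ) : ℝ) := by exact_mod_cast h3
        have h5 : (0 : ℝ) ≤ ((p / 2 : ℕ) : ℝ) := Nat.cast_nonneg _
        nlinarith [Real.log_two_gt_d9]
    rw [hu, allowance, show (36 : ℝ) = Real.sqrt 1296 by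
      rw [show (1296 : ℝ) = 36 ^ 2 by norm_num, Real.sqrt_sq (by norm_num)],
      ← Real.sqrt_mul (by norm_num)]
    refine Real.sqrt_le_sqrt ?_
    nlinarith

end Balancing

/-! ### The programs of the main loop and the initialisation of a phase -/

namespace RealRAM

open Balancing

theorem WP.frame_le {p : Prog} {σ : State} {t : ℕ} {Q : State → Prop} (h : WP p σ t Q)
    (is rs : List ℕ) (hi : p.intsW ⊆ is) (hr : p.realsW ⊆ rs) :
    WP p σ t (fun τ => Q τ ∧ Frame is rs σ τ) :=
  h.frame.mono le_rfl fun _ hτ => ⟨hτ.1, hτ.2.weaken hi hr⟩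

/-- Compute the mask of the live coordinates (`6`) and their number (`7`). -/
def progLive : Prog :=
  .seq (.mapVec 6 0 (.ind (.sub (.lit 1) (.mul (.at₁ 1 10) (.at₁ 1 10)))))
    (.sumScal 7 0 (.at₁ 6 13))

/-- Start a phase: store `x` (`3`), the number of live coordinates (`4`), the exponent `p` (index
scalar `6`) and the initial level (`5`). -/
def progInit : Prog :=
  .seq (.mapVec 3 0 (.at₁ 1 10))
  (.seq (.setR 4 (.var 7))
  (.seq (.setI 6 (.lit 2))
  (.seq (.setR 8 (.lit 4))
  (.seq (.while (.rlt (.mul (.var 8) (.var 4))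
      (.mul (.lit 64) (.mul (.cast (.var 2)) (.cast (.var 1)))))
    (.seq (.setR 8 (.mul (.var 8) (.var 8))) (.setI 6 (.add (.var 6) (.var 6)))))
  (.setR 5 (.sqrt (.mul (.mul (.lit 432) (.cast (.var 6))) (.var 4))))))))

/-- One step. -/
def progStep : Prog :=
  .seq progBarrier (.seq progReduce (.seq progGram (.seq progDir (.seq progMove progLive))))

/-- One step, and a new phase if most coordinates of the current one are not live any more. -/
def progBody : Prog :=
  .seq progStep (.ite (.and (.not (.rlt (.var 7) (.lit 2)))
    (.rlt (.mul (.lit 2) (.var 7)) (.var 4))) progInit .skip)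

/-- The main loop. -/
def progLoop : Prog := .while (.not (.rlt (.var 7) (.lit 2))) progBody

/-- Round the live coordinates to `1`. -/
def progRound : Prog :=
  .seq (.mapVec 16 0 (.add (.at₁ 1 10) (.mul (.at₁ 6 10) (.sub (.lit 1) (.at₁ 1 10)))))
    (.mapVec 1 0 (.at₁ 16 10))

section

variable {n m w q c p N U : ℕ} {σ : State} {D : Fin n → Matrix (Fin w) (Fin w) ℝ}
  {x xs : Fin n → ℝ} {u₀ : ℝ}

theorem WP.live (h0 : σ.ints 0 0 0 0 = n) (hn : 0 < n) (hU : n * 500 ≤ U) (hx : HasVec σ 1 x) :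
    WP progLive σ (2 * U) (fun τ =>
      (HasVec τ 6 (mask x) ∧ τ.reals 7 0 0 0 = (live x).card) ∧
      Frame [10, 11, 12, 13] [6, 7, 40] σ τ) := by
  refine WP.frame_le ?_ _ _ (by decide) (by decide)
  refine WP.seq_le U U (by linarith) ((WP.mapVec (mask x) h0 hn hU (fun τ l hτ h₁ => ?_)
    (hc := by simp [RExpr.cost, RExpr.ind, IExpr.cost])).mono le_rfl ?_)
  · simp only [RExpr.ind_eval, RExpr.eval, IExpr.eval, h₁]
    rw [hτ.2 _ (by simp), hx, mask]
    push_cast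
    by_cases h : x l * x l = 1
    · rw [if_pos h, if_pos (by rw [h, sub_self])]
    · rw [if_neg h, if_neg fun e => h (by linarith)]
  rintro τ₁ ⟨f₁, g₁⟩
  refine (WP.sumScal (mask x) _ (sum_mask x).symm (by rw [f₁.1 _ (by simp), h0]) hn hU
    (fun τ l hτ h₁ => ?_)).mono le_rfl ?_
  · simp only [RExpr.eval, IExpr.eval, h₁]
    rw [hτ.2 _ (by simp), g₁]
  rintro τ₂ ⟨f₂, g₂⟩
  exact ⟨fun i => by rw [f₂.2 _ (by simp), g₁], g₂⟩

/-- Real scalar `8` holds `2 ^ p`, so doubling `p` is a squaring, and `p` runs through powers of two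
until the count condition holds. The last failed test gives minimality up to a factor of two. -/
theorem WP.init (h0 : σ.ints 0 0 0 0 = n) (h1 : σ.ints 1 0 0 0 = m) (h2 : σ.ints 2 0 0 0 = q)
    (hn : 0 < n) (hN : 0 < N) (hbig : q * m ≤ 2 ^ n * n) (hU : n * 2000 ≤ U) (hx : HasVec σ 1 x)
    (h7 : σ.reals 7 0 0 0 = N) :
    WP progInit σ (3 * U) (fun τ => (∃ p k, τ.ints 6 0 0 0 = p ∧ p = 2 ^ (k + 1) ∧
      64 * (q * m) ≤ 2 ^ p * N ∧ (p = 2 ∨ 2 ^ (p / 2) * N < 64 * (q * m)) ∧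
      HasVec τ 3 x ∧ τ.reals 4 0 0 0 = N ∧ τ.reals 5 0 0 0 = Real.sqrt (432 * p * N)) ∧
      Frame [6, 10, 11, 12, 13] [3, 4, 5, 8, 40] σ τ) := by
  refine WP.frame_le ?_ _ _ (by decide) (by decide)
  refine WP.seq_le U (2 * U) (by linarith) ((WP.mapVec x h0 hn (by linarith)
    (fun τ l hτ h₁ => ?_)).mono le_rfl ?_)
  · simp only [RExpr.eval, IExpr.eval, h₁]
    rw [hτ.2 _ (by simp), hx]
  rintro τ₁ ⟨f₁, g₁⟩
  refine WP.seq_le 40 (2 * U - 40) (by omega) (WP.setR (by simp [RExpr.cost, IExpr.cost]) ?_)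
  refine WP.seq_le 40 (2 * U - 80) (by omega) (WP.setI (by simp [IExpr.cost]) ?_)
  refine WP.seq_le 40 (2 * U - 120) (by omega) (WP.setR (by simp [RExpr.cost]) ?_)
  generalize hτ₂ : State.setReal _ 8 0 0 0 _ = τ₂
  have f₂ : Frame [6] [4, 8] τ₁ τ₂ := by
    rw [← hτ₂]
    exact (((Frame.refl _ _ _).setReal _ _ _ _ (by simp)).setInt _ (by simp)).setReal _ _ _ _
      (by simp)
  have r8 : τ₂.reals 8 0 0 0 = 2 ^ 2 := by
    rw [← hτ₂, State.setReal_apply]; simp [RExpr.eval]; norm_num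
  have r4 : τ₂.reals 4 0 0 0 = N := by
    rw [← hτ₂, State.setReal_ne _ _ _ _ _ (by simp), State.setInt_reals, State.setReal_apply]
    simp only [and_self, if_true, RExpr.eval, IExpr.eval]
    rw [f₁.2 _ (by simp), h7]
  have i6 : τ₂.ints 6 0 0 0 = 2 := by
    rw [← hτ₂, State.setReal_ints, State.setInt_same]; rfl
  have i1 : τ₂.ints 1 0 0 0 = m := by rw [f₂.1 _ (by simp), f₁.1 _ (by simp), h1]
  have i2 : τ₂.ints 2 0 0 0 = q := by rw [f₂.1 _ (by simp), f₁.1 _ (by simp), h2]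
  have hx3 : HasVec τ₂ 3 x := fun i => by rw [f₂.2 _ (by simp), g₁]
  clear hτ₂
  have test : ∀ (p : ℕ) (τ : State), Frame [6] [8] τ₂ τ → τ.reals 8 0 0 0 = 2 ^ p →
      ((Test.rlt (.mul (.var 8) (.var 4))
        (.mul (.lit 64) (.mul (.cast (.var 2)) (.cast (.var 1))))).Holds τ ↔
        2 ^ p * N < 64 * (q * m)) := by
    intro p τ f e
    simp only [Test.Holds, RExpr.eval, IExpr.eval]
    rw [e, f.2 _ (by simp), r4, f.1 _ (by simp), i2, f.1 _ (by simp), i1]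
    push_cast
    exact_mod_cast Iff.rfl
  refine WP.seq_le (16 * n * (60 + 23 + 1) + 23 + 1) 200 (by omega) ?_
  refine (WP.whileLoop (t := 60) (K := 16 * n) (ν := fun τ => 16 * n - τ.ints 6 0 0 0)
    (I := fun τ => Frame [6] [8] τ₂ τ ∧ ∃ k, τ.ints 6 0 0 0 = 2 ^ (k + 1) ∧
      τ.reals 8 0 0 0 = 2 ^ (2 ^ (k + 1)) ∧ 2 ^ (k + 1) ≤ 16 * n ∧
      (2 ^ (k + 1) = 2 ∨ 2 ^ (2 ^ (k + 1) / 2) * N < 64 * (q * m))) ?_ ?_ ?_ ?_).mono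
      (by simp [Test.cost, RExpr.cost, IExpr.cost]) ?_
  · rintro τ ⟨-, k, e, -, h, -⟩
    rw [e, sub_nonneg]; exact_mod_cast h
  · rintro τ ⟨f, k, e, e8, hle, hmin⟩ hb
    have hb' := (test _ τ f e8).1 hb
    -- A true test bounds the current exponent by `p < 6 + 2 n`, so the doubled one is still at most
    -- `16 n`; this makes `16 n - p` a termination measure.
    have hle' : 2 * 2 ^ (k + 1) ≤ 16 * n := by
      have h1 : 2 ^ 2 ^ (k + 1) < 2 ^ (6 + n + n) := by
        calc 2 ^ 2 ^ (k + 1) ≤ 2 ^ 2 ^ (k + 1) * N := Nat.le_mul_of_pos_right _ hN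
          _ < 64 * (q * m) := hb'
          _ ≤ 64 * (2 ^ n * n) := Nat.mul_le_mul_left _ hbig
          _ ≤ 64 * (2 ^ n * 2 ^ n) :=
              Nat.mul_le_mul_left _ (Nat.mul_le_mul_left _ Nat.lt_two_pow_self.le)
          _ = _ := by rw [pow_add, pow_add]; ring
      have := (Nat.pow_lt_pow_iff_right (by norm_num)).1 h1
      omega
    refine WP.seq_le 30 30 (by norm_num) (WP.setR (by simp [RExpr.cost, IExpr.cost])
      (WP.setI (by simp [IExpr.cost]) ⟨⟨(f.setReal _ _ _ _ (by simp)).setInt _ (by simp), k + 1,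
        ?_, ?_, ?_, ?_⟩, ?_⟩))
    · simp only [State.setInt_same, IExpr.eval, State.setReal_ints, e]; ring
    · rw [State.setInt_reals, State.setReal_apply]
      simp only [and_self, if_true, RExpr.eval, IExpr.eval, e8]
      rw [← pow_add]; congr 1; ring
    · rw [pow_succ]; omega
    · right
      rwa [pow_succ, Nat.mul_div_cancel _ (by norm_num)]
    · simp only [State.setInt_same, IExpr.eval, State.setReal_ints, e]
      have : 1 ≤ 2 ^ (k + 1) := Nat.one_le_two_pow
      have : (1 : ℝ) ≤ 2 ^ (k + 1) := by exact_mod_cast this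
      push_cast
      linarith
  · refine ⟨Frame.refl _ _ _, 0, i6, r8, by omega, Or.inl rfl⟩
  · simp
  · rintro τ ⟨⟨f, k, e, e8, hle, hmin⟩, hb⟩
    rw [test _ τ f e8, not_lt] at hb
    refine WP.setR (by simp [RExpr.cost, IExpr.cost]) ⟨2 ^ (k + 1), k, ?_, rfl, hb, hmin,
      fun i => ?_, ?_, ?_⟩
    · rw [State.setReal_ints, e]
    · rw [State.setReal_ne _ _ _ _ _ (by simp), f.2 _ (by simp), hx3]
    · rw [State.setReal_ne _ _ _ _ _ (by simp), f.2 _ (by simp), r4]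
    · rw [State.setReal_apply]
      simp only [and_self, if_true, RExpr.eval, IExpr.eval]
      rw [f.2 _ (by simp), r4, e]
      norm_num

end

end RealRAM

/-! ### Correctness of one step and of the body of the main loop -/

namespace RealRAM

open Balancing

section

variable {n m w q c p N U : ℕ} {σ : State} {D : Fin n → Matrix (Fin w) (Fin w) ℝ}
  {x xs : Fin n → ℝ} {u₀ K : ℝ}

set_option maxRecDepth 4000 in
theorem WP.step (hs : Sizes σ n w c p) (hw : 0 < w) (hU : Budget n w p U)
    (hF : BlockFamily q D) (hx : HasVec σ 1 x) (hxs : HasVec σ 3 xs) (hD : HasFam σ 2 D)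
    (hu₀ : σ.reals 5 0 0 0 = u₀) (hm : HasVec σ 6 (mask x)) (hP : Progress D K c q N p u₀ xs x)
    (hd2 : 2 ≤ (Balancing.live x).card) (hdN : N ≤ 2 * (Balancing.live x).card) :
    WP progStep σ (35 * U) (fun τ => (∃ x', HasVec τ 1 x' ∧ HasVec τ 6 (mask x') ∧
      τ.reals 7 0 0 0 = (Balancing.live x').card ∧ Barrier D p u₀ xs x' ∧ (∀ i, |x' i| ≤ 1) ∧
      (∀ i ∉ Balancing.live x, x' i = x i) ∧ remaining n c x' + 1 ≤ remaining n c x) ∧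
      Frame [8, 9, 10, 11, 12, 13, 14, 15] [1, 6, 7, 10, 11, 12, 13, 14, 15, 16, 17, 18, 19, 20,
        21, 22, 23, 24, 25, 26, 27, 28, 29, 30, 31, 32, 33, 34, 35, 36, 37, 40, 41, 42, 43] σ τ) := by
  have hn : 0 < n := lt_of_lt_of_le hP.params.one_le_N hP.params.N_le
  refine WP.frame_le ?_ _ _ (by decide) (by decide)
  refine WP.seq_le (7 * U) (28 * U) (by linarith) (((WP.barrier hs hn hw hU hx hxs hD hu₀
    hP.barrier.posDef).frame_le [10, 11, 12, 13, 14] [10, 11, 12, 13, 14, 15, 37, 40, 41, 42, 43]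
    (by decide) (by decide)).mono le_rfl ?_)
  rintro τ₁ ⟨⟨gR, gW, gt⟩, f₁⟩
  have s₁ := hs.frame f₁
  have hx₁ : HasVec τ₁ 1 x := fun i => by rw [f₁.2 _ (by simp), hx]
  have hm₁ : HasVec τ₁ 6 (mask x) := fun i => by rw [f₁.2 _ (by simp), hm]
  have hD₁ : HasFam τ₁ 2 D := fun i j k => by rw [f₁.2 _ (by simp), hD]
  refine WP.seq_le (5 * U) (23 * U) (by linarith) (((WP.reduce s₁ hn hw hU hx₁ hm₁ hD₁).frame_le
    [8, 10, 11, 12, 13] [16, 17, 18, 19, 40] (by decide) (by decide)).mono le_rfl ?_)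
  rintro τ₂ ⟨⟨j₀, gj, hj, gr, gm, gB⟩, f₂⟩
  have hj₀ := isPivot_of_forall_le (Finset.card_pos.1 (by omega)) hj
  have s₂ := s₁.frame f₂
  set R := (slack D p u₀ x xs)⁻¹ with hR
  have hR₂ : HasMat τ₂ 13 R := fun i j => by rw [f₂.2 _ (by simp), gR]
  have hW₂ : HasMat τ₂ 14 (R ^ (p + 1)) := fun i j => by rw [f₂.2 _ (by simp), gW]
  refine WP.seq_le (6 * U) (17 * U) (by linarith) (((WP.gramInv s₂ hn hw hU hW₂ hR₂ gB
    (by rw [f₂.2 _ (by simp), f₁.2 _ (by simp), hu₀]) (by rw [f₂.2 _ (by simp), gt])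
    (gram_slack_posDef hF hP.params hw hP.barrier j₀)).frame_le
    [10, 11, 12, 13, 14] [20, 21, 22, 23, 24, 25, 40, 41, 42] (by decide) (by decide)).mono le_rfl ?_)
  rintro τ₃ ⟨gS, f₃⟩
  have s₃ := s₂.frame f₃
  have hW₃ : HasMat τ₃ 14 (R ^ (p + 1)) := fun i j => by rw [f₃.2 _ (by simp), hW₂]
  have hD₃ : HasFam τ₃ 2 D := fun i j k => by rw [f₃.2 _ (by simp), f₂.2 _ (by simp), hD₁]
  refine WP.seq_le (8 * U) (9 * U) (by linarith) (((WP.dir s₃ hn hw hU hW₃ gS hD₃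
    (by rw [f₃.1 _ (by simp), gj]) (fun i => by rw [f₃.2 _ (by simp), gr])
    (fun i => by rw [f₃.2 _ (by simp), gm])).frame_le
    [9, 10, 11, 12, 13] [16, 26, 27, 28, 29, 30, 31, 40] (by decide) (by decide)).mono le_rfl ?_)
  rintro τ₄ ⟨⟨i₀, hmax, gy, gl⟩, f₄⟩
  have s₄ := s₃.frame f₄
  have hx₄ : HasVec τ₄ 1 x := fun i => by
    rw [f₄.2 _ (by simp), f₃.2 _ (by simp), f₂.2 _ (by simp), hx₁]
  refine WP.seq_le (7 * U) (2 * U) (by linarith) (((WP.move s₄ hn hU hx₄ gy gl).frame_le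
    [10, 11, 12, 13, 15] [1, 32, 33, 34, 35, 36, 40] (by decide) (by decide)).mono le_rfl ?_)
  rintro τ₅ ⟨⟨k, hk, gx⟩, f₅⟩
  have s₅ := s₄.frame f₅
  obtain ⟨h1, h2, h3, h4, h5⟩ := hP.barrier.step hF hP.params hw hP.abs_le hd2 hdN
    hP.card_le hj₀ rfl rfl hmax rfl rfl rfl hk rfl rfl
  refine (WP.live s₅.n hn (hU.nn hn) gx).mono le_rfl ?_
  rintro τ₆ ⟨⟨gm', gd⟩, f₆⟩
  exact ⟨_, fun i => by rw [f₆.2 _ (by simp), gx], gm', gd, h1, h2, h3,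
    remaining_step hn hP.params.one_le_c h3 h4 h5⟩

/-- The memory during the main loop. -/
structure LoopState (D : Fin n → Matrix (Fin w) (Fin w) ℝ) (K : ℝ) (c m q : ℕ) (σ : State) :
    Prop where
  size_m : σ.ints 1 0 0 0 = m
  size_q : σ.ints 2 0 0 0 = q
  fam : HasFam σ 2 D
  mask : HasVec σ 6 (mask (outputVector n σ))
  live : σ.reals 7 0 0 0 = (live (outputVector n σ)).card
  phase : ∃ N p u₀ xs, Sizes σ n w c p ∧ HasVec σ 3 xs ∧ σ.reals 4 0 0 0 = (N : ℕ) ∧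
    σ.reals 5 0 0 0 = u₀ ∧ Progress D K c q N p u₀ xs (outputVector n σ) ∧
    (2 ≤ (Balancing.live (outputVector n σ)).card →
      N ≤ 2 * (Balancing.live (outputVector n σ)).card)

theorem HasVec.eq_outputVector (h : HasVec σ 1 x) : outputVector n σ = x := funext h

theorem two_le_iff_test {d : ℕ} (h : σ.reals 7 0 0 0 = d) :
    (Test.not (.rlt (.var 7) (.lit 2))).Holds σ ↔ 2 ≤ d := by
  simp only [Test.Holds, RExpr.eval, IExpr.eval, h, not_lt]
  norm_num

/-- A new phase starts exactly when at least two, but fewer than `N / 2`, coordinates are live. So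
every iteration is entered with `N ≤ 2 * card`, as the existence of a good direction requires; with
fewer than two live coordinates the loop stops and nothing is required. -/
theorem WP.body (hw : w = m + m) (hc : c = n - (n - m)) (hm : 1 ≤ m) (hq : 1 ≤ q)
    (hnqm : n ≤ q * m) (hbig : q * m ≤ 2 ^ n * n) (hU : ∀ p ≤ 16 * n, Budget n w p U)
    (hF : BlockFamily q D) (hσ : LoopState D (64 * (q * m)) c m q σ)
    (hb : (Test.not (.rlt (.var 7) (.lit 2))).Holds σ) :
    WP progBody σ (40 * U) (fun τ => LoopState D (64 * (q * m)) c m q τ ∧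
      remaining n c (outputVector n τ) + 1 ≤ remaining n c (outputVector n σ)) := by
  obtain ⟨N, p, u₀, xs, hs, hxs, hN, hu₀, hP, hlarge⟩ := hσ.phase
  have hd2 := (two_le_iff_test hσ.live).1 hb
  have hn : 0 < n := lt_of_lt_of_le hP.params.one_le_N hP.params.N_le
  have hUp := hU p hP.params.p_le
  have hn2 : n * 2000 ≤ U := by
    have := hUp.inv
    have h1 : n * (1 * 1) ≤ n * (n * n) := Nat.mul_le_mul_left _ (Nat.mul_le_mul hn hn)
    linarith
  have hK : (64 * n : ℝ) ≤ 64 * (q * m) := by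
    have : (n : ℝ) ≤ q * m := by exact_mod_cast hnqm
    linarith
  refine WP.seq_le (35 * U) (5 * U) (by linarith) ((WP.step (x := outputVector n σ) hs (by omega) hUp hF
    (fun _ => rfl) hxs hσ.fam hu₀ hσ.mask hP hd2 (hlarge hd2)).mono le_rfl ?_)
  rintro τ ⟨⟨x', gx, gm, gd, hB, habs, hfix, hrem⟩, f⟩
  have hsub := live_subset_of_fixed hfix
  have hcard := Finset.card_le_card hsub
  have s := hs.frame f
  have hD : HasFam τ 2 D := fun i j k => by rw [f.2 _ (by simp), hσ.fam]
  have i1 : τ.ints 1 0 0 0 = m := by rw [f.1 _ (by simp), hσ.size_m]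
  have i2 : τ.ints 2 0 0 0 = q := by rw [f.1 _ (by simp), hσ.size_q]
  have r4 : τ.reals 4 0 0 0 = N := by rw [f.2 _ (by simp), hN]
  have hfixs : ∀ i ∉ Balancing.live xs, x' i = xs i := by
    intro i hi
    have h1 : i ∉ Balancing.live (outputVector n σ) := fun h => by
      have := mem_live.1 h
      rw [hP.fixed i hi] at this
      exact hi (mem_live.2 this)
    rw [hfix i h1, hP.fixed i hi]
  have hout := HasVec.eq_outputVector gx
  refine (WP.ite (t := 3 * U) (fun hb => ?_) (fun hb => ?_)).mono ?_ (fun _ h => h)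
  · have hd2' := (two_le_iff_test gd).1 hb.1
    have hlt : 2 * (Balancing.live x').card < N := by
      have := hb.2
      simp only [Test.Holds, RExpr.eval, IExpr.eval, gd, r4] at this
      exact_mod_cast this
    refine (WP.init s.n i1 i2 hn (by omega) hbig hn2 gx gd).mono le_rfl ?_
    rintro υ ⟨⟨p', k, h6, hp', hcount, hmin, hx3, h4, h5⟩, f'⟩
    have gx' : HasVec υ 1 x' := fun i => by rw [f'.2 _ (by simp), gx]
    have hout' := HasVec.eq_outputVector gx'
    obtain ⟨hPP, hall⟩ := PhaseParams.of_minimal hw hc hn hm hq (N := (Balancing.live x').card)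
      (by omega) (by have := hP.params.N_le; omega) hnqm hbig hp' hcount hmin h5
    refine ⟨⟨by rw [f'.1 _ (by simp), i1], by rw [f'.1 _ (by simp), i2],
      fun i j k => by rw [f'.2 _ (by simp), hD], fun i => ?_, ?_, _, p', _, x',
      ⟨by rw [f'.1 _ (by simp), s.n], by rw [f'.1 _ (by simp), s.w], by rw [f'.1 _ (by simp), s.c],
        h6⟩, hx3, h4, rfl, ?_⟩, by rw [hout']; exact hrem⟩
    · rw [hout', f'.2 _ (by simp), gm]
    · rw [hout', f'.2 _ (by simp), gd]
    · rw [hout']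
      have hP' : Progress D (64 * (q * m)) c q N p u₀ xs x' := ⟨hP.params, hB, habs, hfixs,
        hP.card_xs, hcard.trans hP.card_le, hP.past, hP.le_allowance⟩
      exact ⟨Progress.start hPP habs rfl hall (hP'.past_of_lt_half hK (by omega) hlt),
        fun _ => by omega⟩
  · refine WP.skip (by omega) ⟨⟨i1, i2, hD, ?_, ?_, N, p, u₀, xs, s, ?_, r4, ?_, ?_⟩,
      by rw [hout]; exact hrem⟩
    · rw [hout]; exact gm
    · rw [hout]; exact gd
    · exact fun i => by rw [f.2 _ (by simp), hxs]
    · rw [f.2 _ (by simp), hu₀]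
    · rw [hout]
      refine ⟨⟨hP.params, hB, habs, hfixs, hP.card_xs, hcard.trans hP.card_le, hP.past,
        hP.le_allowance⟩, fun h2 => ?_⟩
      by_contra hlt
      refine hb ⟨(two_le_iff_test gd).2 h2, ?_⟩
      simp only [Test.Holds, RExpr.eval, IExpr.eval, gd, r4]
      exact_mod_cast not_le.1 hlt
  · simp only [Test.cost, RExpr.cost, IExpr.cost]
    linarith

end

end RealRAM

/-! ### Operator norm, doubling, rounding and the final bound -/

namespace Balancing

open Matrix

set_option linter.unusedSectionVars false

variable {n m q : ℕ} {A : Fin n → Matrix (Fin m) (Fin m) ℝ}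

theorem matrixOpNorm_dotProduct_le {A : Matrix (Fin m) (Fin m) ℝ} (h : matrixOpNorm A ≤ 1)
    (v : Fin m → ℝ) : (A *ᵥ v) ⬝ᵥ (A *ᵥ v) ≤ v ⬝ᵥ v := by
  have h1 := (Matrix.toEuclideanCLM (n := Fin m) (𝕜 := ℝ) A).le_of_opNorm_le h (WithLp.toLp 2 v)
  rw [one_mul] at h1
  have h2 := mul_self_le_mul_self (norm_nonneg _) h1
  have e : ∀ u : EuclideanSpace ℝ (Fin m), ‖u‖ * ‖u‖ = u.ofLp ⬝ᵥ u.ofLp := by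
    intro u
    rw [← sq, EuclideanSpace.norm_sq_eq]
    refine Finset.sum_congr rfl fun i _ => ?_
    rw [Real.norm_eq_abs, sq_abs, sq]
  rw [e, e] at h2
  simpa using h2

theorem matrixOpNorm_le_of_isSymm {A : Matrix (Fin m) (Fin m) ℝ} (hA : A.IsSymm) {u : ℝ}
    (hu : 0 ≤ u) (h : ∀ v, |v ⬝ᵥ A *ᵥ v| ≤ u * (v ⬝ᵥ v)) : matrixOpNorm A ≤ u := by
  obtain ⟨U, d, hU, hU', hd⟩ :=
    (show A.IsHermitian by rw [IsHermitian, conjTranspose_eq_transpose_of_trivial, hA.eq]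
      : A.IsHermitian).exists_diagonalization
  have hdu : ∀ i, |d i| ≤ u := by
    intro i
    have h1 := h (U.col i)
    have e1 : U.col i = U *ᵥ Pi.single i 1 := by ext j; simp
    have e2 : U.col i ⬝ᵥ U.col i = 1 := by
      have : (Uᵀ * U) i i = 1 := by rw [hU, one_apply_eq]
      exact this
    have e3 : A *ᵥ U.col i = d i • U.col i := by
      rw [e1, hd, mulVec_mulVec, mul_assoc, mul_assoc, hU, mul_one, ← mulVec_mulVec]
      rw [← mulVec_smul]
      congr 1
      ext j
      rw [mulVec_diagonal, Pi.smul_apply, smul_eq_mul, Pi.single_apply]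
      split_ifs with hj
      · rw [hj]
      · rw [mul_zero, mul_zero]
    rwa [e3, dotProduct_smul, e2, smul_eq_mul, mul_one, mul_one] at h1
  refine ContinuousLinearMap.opNorm_le_bound _ hu fun v => ?_
  have e : ∀ u : EuclideanSpace ℝ (Fin m), ‖u‖ * ‖u‖ = u.ofLp ⬝ᵥ u.ofLp := by
    intro u
    rw [← sq, EuclideanSpace.norm_sq_eq]
    refine Finset.sum_congr rfl fun i _ => ?_
    rw [Real.norm_eq_abs, sq_abs, sq]
  refine abs_le_of_sq_le_sq' ?_ (by positivity) |>.2
  rw [mul_pow, sq, sq ‖v‖, e, e]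
  have e4 : (toEuclideanCLM (n := Fin m) (𝕜 := ℝ) A v).ofLp = A *ᵥ v.ofLp := by simp
  rw [e4]
  generalize v.ofLp = v
  have hiso : ∀ s : Fin m → ℝ, (U *ᵥ s) ⬝ᵥ (U *ᵥ s) = s ⬝ᵥ s := fun s => by
    rw [dotProduct_mulVec, vecMul_mulVec, ← dotProduct_mulVec, hU, one_mulVec]
  have hv : U *ᵥ (Uᵀ *ᵥ v) = v := by rw [mulVec_mulVec, hU', one_mulVec]
  have hAv : A *ᵥ v = U *ᵥ (diagonal d *ᵥ (Uᵀ *ᵥ v)) := by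
    rw [mulVec_mulVec, mulVec_mulVec, ← hd]
  rw [hAv, hiso]
  conv_rhs => rw [← hv, hiso]
  rw [dotProduct, dotProduct, Finset.mul_sum]
  refine Finset.sum_le_sum fun i _ => ?_
  rw [mulVec_diagonal]
  have h2 : d i ^ 2 ≤ u ^ 2 := sq_le_sq' (abs_le.1 (hdu i)).1 (abs_le.1 (hdu i)).2
  nlinarith [mul_self_nonneg ((Uᵀ *ᵥ v) i)]

/-- The matrix `A ⊕ -A`. -/
def double (A : Matrix (Fin m) (Fin m) ℝ) : Matrix (Fin (m + m)) (Fin (m + m)) ℝ :=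
  (fromBlocks A 0 0 (-A)).submatrix finSumFinEquiv.symm finSumFinEquiv.symm

theorem double_castAdd_castAdd (A : Matrix (Fin m) (Fin m) ℝ) (i j : Fin m) :
    double A (Fin.castAdd m i) (Fin.castAdd m j) = A i j := by
  simp only [double, submatrix_apply, finSumFinEquiv_symm_apply_castAdd, fromBlocks_apply₁₁]

theorem double_castAdd_natAdd (A : Matrix (Fin m) (Fin m) ℝ) (i j : Fin m) :
    double A (Fin.castAdd m i) (Fin.natAdd m j) = 0 := by
  simp only [double, submatrix_apply, finSumFinEquiv_symm_apply_castAdd,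
    finSumFinEquiv_symm_apply_natAdd, fromBlocks_apply₁₂, Matrix.zero_apply]

theorem double_natAdd_castAdd (A : Matrix (Fin m) (Fin m) ℝ) (i j : Fin m) :
    double A (Fin.natAdd m i) (Fin.castAdd m j) = 0 := by
  simp only [double, submatrix_apply, finSumFinEquiv_symm_apply_castAdd,
    finSumFinEquiv_symm_apply_natAdd, fromBlocks_apply₂₁, Matrix.zero_apply]

theorem double_natAdd_natAdd (A : Matrix (Fin m) (Fin m) ℝ) (i j : Fin m) :
    double A (Fin.natAdd m i) (Fin.natAdd m j) = -A i j := by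
  simp only [double, submatrix_apply, finSumFinEquiv_symm_apply_natAdd, fromBlocks_apply₂₂,
    Matrix.neg_apply]

theorem double_mulVec_castAdd (A : Matrix (Fin m) (Fin m) ℝ) (v : Fin (m + m) → ℝ) :
    (double A *ᵥ v) ∘ Fin.castAdd m = A *ᵥ (v ∘ Fin.castAdd m) := by
  ext j
  simp only [Function.comp, mulVec, dotProduct, Fin.sum_univ_add, double_castAdd_castAdd,
    double_castAdd_natAdd, zero_mul, Finset.sum_const_zero, add_zero]

theorem double_mulVec_natAdd (A : Matrix (Fin m) (Fin m) ℝ) (v : Fin (m + m) → ℝ) :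
    (double A *ᵥ v) ∘ Fin.natAdd m = -(A *ᵥ (v ∘ Fin.natAdd m)) := by
  ext j
  simp only [Function.comp, mulVec, dotProduct, Fin.sum_univ_add, double_natAdd_castAdd,
    double_natAdd_natAdd, zero_mul, Finset.sum_const_zero, zero_add, Pi.neg_apply, neg_mul,
    Finset.sum_neg_distrib]

theorem dotProduct_add_index (v v' : Fin (m + m) → ℝ) : v' ⬝ᵥ v =
    (v' ∘ Fin.castAdd m) ⬝ᵥ (v ∘ Fin.castAdd m) + (v' ∘ Fin.natAdd m) ⬝ᵥ (v ∘ Fin.natAdd m) := by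
  simp only [dotProduct, Fin.sum_univ_add, Function.comp]

theorem double_mulVec_dotProduct (A : Matrix (Fin m) (Fin m) ℝ) (v v' : Fin (m + m) → ℝ) :
    v' ⬝ᵥ double A *ᵥ v =
      (v' ∘ Fin.castAdd m) ⬝ᵥ A *ᵥ (v ∘ Fin.castAdd m) -
      (v' ∘ Fin.natAdd m) ⬝ᵥ A *ᵥ (v ∘ Fin.natAdd m) := by
  rw [dotProduct_add_index, double_mulVec_castAdd, double_mulVec_natAdd, dotProduct_neg,
    sub_eq_add_neg]

/-- The blocks are the fibres of `i ↦ i / q` in both copies, because `q ∣ m` makes the shift by `m`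
a shift by whole blocks. -/
theorem blockFamily_double (hA : ∀ i, IsQBlockDiagonal q (A i)) (h1 : ∀ i, matrixOpNorm (A i) ≤ 1)
    (hq : 1 ≤ q) (hqm : q ∣ m) : BlockFamily q fun i => double (A i) := by
  refine ⟨fun i => ?_, fun i v => ?_, ?_⟩
  · rw [double, IsSymm, transpose_submatrix, fromBlocks_transpose, (hA i).2.1.eq]
    simp [(hA i).2.1.eq]
  · rw [dotProduct_add_index, dotProduct_add_index v, double_mulVec_castAdd,
      double_mulVec_natAdd, neg_dotProduct_neg]
    exact add_le_add (matrixOpNorm_dotProduct_le (h1 i) _) (matrixOpNorm_dotProduct_le (h1 i) _)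
  · refine ⟨fun i => ⟨i / q, (Nat.div_le_self _ _).trans_lt i.2⟩, fun c => ?_, fun l => ?_⟩
    · have : (Finset.univ.filter fun i : Fin (m + m) =>
          (⟨i / q, (Nat.div_le_self _ _).trans_lt i.2⟩ : Fin (m + m)) = c).card ≤
          (Finset.Ico (c * q) (c * q + q)).card := by
        refine Finset.card_le_card_of_injOn (fun i => (i : ℕ)) (fun i hi => ?_)
          (fun i _ j _ h => Fin.ext h)
        have hi' : (i : ℕ) / q = c := by
          have := (Finset.mem_filter.1 hi).2
          rw [← this]
        simp only [Finset.coe_Ico, Set.mem_Ico]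
        rw [← hi']
        exact ⟨Nat.div_mul_le_self _ _, Nat.lt_div_mul_add hq⟩
      rwa [Nat.card_Ico, Nat.add_sub_cancel_left] at this
    · intro i j
      have hb := (hA l).2.2
      simp only [ne_eq, Fin.mk.injEq]
      refine Fin.addCases (fun i => ?_) (fun i => ?_) i <;>
        refine Fin.addCases (fun j => ?_) (fun j => ?_) j <;> intro hij
      · rw [double_castAdd_castAdd]; exact hb i j hij
      · exact double_castAdd_natAdd _ _ _
      · exact double_natAdd_castAdd _ _ _
      · rw [double_natAdd_natAdd, hb i j, neg_zero]
        intro h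
        apply hij
        obtain ⟨t, rfl⟩ := hqm
        rw [Fin.val_natAdd, Fin.val_natAdd, Nat.mul_add_div hq, Nat.mul_add_div hq, h]

/-- A quadratic bound for the doubled matrices is a bound for the operator norm. -/
theorem matrixOpNorm_sum_le_of_double (hA : ∀ i, (A i).IsSymm) (x : Fin n → ℝ) {u : ℝ} (hu : 0 ≤ u)
    (h : ∀ v, v ⬝ᵥ (∑ i, x i • double (A i)) *ᵥ v ≤ u * (v ⬝ᵥ v)) :
    matrixOpNorm (∑ i, x i • A i) ≤ u := by
  have key : ∀ v : Fin (m + m) → ℝ, v ⬝ᵥ (∑ i, x i • double (A i)) *ᵥ v =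
      (v ∘ Fin.castAdd m) ⬝ᵥ (∑ i, x i • A i) *ᵥ (v ∘ Fin.castAdd m) -
      (v ∘ Fin.natAdd m) ⬝ᵥ (∑ i, x i • A i) *ᵥ (v ∘ Fin.natAdd m) := by
    intro v
    simp only [sum_mulVec, dotProduct_sum, smul_mulVec, dotProduct_smul, double_mulVec_dotProduct,
      smul_sub, Finset.sum_sub_distrib]
  refine matrixOpNorm_le_of_isSymm (isSymm_sum_smul hA x) hu fun v => abs_le.2 ⟨?_, ?_⟩
  · have h1 := h (Fin.append 0 v)
    rw [key, dotProduct_add_index] at h1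
    have e1 : (Fin.append 0 v : Fin (m + m) → ℝ) ∘ Fin.castAdd m = 0 := by ext; simp
    have e2 : (Fin.append 0 v : Fin (m + m) → ℝ) ∘ Fin.natAdd m = v :=
      funext fun i => Fin.append_right _ _ i
    rw [e1, e2, zero_dotProduct, zero_dotProduct, zero_add, zero_sub] at h1
    linarith
  · have h1 := h (Fin.append v 0)
    rw [key, dotProduct_add_index] at h1
    have e1 : (Fin.append v 0 : Fin (m + m) → ℝ) ∘ Fin.castAdd m = v := by ext; simp
    have e2 : (Fin.append v 0 : Fin (m + m) → ℝ) ∘ Fin.natAdd m = 0 :=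
      funext fun i => Fin.append_right _ _ i
    rw [e1, e2, zero_dotProduct, zero_dotProduct, add_zero, sub_zero] at h1
    linarith

/-- The vector in which the live coordinates are replaced by `1`. -/
noncomputable def rounded (x : Fin n → ℝ) (i : Fin n) : ℝ := x i + mask x i * (1 - x i)

theorem rounded_eq (x : Fin n → ℝ) (i : Fin n) : rounded x i = -1 ∨ rounded x i = 1 := by
  by_cases h : i ∈ live x
  · right; rw [rounded, mask_of_mem h]; ring
  · rw [rounded, mask_of_notMem h, zero_mul, add_zero]
    exact (mul_self_eq_one_iff.1 (not_not.1 (mt mem_live.2 h))).symm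

/-- Each live coordinate moves by at most `2`, and every `D i` is a contraction. -/
theorem BlockFamily.sum_rounded_le {w : ℕ} {D : Fin n → Matrix (Fin w) (Fin w) ℝ}
    (hD : BlockFamily q D) {x : Fin n → ℝ} (hx : ∀ i, |x i| ≤ 1) (v : Fin w → ℝ) :
    v ⬝ᵥ (∑ i, rounded x i • D i) *ᵥ v ≤
      v ⬝ᵥ (∑ i, x i • D i) *ᵥ v + 2 * (live x).card * (v ⬝ᵥ v) := by
  have h1 := (abs_le.1 (hD.abs_sum_dotProduct_le (fun i => mask x i * (1 - x i)) v)).2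
  have h2 : ∑ i, |mask x i * (1 - x i)| ≤ 2 * (live x).card := by
    rw [← sum_mask, Finset.mul_sum]
    refine Finset.sum_le_sum fun i _ => ?_
    by_cases h : i ∈ live x
    · have := abs_le.1 (hx i)
      rw [mask_of_mem h, one_mul, abs_of_nonneg (by linarith)]; linarith
    · rw [mask_of_notMem h]; simp
  have h3 := mul_le_mul_of_nonneg_right h2 (dotProduct_self_nonneg' v)
  simp only [rounded, add_smul, Finset.sum_add_distrib, add_mulVec, dotProduct_add]
  linarith

theorem log_le_six_mul_log {y : ℝ} (hy : 1 ≤ y) : Real.log (64 * y) ≤ 6 * Real.log (2 * y) := by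
  have e : (64 : ℝ) * y ≤ (2 * y) ^ 6 := by
    have : y ≤ y ^ 6 := le_self_pow₀ hy (by norm_num)
    calc 64 * y ≤ 64 * y ^ 6 := by linarith
      _ = _ := by ring
  have h := Real.log_le_log (by linarith) e
  rwa [Real.log_pow] at h

/-- The lower bound `2` pays for rounding the last live coordinate. The upper bound comes from `64 y
≤ (2 y) ^ 6` for `y ≥ 1`, which costs a factor `√6 < 3`. -/
theorem allowance_le {m q : ℕ} (hn : 1 ≤ n) (hnqm : n ≤ q * m) :
    2 ≤ allowance (64 * (q * m)) n ∧ allowance (64 * (q * m)) n ≤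
      3 * Real.sqrt (n * Real.log (2 * q * m / n)) := by
  have hn' : (1 : ℝ) ≤ n := by exact_mod_cast hn
  have hy : 1 ≤ (q * m : ℝ) / n := by
    rw [le_div_iff₀ (by linarith), one_mul]; exact_mod_cast hnqm
  have e1 : (64 * (q * m) : ℝ) / n = 64 * (q * m / n) := by ring
  have e2 : (2 * q * m : ℝ) / n = 2 * (q * m / n) := by ring
  rw [allowance, e1, e2]
  have h4 := four_le_log (y := 64 * (q * m / n)) (by linarith)
  have h6 := log_le_six_mul_log hy
  have hpos : 0 ≤ Real.log (2 * (q * m / n) : ℝ) := Real.log_nonneg (by linarith)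
  constructor
  · refine Real.le_sqrt_of_sq_le ?_
    nlinarith
  · rw [show (3 : ℝ) = Real.sqrt 9 by
      rw [show (9 : ℝ) = 3 ^ 2 by norm_num, Real.sqrt_sq (by norm_num)],
      ← Real.sqrt_mul (by norm_num)]
    refine Real.sqrt_le_sqrt ?_
    have := mul_le_mul_of_nonneg_left h6 (by linarith : (0 : ℝ) ≤ n)
    nlinarith [mul_nonneg (by linarith : (0 : ℝ) ≤ n) hpos]

/-- The final vector of the algorithm is balanced. -/
theorem Progress.matrixOpNorm_rounded_le {c N p : ℕ} {u₀ : ℝ} {xs x : Fin n → ℝ}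
    (hA : ∀ i, (A i).IsSymm) (hF : BlockFamily q fun i => double (A i)) (hnqm : n ≤ q * m)
    (h : Progress (fun i => double (A i)) (64 * (q * m)) c q N p u₀ xs x)
    (hlive : (live x).card ≤ 1) :
    matrixOpNorm (∑ i, rounded x i • A i) ≤
      1083 * Real.sqrt (n * Real.log (2 * q * m / n)) := by
  have hn : 1 ≤ n := h.params.one_le_N.trans h.params.N_le
  obtain ⟨h1, h2⟩ := allowance_le hn hnqm
  -- All phases together cost `360` allowances and the rounding at most one more; `3 * 361 = 1083`.
  refine (matrixOpNorm_sum_le_of_double hA _ (u := 361 * allowance (64 * (q * m)) n)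
    (by linarith) fun v => ?_).trans (by linarith)
  refine (hF.sum_rounded_le h.abs_le v).trans ?_
  have h3 := h.sum_le v
  have h4 := dotProduct_self_nonneg' v
  have h5 : ((live x).card : ℝ) ≤ 1 := by exact_mod_cast hlive
  have h6 : 0 ≤ allowance (64 * (q * m)) N := Real.sqrt_nonneg _
  have h7 : 360 * (allowance (64 * (q * m)) n - allowance (64 * (q * m)) N) +
      72 * allowance (64 * (q * m)) N + 2 * (live x).card ≤ 361 * allowance (64 * (q * m)) n := by
    linarith
  have := mul_le_mul_of_nonneg_right h7 h4
  linarith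

/-- Here `log (2 q m / n) ≥ n log 2`, so the trivial bound `n` suffices. The case is treated apart
because the bound `p ≤ 16 n`, and with it the running time, needs `q m ≤ 2 ^ n n`. -/
theorem matrixOpNorm_sum_one_le (h1 : ∀ i, matrixOpNorm (A i) ≤ 1) (hn : 1 ≤ n)
    (hsmall : 2 ^ n * n < q * m) :
    matrixOpNorm (∑ i, (1 : ℝ) • A i) ≤ 1083 * Real.sqrt (n * Real.log (2 * q * m / n)) := by
  have hn' : (1 : ℝ) ≤ n := by exact_mod_cast hn
  have h2 : matrixOpNorm (∑ i, (1 : ℝ) • A i) ≤ n := by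
    simp only [one_smul, matrixOpNorm, map_sum]
    refine (norm_sum_le _ _).trans ?_
    calc _ ≤ ∑ _i : Fin n, (1 : ℝ) := Finset.sum_le_sum fun i _ => h1 i
      _ = n := by simp
  refine h2.trans ?_
  have h3 : (2 : ℝ) ^ n ≤ 2 * q * m / n := by
    rw [le_div_iff₀ (by linarith)]
    have : (2 : ℝ) ^ n * n < q * m := by exact_mod_cast hsmall
    have : (0 : ℝ) ≤ 2 ^ n * n := by positivity
    linarith
  have h4 := Real.log_le_log (by positivity) h3
  rw [Real.log_pow] at h4
  have h5 : (n : ℝ) / 2 ≤ Real.sqrt (n * Real.log (2 * q * m / n)) := by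
    refine Real.le_sqrt_of_sq_le ?_
    have := Real.log_two_gt_d9
    have h6 : (n : ℝ) * (1 / 4) ≤ n * Real.log 2 := by
      refine mul_le_mul_of_nonneg_left ?_ (by linarith); linarith
    nlinarith
  linarith

end Balancing

/-! ### The complete program and its running time -/

namespace RealRAM

open Balancing

/-- Compute the size `2 m` (index scalar `3`), `min n m` (index scalar `4`) and the doubled
matrices (`2`). -/
def progPrepare : Prog :=
  .seq (.setI 3 (.add (.var 1) (.var 1)))
  (.seq (.setI 4 (.sub (.var 0) (.sub (.var 0) (.var 1))))
  (.mapFam 2 0 3 (.sub (.at₃ 0 10 11 12)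
    (.mul (.mul (.sub (.lit 1) (.ind (.cast (.sub (.var 1) (.var 11)))))
      (.sub (.lit 1) (.ind (.cast (.sub (.var 1) (.var 12))))))
      (.get 0 (.var 10) (.sub (.var 11) (.var 1)) (.sub (.var 12) (.var 1)))))))

/-- The algorithm for `q m ≤ 2 ^ n n`. -/
def progLarge : Prog := .seq progPrepare (.seq progLive (.seq progInit (.seq progLoop progRound)))

/-- The algorithm. -/
def progBalance : Prog :=
  .seq (.setR 38 (.cast (.var 0)))
  (.seq (.for 14 (.var 0) (.setR 38 (.add (.var 38) (.var 38))))
  (.ite (.rlt (.var 38) (.mul (.cast (.var 2)) (.cast (.var 1))))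
    (.mapVec 1 0 (.lit 1)) progLarge))

section

variable {n m q c w N U : ℕ} {σ : State}

theorem WP.prepare {A : Fin n → Matrix (Fin m) (Fin m) ℝ} (h0 : σ.ints 0 0 0 0 = n)
    (h1 : σ.ints 1 0 0 0 = m) (hA : σ.reals 0 = (balancingInput q A).reals 0) (hn : 0 < n)
    (hm : 0 < m) (hU : n * (m + m) * (m + m) * 500 + 100 ≤ U) :
    WP progPrepare σ U (fun τ => (τ.ints 3 0 0 0 = m + m ∧ τ.ints 4 0 0 0 = n - (n - m) ∧
      HasFam τ 2 fun i => double (A i)) ∧ Frame [3, 4, 10, 11, 12, 13] [2, 40] σ τ) := by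
  refine WP.frame_le ?_ _ _ (by decide) (by decide)
  have hU1 : 100 ≤ U := (Nat.le_add_left _ _).trans hU
  have hU2 := Nat.le_sub_of_add_le hU
  refine WP.seq_le 50 (U - 50) (by clear hU hU2; omega) (WP.setI (by simp [IExpr.cost]) ?_)
  refine WP.seq_le 50 (U - 100) (by clear hU hU2; omega) (WP.setI (by simp [IExpr.cost]) ?_)
  generalize hτ : State.setInt _ 4 _ = τ
  have f : Frame [3, 4] [] σ τ := by
    rw [← hτ]; exact ((Frame.refl _ _ _).setInt _ (by simp)).setInt _ (by simp)
  have i3 : τ.ints 3 0 0 0 = m + m := by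
    rw [← hτ, State.setInt_ne _ _ (by simp), State.setInt_same]
    simp only [IExpr.eval, h1]
  have i4 : τ.ints 4 0 0 0 = n - (n - m) := by
    rw [← hτ, State.setInt_same]
    simp only [IExpr.eval]
    rw [State.setInt_ne _ _ (by simp), State.setInt_ne _ _ (by simp), h0, h1]
  clear hτ
  refine (WP.mapFam (fun i => double (A i)) ⟨by rw [f.1 _ (by simp), h0], i3⟩ ⟨hn, by omega⟩
    hU2 (fun υ i j k hυ h₁ h₂ h₃ => ?_)
    (hc := by simp [RExpr.cost, RExpr.ind, IExpr.cost])).mono le_rfl ?_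
  · simp only [RExpr.eval, RExpr.ind_eval, IExpr.eval, h₁, h₂, h₃]
    rw [hυ.2 _ (by simp), hυ.1 _ (by simp), f.2 _ (by simp), f.1 _ (by simp), h1, hA]
    simp only [balancingInput]
    have hl : ∀ j : Fin m, ((m - (Fin.castAdd m j : ℕ) : ℕ) : ℝ) ≠ 0 := fun j => by
      have := j.2
      rw [Fin.val_castAdd, Nat.cast_ne_zero]; omega
    have hr : ∀ j : Fin m, ((m - (Fin.natAdd m j : ℕ) : ℕ) : ℝ) = 0 := fun j => by
      rw [Fin.val_natAdd, Nat.cast_eq_zero]; omega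
    -- The truncated difference `m - j` vanishes exactly for indices in the second copy, so the
    -- product of indicators selects the lower right block. Outside the upper left block the direct
    -- read of the input is out of range and returns `0`.
    refine Fin.addCases (fun j => ?_) (fun j => ?_) j <;>
      refine Fin.addCases (fun k => ?_) (fun k => ?_) k
    · rw [if_neg (hl j), double_castAdd_castAdd, dif_pos ⟨trivial, i.2, j.2, k.2⟩]
      norm_num
    · rw [if_neg (hl j), double_castAdd_natAdd, dif_neg (by simp)]
      norm_num
    · rw [if_neg (hl k), double_natAdd_castAdd, dif_neg (by simp)]
      norm_num
    · rw [if_pos (hr j), if_pos (hr k), double_natAdd_natAdd, dif_neg (by simp)]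
      simp only [Fin.val_natAdd, Nat.add_sub_cancel_left, i.2, j.2, k.2, and_self, dite_true]
      norm_num
  · rintro υ ⟨f', g⟩
    exact ⟨by rw [f'.1 _ (by simp), i3], by rw [f'.1 _ (by simp), i4], g⟩

theorem WP.round {x : Fin n → ℝ} (h0 : σ.ints 0 0 0 0 = n) (hn : 0 < n) (hU : n * 500 ≤ U)
    (hx : HasVec σ 1 x) (hm : HasVec σ 6 (mask x)) :
    WP progRound σ (2 * U) (fun τ => HasVec τ 1 (rounded x)) := by
  refine WP.seq_le U U (by linarith) ((WP.mapVec (rounded x) h0 hn hU (fun τ l hτ h₁ => ?_)).mono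
    le_rfl ?_)
  · simp only [RExpr.eval, IExpr.eval, h₁]
    rw [hτ.2 _ (by simp), hτ.2 _ (by simp), hx, hm, rounded]
    norm_num
  rintro τ₁ ⟨f₁, g₁⟩
  refine (WP.mapVec (rounded x) (by rw [f₁.1 _ (by simp), h0]) hn hU
    (fun τ l hτ h₁ => ?_)).mono le_rfl (fun τ hτ => hτ.2)
  simp only [RExpr.eval, IExpr.eval, h₁]
  rw [hτ.2 _ (by simp), g₁]

/-- The measure `remaining` starts at no more than `1024 n² c + n`, which bounds the number of
iterations. -/
theorem WP.loop {D : Fin n → Matrix (Fin w) (Fin w) ℝ} (hw : w = m + m) (hc : c = n - (n - m))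
    (hn : 1 ≤ n) (hm : 1 ≤ m) (hq : 1 ≤ q) (hnqm : n ≤ q * m) (hbig : q * m ≤ 2 ^ n * n)
    (hU : ∀ p ≤ 16 * n, Budget n w p U) (hF : BlockFamily q D)
    (hσ : LoopState D (64 * (q * m)) c m q σ) :
    WP progLoop σ ((1024 * (n * n * c) + n) * (41 * U) + U)
      (fun τ => LoopState D (64 * (q * m)) c m q τ ∧
        (Balancing.live (outputVector n τ)).card ≤ 1) := by
  have hU1 : 1000 ≤ U := by
    have := (hU 0 (Nat.zero_le _)).inv
    have h1 : 1 * 1 * 1 ≤ n * n * n := Nat.mul_le_mul (Nat.mul_le_mul hn hn) hn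
    linarith
  refine (WP.whileLoop (t := 40 * U) (K := 1024 * (n * n * c) + n)
    (I := LoopState D (64 * (q * m)) c m q) (ν := fun τ => remaining n c (outputVector n τ))
    (fun τ hτ => ?_) (fun τ hτ hb => WP.body hw hc hm hq hnqm hbig hU hF hτ hb) hσ ?_).mono ?_ ?_
  · obtain ⟨_, _, _, _, _, _, _, _, hP, _⟩ := hτ.phase
    exact remaining_nonneg hP.abs_le
  · have h1 : 0 ≤ ∑ i, outputVector n σ i * outputVector n σ i :=
      Finset.sum_nonneg fun i _ => mul_self_nonneg _
    have h2 : ((Balancing.live (outputVector n σ)).card : ℝ) ≤ n := by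
      have := Finset.card_le_univ (Balancing.live (outputVector n σ))
      rw [Fintype.card_fin] at this
      exact_mod_cast this
    have h3 : 0 ≤ (∑ i, outputVector n σ i * outputVector n σ i) * (1024 * (n * c)) := by positivity
    rw [remaining]
    push_cast
    linarith
  · simp only [Test.cost, RExpr.cost, IExpr.cost]
    have : (1024 * (n * n * c) + n) * (40 * U + (1 + 1 + 1 + 1 + 1 + 1 + 1) + 1) ≤
        (1024 * (n * n * c) + n) * (41 * U) := Nat.mul_le_mul_left _ (by omega)
    linarith
  · rintro τ ⟨hτ, hb⟩
    rw [two_le_iff_test hτ.live] at hb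
    exact ⟨hτ, by omega⟩

theorem Progress.initial {D : Fin n → Matrix (Fin w) (Fin w) ℝ} {p : ℕ} {u₀ : ℝ}
    (hP : PhaseParams n c w p q n u₀) (hu : u₀ ≤ 36 * allowance (64 * (q * m)) n) :
    Progress D (64 * (q * m)) c q n p u₀ 0 0 :=
  Balancing.Progress.start hP (fun i => by simp) (by simp [Balancing.live]) hu
    (fun v => by simp)

theorem WP.large {A : Fin n → Matrix (Fin m) (Fin m) ℝ} (h0 : σ.ints 0 0 0 0 = n)
    (h1 : σ.ints 1 0 0 0 = m) (h2 : σ.ints 2 0 0 0 = q)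
    (hA : σ.reals 0 = (balancingInput q A).reals 0) (hx : HasVec σ 1 (0 : Fin n → ℝ)) (hn : 1 ≤ n)
    (hm : 1 ≤ m) (hq : 1 ≤ q) (hnqm : n ≤ q * m) (hbig : q * m ≤ 2 ^ n * n)
    (hU : ∀ p ≤ 16 * n, Budget n (m + m) p U) (hA' : ∀ i, IsQBlockDiagonal q (A i))
    (hA1 : ∀ i, matrixOpNorm (A i) ≤ 1) :
    WP progLarge σ ((1024 * (n * n * (n - (n - m))) + n) * (41 * U) + 10 * U) (fun τ =>
      (∀ i, outputVector n τ i = -1 ∨ outputVector n τ i = 1) ∧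
      matrixOpNorm (∑ i, outputVector n τ i • A i) ≤
        1083 * Real.sqrt (n * Real.log (2 * q * m / n))) := by
  have hF := blockFamily_double hA' hA1 hq (hA' ⟨0, hn⟩).1
  have hU0 := hU 0 (Nat.zero_le _)
  have hn1 := hU0.inv
  have hnn : n * 1 ≤ n * (n * n) := Nat.mul_le_mul_left _ (Nat.mul_le_mul hn hn)
  have hw0 : 0 < m + m := by omega
  refine WP.seq_le (2 * U) ((1024 * (n * n * (n - (n - m))) + n) * (41 * U) + 8 * U) (by linarith)
    ((WP.prepare h0 h1 hA hn hm (by have := hU0.nww hw0; linarith)).mono le_rfl ?_)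
  rintro τ₁ ⟨⟨i3, i4, gD⟩, f₁⟩
  have hx₁ : HasVec τ₁ 1 (0 : Fin n → ℝ) := fun i => by rw [f₁.2 _ (by simp), hx]
  have i0 : τ₁.ints 0 0 0 0 = n := by rw [f₁.1 _ (by simp), h0]
  refine WP.seq_le (2 * U) ((1024 * (n * n * (n - (n - m))) + n) * (41 * U) + 6 * U) (by linarith)
    ((WP.live i0 hn (by linarith) hx₁).mono le_rfl ?_)
  rintro τ₂ ⟨⟨gm, gd⟩, f₂⟩
  have hcard : (Balancing.live (0 : Fin n → ℝ)).card = n := by simp [Balancing.live]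
  rw [hcard] at gd
  have hx₂ : HasVec τ₂ 1 (0 : Fin n → ℝ) := fun i => by rw [f₂.2 _ (by simp), hx₁]
  have j0 : τ₂.ints 0 0 0 0 = n := by rw [f₂.1 _ (by simp), i0]
  have j1 : τ₂.ints 1 0 0 0 = m := by rw [f₂.1 _ (by simp), f₁.1 _ (by simp), h1]
  have j2 : τ₂.ints 2 0 0 0 = q := by rw [f₂.1 _ (by simp), f₁.1 _ (by simp), h2]
  refine WP.seq_le (3 * U) ((1024 * (n * n * (n - (n - m))) + n) * (41 * U) + 3 * U) (by linarith)
    ((WP.init j0 j1 j2 hn hn hbig (by linarith) hx₂ gd).mono le_rfl ?_)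
  rintro τ₃ ⟨⟨p, k, g6, hp, hcount, hmin, gxs, g4, g5⟩, f₃⟩
  obtain ⟨hPP, hall⟩ := PhaseParams.of_minimal rfl rfl hn hm hq hn le_rfl hnqm hbig hp hcount
    hmin g5
  have hx₃ : HasVec τ₃ 1 (0 : Fin n → ℝ) := fun i => by rw [f₃.2 _ (by simp), hx₂]
  have hout := HasVec.eq_outputVector hx₃
  have hL : LoopState (fun i => double (A i)) (64 * (q * m)) (n - (n - m)) m q τ₃ := by
    refine ⟨by rw [f₃.1 _ (by simp), j1], by rw [f₃.1 _ (by simp), j2], fun i j k => ?_, ?_, ?_,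
      n, p, _, 0, ⟨by rw [f₃.1 _ (by simp), j0], ?_, ?_, g6⟩, gxs, g4, rfl, ?_, fun _ => ?_⟩
    · rw [f₃.2 _ (by simp), f₂.2 _ (by simp), gD]
    · rw [hout]; exact fun i => by rw [f₃.2 _ (by simp), gm]
    · rw [hout, hcard, f₃.2 _ (by simp), gd]
    · rw [f₃.1 _ (by simp), f₂.1 _ (by simp), i3]
    · rw [f₃.1 _ (by simp), f₂.1 _ (by simp), i4]
    · rw [hout]; exact Progress.initial hPP hall
    · rw [hout, hcard]; omega
  refine WP.seq_le ((1024 * (n * n * (n - (n - m))) + n) * (41 * U) + U) (2 * U) (by linarith)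
    ((WP.loop rfl rfl hn hm hq hnqm hbig hU hF hL).mono le_rfl ?_)
  rintro τ₄ ⟨hL', hlive⟩
  obtain ⟨_, _, _, _, s, _, _, _, hP, _⟩ := hL'.phase
  refine (WP.round (x := outputVector n τ₄) s.n hn (by linarith) (fun _ => rfl) hL'.mask).mono
    le_rfl (fun τ hτ => ?_)
  rw [HasVec.eq_outputVector hτ]
  exact ⟨rounded_eq _, hP.matrixOpNorm_rounded_le (fun i => (hA' i).2.1) hF hnqm hlive⟩

theorem WP.balance {A : Fin n → Matrix (Fin m) (Fin m) ℝ} (hn : 1 ≤ n)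
    (hm : 1 ≤ m) (hq : 1 ≤ q) (hnqm : n ≤ q * m)
    (hU : ∀ p ≤ 16 * n, Budget n (m + m) p U) (hA' : ∀ i, IsQBlockDiagonal q (A i))
    (hA1 : ∀ i, matrixOpNorm (A i) ≤ 1) :
    WP progBalance (balancingInput q A)
      ((1024 * (n * n * (n - (n - m))) + n) * (41 * U) + 12 * U) (fun τ =>
      (∀ i, outputVector n τ i = -1 ∨ outputVector n τ i = 1) ∧
      matrixOpNorm (∑ i, outputVector n τ i • A i) ≤
        1083 * Real.sqrt (n * Real.log (2 * q * m / n))) := by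
  have hU0 := hU 0 (Nat.zero_le _)
  have hn1 := hU0.inv
  have hnn : n * 1 ≤ n * (n * n) := Nat.mul_le_mul_left _ (Nat.mul_le_mul hn hn)
  have hn2 : n * 2000 ≤ U := by linarith
  generalize hV : (1024 * (n * n * (n - (n - m))) + n) * (41 * U) + 10 * U = V
  have hV' : U ≤ V := by
    have : 0 ≤ (1024 * (n * n * (n - (n - m))) + n) * (41 * U) := Nat.zero_le _
    omega
  generalize hσ : balancingInput q A = σ
  have a0 : σ.ints 0 0 0 0 = n := by rw [← hσ]; simp [balancingInput]
  have a1 : σ.ints 1 0 0 0 = m := by rw [← hσ]; simp [balancingInput]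
  have a2 : σ.ints 2 0 0 0 = q := by rw [← hσ]; simp [balancingInput]
  have ax : HasVec σ 1 (0 : Fin n → ℝ) := fun i => by rw [← hσ]; simp [balancingInput]
  refine WP.seq_le 50 (V + 2 * U - 50) (by omega) (WP.setR (by simp [RExpr.cost, IExpr.cost]) ?_)
  generalize hτ : State.setReal _ 38 0 0 0 _ = τ
  have f : Frame [] [38] σ τ := by
    rw [← hτ]; exact (Frame.refl _ _ _).setReal _ _ _ _ (by simp)
  have r38 : τ.reals 38 0 0 0 = n := by
    rw [← hτ, State.setReal_apply]
    simp only [and_self, if_true, RExpr.eval, IExpr.eval, a0]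
  clear hτ
  refine WP.seq_le (n * (50 + 4 + 20) + 4 + 20) (V + U) (by omega) ?_
  refine (WP.for (N := n) (t := 50) (I := fun k υ => Frame [14] [38] τ υ ∧
    υ.reals 38 0 0 0 = 2 ^ k * n) ?_ (fun k _ υ hυ => ?_) ?_).mono (by simp [IExpr.cost]) ?_
  · exact ⟨(Frame.refl _ _ _).setInt _ (by simp), by rw [State.setInt_reals, r38]; ring⟩
  · simp only [IExpr.eval]
    rw [hυ.1.1 _ (by simp), f.1 _ (by simp), a0]
  · rintro k - υ ⟨hυ, e⟩ hk
    refine WP.setR (by simp [RExpr.cost, IExpr.cost]) ⟨hk,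
      (hυ.setReal _ _ _ _ (by simp)).setInt _ (by simp), ?_⟩
    rw [State.setInt_reals, State.setReal_apply]
    simp only [and_self, if_true, RExpr.eval, IExpr.eval, e]
    ring
  rintro υ ⟨fυ, e⟩
  have b0 : υ.ints 0 0 0 0 = n := by rw [fυ.1 _ (by simp), f.1 _ (by simp), a0]
  have b1 : υ.ints 1 0 0 0 = m := by rw [fυ.1 _ (by simp), f.1 _ (by simp), a1]
  have b2 : υ.ints 2 0 0 0 = q := by rw [fυ.1 _ (by simp), f.1 _ (by simp), a2]
  have test : (Test.rlt (.var 38) (.mul (.cast (.var 2)) (.cast (.var 1)))).Holds υ ↔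
      2 ^ n * n < q * m := by
    simp only [Test.Holds, RExpr.eval, IExpr.eval, e, b1, b2]
    exact_mod_cast Iff.rfl
  refine (WP.ite (t := V) (fun hb => ?_) (fun hb => ?_)).mono ?_ (fun _ h => h)
  · refine (WP.mapVec (fun _ => 1) b0 hn (by linarith) (fun τ l hτ h₁ => ?_)).mono le_rfl
      (fun τ hτ => ?_)
    · simp [RExpr.eval]
    · rw [HasVec.eq_outputVector hτ.2]
      exact ⟨fun _ => Or.inr rfl, matrixOpNorm_sum_one_le hA1 hn (test.1 hb)⟩
  · rw [← hV]
    refine WP.large b0 b1 b2 ?_ (fun i => ?_) hn hm hq hnqm (not_lt.1 (mt test.2 hb)) hU hA' hA1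
    · rw [fυ.2 _ (by simp), f.2 _ (by simp), ← hσ]
    · rw [fυ.2 _ (by simp), f.2 _ (by simp), ax]
  · simp only [Test.cost, RExpr.cost, IExpr.cost]
    omega

/-- The power of the inverse slack takes `p` products of size `w`, which with `p ≤ 16 n` costs `O(n
m³)`. The Gram table costs `O(n² m²)` and its inversion `O(n³)`. -/
theorem budget_of_le (hn : 1 ≤ n) {p : ℕ} (hp : p ≤ 16 * n) :
    Budget n (m + m) p (300000 * (n * m ^ 3 + n ^ 2 * m ^ 2 + n ^ 3)) := by
  refine ⟨?_, ?_, ?_, ?_⟩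
  · calc (p + 1) * ((m + m) * (m + m) * (m + m) * 2000)
        ≤ (17 * n) * ((m + m) * (m + m) * (m + m) * 2000) := Nat.mul_le_mul_right _ (by omega)
      _ = 272000 * (n * m ^ 3) := by ring
      _ ≤ _ := by nlinarith [Nat.zero_le (n * m ^ 3), Nat.zero_le (n ^ 2 * m ^ 2), Nat.zero_le (n ^ 3)]
  · calc n * ((m + m) * (m + m) * (m + m) * 500) = 4000 * (n * m ^ 3) := by ring
      _ ≤ _ := by nlinarith [Nat.zero_le (n * m ^ 3), Nat.zero_le (n ^ 2 * m ^ 2), Nat.zero_le (n ^ 3)]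
  · calc n * n * ((m + m) * (m + m) * 500) = 2000 * (n ^ 2 * m ^ 2) := by ring
      _ ≤ _ := by nlinarith [Nat.zero_le (n * m ^ 3), Nat.zero_le (n ^ 2 * m ^ 2), Nat.zero_le (n ^ 3)]
  · calc n * n * n * 2000 = 2000 * n ^ 3 := by ring
      _ ≤ _ := by nlinarith [Nat.zero_le (n * m ^ 3), Nat.zero_le (n ^ 2 * m ^ 2), Nat.zero_le (n ^ 3)]

/-- Each summand uses `c = min(n, m)` differently: `c ≤ n` for `n m³`, `c ≤ m` for `n² m²`, and `n c
≤ m² m` for `n³`. -/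
theorem total_cost_le (hn : 1 ≤ n) (hm : 1 ≤ m) (hnm : n ≤ m * m) :
    (1024 * (n * n * (n - (n - m))) + n) *
      (41 * (300000 * (n * m ^ 3 + n ^ 2 * m ^ 2 + n ^ 3))) +
      12 * (300000 * (n * m ^ 3 + n ^ 2 * m ^ 2 + n ^ 3)) ≤ 10 ^ 11 * (n ^ 5 + n ^ 4 * m ^ 3) := by
  obtain ⟨c, hc⟩ : ∃ c, c = n - (n - m) := ⟨_, rfl⟩
  rw [← hc]
  have hc1 : 1 ≤ c := by omega
  have hcn : c ≤ n := by omega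
  have hcm : c ≤ m := by omega
  generalize hE : n * m ^ 3 + n ^ 2 * m ^ 2 + n ^ 3 = E
  have hEc : n * n * c * E ≤ 3 * (n ^ 4 * m ^ 3) := by
    have h1 : n * n * c * (n * m ^ 3) ≤ n ^ 4 * m ^ 3 := by
      calc n * n * c * (n * m ^ 3) = n ^ 3 * m ^ 3 * c := by ring
        _ ≤ n ^ 3 * m ^ 3 * n := Nat.mul_le_mul_left _ hcn
        _ = _ := by ring
    have h2 : n * n * c * (n ^ 2 * m ^ 2) ≤ n ^ 4 * m ^ 3 := by
      calc n * n * c * (n ^ 2 * m ^ 2) = n ^ 4 * m ^ 2 * c := by ring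
        _ ≤ n ^ 4 * m ^ 2 * m := Nat.mul_le_mul_left _ hcm
        _ = _ := by ring
    have h3 : n * n * c * n ^ 3 ≤ n ^ 4 * m ^ 3 := by
      calc n * n * c * n ^ 3 = n ^ 4 * (n * c) := by ring
        _ ≤ n ^ 4 * (m * m * m) := Nat.mul_le_mul_left _ (Nat.mul_le_mul hnm hcm)
        _ = _ := by ring
    rw [← hE, mul_add, mul_add]
    linarith
  have h4 : n * E ≤ n * n * c * E := by
    refine Nat.mul_le_mul_right _ ?_
    calc n = n * 1 * 1 := by ring
      _ ≤ n * n * c := Nat.mul_le_mul (Nat.mul_le_mul_left _ hn) hc1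
  have h5 : E ≤ n * E := Nat.le_mul_of_pos_left _ hn
  calc (1024 * (n * n * c) + n) * (41 * (300000 * E)) + 12 * (300000 * E)
      = 12595200000 * (n * n * c * E) + 12300000 * (n * E) + 3600000 * E := by ring
    _ ≤ 12611100000 * (n * n * c * E) := by linarith
    _ ≤ 10 ^ 11 * (n ^ 5 + n ^ 4 * m ^ 3) := by
      have := Nat.zero_le (n ^ 5)
      linarith

end

end RealRAM

theorem theorem3 :
    ∃ (P : RealRAM.Prog) (C : ℝ),
      ∀ (n m q : ℕ) (A : Fin n → Matrix (Fin m) (Fin m) ℝ),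
        1 ≤ n → n ≤ q * m →
        (∀ i, IsQBlockDiagonal q (A i)) → (∀ i, matrixOpNorm (A i) ≤ 1) →
        ∃ (T : ℕ) (σ : RealRAM.State),
          RealRAM.Run P (balancingInput q A) T σ ∧
          (T : ℝ) ≤ C * ((n : ℝ) ^ 5 + (n : ℝ) ^ 4 * (m : ℝ) ^ 3) ∧
          (∀ i, outputVector n σ i = -1 ∨ outputVector n σ i = 1) ∧
          matrixOpNorm (∑ i, outputVector n σ i • A i) ≤
            C * Real.sqrt ((n : ℝ) * Real.log (2 * (q : ℝ) * (m : ℝ) / (n : ℝ))) := by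
  refine ⟨RealRAM.progBalance, 10 ^ 11, fun n m q A hn hnqm hA hA1 => ?_⟩
  have hqm : 0 < q * m := by omega
  have hq : 1 ≤ q := Nat.pos_of_mul_pos_right hqm
  have hm : 1 ≤ m := Nat.pos_of_mul_pos_left hqm
  -- This gives `n ≤ q m ≤ m²`, which the cost estimate needs for the inversion of the Gram matrix.
  have hqle : q ≤ m := Nat.le_of_dvd hm (hA ⟨0, hn⟩).1
  obtain ⟨T, σ, hrun, hT, h1, h2⟩ := RealRAM.WP.balance hn hm hq hnqm
    (fun p hp => RealRAM.budget_of_le hn hp) hA hA1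
  refine ⟨T, σ, hrun, ?_, h1, h2.trans ?_⟩
  · have := hT.trans (RealRAM.total_cost_le hn hm (hnqm.trans (Nat.mul_le_mul_right _ hqle)))
    exact_mod_cast this
  · exact mul_le_mul_of_nonneg_right (by norm_num) (Real.sqrt_nonneg _)
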